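/- Let $n,m\ge 0$ be integers and $R>0$. On $\mathbb C^{n+1|m}$, with even coordinates $z^a=x^a+iy^a$ ($0\le a\le n$) and odd coordinates $\zeta^\mu=\xi^\mu+i\eta^\mu$ ($1\le\mu\le m$), consider the Euclidean metric $\sum\big((\delta x^a)^2+(\delta y^a)^2\big)+2\sum\delta\xi^\mu\delta\eta^\mu=\sum\delta z^a\delta\bar z^a+i\sum\delta\zeta^\mu\delta\bar\zeta^\mu$. Let the supersphere $S^{2n+1|2m}_R\subset\mathbb C^{n+1|m}$ be given by $\sum z^a\bar z^a+i\sum\zeta^\mu\bar\zeta^\mu=R^2$, with the induced metric. Let $\mathbb{CP}^{n|m}_R$ be the quotient of $\mathbb C^{n+1|m}\setminus 0$ by $\mathbb C^*$, with the Fubini–Study metric, which is the real part of the Hermitian form $$R^2\,\frac{(\delta w\cdot\delta\bar w+i\,\delta\theta\cdot\delta\bar\theta)N-(\delta w\cdot\bar w+i\,\delta\theta\cdot\bar\theta)(\delta\bar w\cdot w-i\,\delta\bar\theta\cdot\theta)}{N^2},\qquad N=w\cdot\bar w+i\,\theta\cdot\bar\theta,$$ in the $k$th affine chart $w^a=z^a/z^k$,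 $\theta^\mu=\zeta^\mu/z^k$ (so that $w^k=1$ and $N$ includes the summand $1$). The Riemannian volume element of a metric $g$ is $dV=\sqrt{\operatorname{Ber}(g_{ab})}\,D(x,\xi)$ in real local coordinates, where $\operatorname{Ber}$ is the Berezinian, and the bracket $[dx\,|\,d\xi]$ of a (possibly complex) coordinate system denotes its coordinate volume element, which is multiplied by the Berezinian of the Jacobi matrix under a change of coordinates. Volumes are total Berezin integrals of the Riemannian volume elements, computed by partitions of unity. For each $k$, the formulas $z^a=Re^{i\alpha}N^{-1/2}w^a$, $\zeta^\mu=Re^{i\alpha}N^{-1/2}\theta^\mu$ define local coordinates $\alpha,w^a,\bar w^a,\theta^\mu,\bar\theta^\mu$ ($a\neq k$) on $S^{2n+1|2m}_R$, where $\alpha$ ranges over an open interval of length $2\pi$; these charts form an atlas of $S^{2n+1|2m}_R$. In these coordinates (the $n$ pairs $dw^a,d\bar w^a$ with $a\ne k$ being numbered $1,\dots,n$) $$dV_{S^{2n+1|2m}_R}=R^{2n+1-2m}\Big(\frac i2\Big)^{n-m}\frac{[d\alpha,dw^1,d\bar w^1,\ldots,dw^n,d\bar w^n\,|\,d\theta^1,d\bar\theta^1,\ldots,d\theta^m,d\bar\theta^m]}{N^{n-m+1}}=R\,d\alpha\cdot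 dV_{\mathbb{CP}^{n|m}_R},$$ where $dV_{\mathbb{CP}^{n|m}_R}$ is the Riemannian volume element of the Fubini–Study metric. Hence the total volumes satisfy $$\operatorname{vol}(S^{2n+1|2m}_R)=2\pi R\cdot\operatorname{vol}(\mathbb{CP}^{n|m}_R).$$ -/

import Mathlib

open scoped ContDiff

noncomputable section

namespace SuperHopf

/-! ## The Grassmann algebra -/

/-- The `2m` odd generators come in pairs: `(μ, 0)` stands for `ξ^μ` and `(μ, 1)` for `η^μ`
(so that `ζ^μ = ξ^μ + i η^μ` is a complex odd coordinate). -/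
abbrev OddIx (m : ℕ) : Type := Fin m × Fin 2

/-- Real coordinates on `ℂ^N`: `(a, 0)` stands for `x^a`, `(a, 1)` for `y^a`, `z^a = x^a + i y^a`. -/
abbrev CplxIx (N : ℕ) : Type := Fin N × Fin 2

/-- The (complexified) Grassmann algebra on `2m` odd generators. -/
abbrev Grass (m : ℕ) : Type := ExteriorAlgebra ℂ (OddIx m → ℂ)

section Grassmann

variable {m : ℕ}

/-- The odd generators. -/
def gen (κ : OddIx m) : Grass m := ExteriorAlgebra.ι ℂ (Pi.single κ 1)

/-- A complex number as an element of the Grassmann algebra. -/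
def scal (c : ℂ) : Grass m := algebraMap ℂ (Grass m) c

/-- The left partial derivative with respect to an odd generator. -/
def oddD (κ : OddIx m) : Grass m →ₗ[ℂ] Grass m :=
  CliffordAlgebra.contractLeft (LinearMap.proj κ : (OddIx m → ℂ) →ₗ[ℂ] ℂ)

/-- The value at `0` of the odd generators ("body", or numerical part). -/
def body (f : Grass m) : ℂ := ExteriorAlgebra.algebraMapInv f

/-- The real part of the body. -/
def rbody (f : Grass m) : ℝ := (body f).re

/-- The odd generators in the order `ξ¹, η¹, ξ², η², …`. -/
def oddList (m : ℕ) : List (OddIx m) := (List.finRange m).product (List.finRange 2)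

/-- The members of `A` in the above order. -/
def sortedList (A : Finset (OddIx m)) : List (OddIx m) := (oddList m).filter (fun κ => κ ∈ A)

/-- The monomial which is the ordered product of the generators from `A`. -/
def mono (A : Finset (OddIx m)) : Grass m := ((sortedList A).map gen).prod

/-- The coefficient of `mono A` in `f`: differentiate in the order of `A`, then take the body. -/
def coeff (A : Finset (OddIx m)) (f : Grass m) : ℂ :=
  body ((sortedList A).foldl (fun g κ => oddD κ g) f)

/-- The Berezin integral over the odd variables,
`∫ D(ξ¹,η¹,…,ξᵐ,ηᵐ) f = ∂/∂ξ¹ ∂/∂η¹ ⋯ ∂/∂ξᵐ ∂/∂ηᵐ f`. -/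
def berezin (f : Grass m) : ℂ := body ((oddList m).foldr (fun κ g => oddD κ g) f)

/-- Even elements. -/
def IsEvenElt (f : Grass m) : Prop :=
  f ∈ CliffordAlgebra.evenOdd (0 : QuadraticForm ℂ (OddIx m → ℂ)) 0

/-- Odd elements. -/
def IsOddElt (f : Grass m) : Prop :=
  f ∈ CliffordAlgebra.evenOdd (0 : QuadraticForm ℂ (OddIx m → ℂ)) 1

/-- The even subalgebra of the Grassmann algebra. -/
abbrev EvenGrass (m : ℕ) : Type := CliffordAlgebra.even (0 : QuadraticForm ℂ (OddIx m → ℂ))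

theorem ι_mul_ι_commute (a b : OddIx m → ℂ) (y : Grass m) :
    Commute (ExteriorAlgebra.ι ℂ a * ExteriorAlgebra.ι ℂ b) y := by
  have hs : ∀ u v : OddIx m → ℂ, (ExteriorAlgebra.ι ℂ u * ExteriorAlgebra.ι ℂ v : Grass m)
      = -(ExteriorAlgebra.ι ℂ v * ExteriorAlgebra.ι ℂ u) := fun u v =>
    eq_neg_of_add_eq_zero_left (ExteriorAlgebra.ι_add_mul_swap u v)
  induction y using ExteriorAlgebra.induction with
  | algebraMap r => exact (Algebra.commutes r _).symm
  | ι c =>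
    change _ * _ = _ * _
    rw [mul_assoc, hs b c, mul_neg, ← mul_assoc, hs a c, neg_mul, neg_neg, mul_assoc]
  | mul p q hp hq => exact hp.mul_right hq
  | add p q hp hq => exact hp.add_right hq

theorem even_mul_comm (x y : EvenGrass m) : x * y = y * x := by
  obtain ⟨x, hx⟩ := x
  replace hx : x ∈ CliffordAlgebra.evenOdd (0 : QuadraticForm ℂ (OddIx m → ℂ)) 0 := hx
  apply Subtype.ext
  change x * (y : Grass m) = (y : Grass m) * x
  have key : Commute x (y : Grass m) := by
    clear * - hx
    induction x, hx using CliffordAlgebra.even_induction with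
    | algebraMap r => exact Algebra.commutes r _
    | add p q _ _ hp hq => exact hp.add_left hq
    | ι_mul_ι_mul a b p _ hp => exact (ι_mul_ι_commute a b _).mul_left hp
  exact key

instance : CommRing (EvenGrass m) :=
  { (inferInstance : Ring (EvenGrass m)) with mul_comm := even_mul_comm }

/-- The even component of an element of the Grassmann algebra. -/
def evenPart (f : Grass m) : EvenGrass m :=
  DirectSum.decompose (CliffordAlgebra.evenOdd (0 : QuadraticForm ℂ (OddIx m → ℂ))) f 0

/-- The Berezinian `det (M₀₀ - M₀₁ M₁₁⁻¹ M₁₀) / det M₁₁` of an even supermatrix. (For such matrices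
the diagonal blocks and the Schur complement have even entries; `evenPart` only puts these entries
into the commutative ring where determinants live.) -/
def ber {I : Type*} [Fintype I] [DecidableEq I]
    (M : Matrix (I ⊕ OddIx m) (I ⊕ OddIx m) (Grass m)) : Grass m :=
  let D : Matrix (OddIx m) (OddIx m) (EvenGrass m) := M.toBlocks₂₂.map evenPart
  let Dinv : Matrix (OddIx m) (OddIx m) (Grass m) := (D⁻¹).map (fun e => (e : Grass m))
  let S : Matrix I I (EvenGrass m) :=
    (M.toBlocks₁₁ - M.toBlocks₁₂ * Dinv * M.toBlocks₂₁).map evenPart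
  ((S.det * Ring.inverse D.det : EvenGrass m) : Grass m)

/-- A function `F` of one real variable applied to an even element with real body, by means of the
(finite) Taylor expansion in the nilpotent part. -/
def superApply (F : ℝ → ℝ) (f : Grass m) : Grass m :=
  ∑ k ∈ Finset.range (2 * m + 1),
    ((iteratedDeriv k F (rbody f) / (k.factorial : ℝ) : ℝ) : ℂ) • (f - scal (body f)) ^ k

end Grassmann

/-! ## Superfunctions -/

/-- Superfunctions of even coordinates indexed by `I` and `2m` odd coordinates. -/
abbrev SFun (I : Type*) (m : ℕ) : Type _ := (I → ℝ) → Grass m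

section Functions

variable {I : Type*} [Fintype I] [DecidableEq I] {m : ℕ}

/-- Smoothness: all the coefficients of the expansion in the odd coordinates are smooth. -/
def SmoothOn (U : Set (I → ℝ)) (f : SFun I m) : Prop :=
  ∀ A, ContDiffOn ℝ ∞ (fun x => coeff A (f x)) U

/-- Left partial derivatives with respect to even (`inl`) and odd (`inr`) coordinates. -/
def pd : I ⊕ OddIx m → SFun I m → SFun I m
  | Sum.inl i, f => fun x =>
      ∑ A : Finset (OddIx m),
        (fderiv ℝ (fun y => coeff A (f y)) x (Pi.single i 1) : ℂ) • mono A
  | Sum.inr κ, f => fun x => oddD κ (f x)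

/-- The Jacobi matrix; the row index labels the coordinates, the column index the functions. -/
def jacobi {C : Type*} (Z : C → SFun I m) : Matrix (I ⊕ OddIx m) C (SFun I m) :=
  Matrix.of fun a c => pd a (Z c)

/-- The coefficient, with respect to the coordinate volume element `D(x,ξ)`, of the bracket
`[dc | dγ]` of a system `c` of `I` even and `2m` odd (possibly complex) functions. -/
def bracket (Z : I ⊕ OddIx m → SFun I m) : SFun I m := fun x => ber ((jacobi Z).map fun f => f x)

/-- Multi-variable Taylor expansion: a smooth function `f` of real variables, evaluated on even
elements `b e` with real bodies. -/
def taylor {E : Type*} [Fintype E] [DecidableEq E] (f : (E → ℝ) → ℂ) (b : E → Grass m) : Grass m :=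
  ∑ k ∈ Finset.range (2 * m + 1), ((k.factorial : ℂ)⁻¹) •
    ∑ s : Fin k → E,
      (iteratedFDeriv ℝ k f (fun e => rbody (b e)) (fun j => Pi.single (s j) 1) : ℂ) •
        (List.ofFn fun j => b (s j) - scal (body (b (s j)))).prod

/-- Substitution of even elements `a (inl e)` and odd elements `a (inr κ)` for the coordinates in a
superfunction `F`. -/
def superEval {E : Type*} [Fintype E] [DecidableEq E] {m' : ℕ}
    (F : SFun E m') (a : E ⊕ OddIx m' → Grass m) : Grass m :=
  ∑ A : Finset (OddIx m'),
    taylor (fun x => coeff A (F x)) (fun e => a (Sum.inl e)) *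
      ((sortedList A).map fun κ => a (Sum.inr κ)).prod

end Functions

/-! ## Riemannian metrics and volume elements -/

section Metrics

variable {I : Type*} [Fintype I] [DecidableEq I] {n m : ℕ}

/-- Index set of the real coordinates `x^a, y^a | ξ^μ, η^μ` of `ℂ^{n+1|m}`. -/
abbrev AmbIx (n m : ℕ) : Type := CplxIx (n + 1) ⊕ OddIx m

/-- The matrix `g_{ab}` of the Euclidean metric `Σ (δx^a)² + (δy^a)² + 2 Σ δξ^μ δη^μ`, with the
convention `δs² = δx^a δx^b g_{ba}`. -/
def euclid (n m : ℕ) : Matrix (AmbIx n m) (AmbIx n m) (SFun I m) :=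
  Matrix.fromBlocks 1 0 0
    (Matrix.of fun κ κ' => if κ.1 = κ'.1 then
      (if κ.2 = 1 ∧ κ'.2 = 0 then 1 else if κ.2 = 0 ∧ κ'.2 = 1 then -1 else 0) else 0)

/-- The supertranspose `(J_{a'}^a) ↦ ((-1)^{ã(ã'+1)} J_{a'}^a)`. -/
def superTranspose {E : Type*} (J : Matrix (I ⊕ OddIx m) (E ⊕ OddIx m) (SFun I m)) :
    Matrix (E ⊕ OddIx m) (I ⊕ OddIx m) (SFun I m) :=
  Matrix.fromBlocks J.toBlocks₁₁.transpose J.toBlocks₂₁.transpose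
    (-J.toBlocks₁₂.transpose) J.toBlocks₂₂.transpose

/-- The matrix of the metric induced from the Euclidean metric of `ℂ^{n+1|m}` by a map `Z`. -/
def inducedMetric (Z : AmbIx n m → SFun I m) :
    Matrix (I ⊕ OddIx m) (I ⊕ OddIx m) (SFun I m) :=
  jacobi Z * (euclid n m : Matrix (AmbIx n m) (AmbIx n m) (SFun I m)) * superTranspose (jacobi Z)

/-- `z^c` and `ζ^μ` of a map to `ℂ^{n+1|m}`, and their conjugates. -/
def zc (Z : AmbIx n m → SFun I m) (c : Fin (n + 1)) : SFun I m :=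
  Z (Sum.inl (c, 0)) + Complex.I • Z (Sum.inl (c, 1))
def zbar (Z : AmbIx n m → SFun I m) (c : Fin (n + 1)) : SFun I m :=
  Z (Sum.inl (c, 0)) - Complex.I • Z (Sum.inl (c, 1))
def zeta (Z : AmbIx n m → SFun I m) (μ : Fin m) : SFun I m :=
  Z (Sum.inr (μ, 0)) + Complex.I • Z (Sum.inr (μ, 1))
def zetabar (Z : AmbIx n m → SFun I m) (μ : Fin m) : SFun I m :=
  Z (Sum.inr (μ, 0)) - Complex.I • Z (Sum.inr (μ, 1))

/-- The scalar square `z·z̄ + i ζ·ζ̄`. -/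
def normSq (Z : AmbIx n m → SFun I m) : SFun I m :=
  ∑ c, zc Z c * zbar Z c + Complex.I • ∑ μ, zeta Z μ * zetabar Z μ

/-- The components of the `1`-forms `δz·z̄ + i δζ·ζ̄` and (the conjugate) `δz̄·z - i δζ̄·ζ`. -/
def radial (Z : AmbIx n m → SFun I m) (a : I ⊕ OddIx m) : SFun I m :=
  ∑ c, pd a (zc Z c) * zbar Z c + Complex.I • ∑ μ, pd a (zeta Z μ) * zetabar Z μ
def radialBar (Z : AmbIx n m → SFun I m) (a : I ⊕ OddIx m) : SFun I m :=
  ∑ c, pd a (zbar Z c) * zc Z c - Complex.I • ∑ μ, pd a (zetabar Z μ) * zeta Z μ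

/-- The Fubini–Study metric with scale factor `R`: the real part of the Hermitian form
`R² ((δz·δz̄ + i δζ·δζ̄) N - (δz·z̄ + i δζ·ζ̄)(δz̄·z - i δζ̄·ζ)) / N²`, `N = z·z̄ + i ζ·ζ̄`, in
homogeneous coordinates; these are expressed by `Z` as functions on a chart. -/
def fubiniStudy (R : ℝ) (Z : AmbIx n m → SFun I m) :
    Matrix (I ⊕ OddIx m) (I ⊕ OddIx m) (SFun I m) :=
  Matrix.of fun a b => ((R : ℂ) ^ 2) •
    (inducedMetric Z a b * (fun x => superApply (fun t => t ^ (-1 : ℤ)) (normSq Z x)) -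
      (1 / 2 : ℂ) • ((radial Z a * radialBar Z b + radialBar Z a * radial Z b) *
        (fun x => superApply (fun t => t ^ (-2 : ℤ)) (normSq Z x))))

/-- The coefficient of the Riemannian volume element `√(Ber g) D(x,ξ)` in real coordinates. -/
def riemVolume (g : Matrix (I ⊕ OddIx m) (I ⊕ OddIx m) (SFun I m)) : SFun I m :=
  fun x => superApply Real.sqrt (ber (g.map fun f => f x))

end Metrics

/-! ## Charts, the complex projective superspace and the supersphere -/

section Charts

variable {n m : ℕ}

/-- A chart with even coordinates in an open subset of `ℝ^I` and `2m` odd coordinates, given by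
a map to `ℂ^{n+1|m}`. -/
structure SuperChart (n m : ℕ) (I : Type) where
  dom : Set (I → ℝ)
  param : AmbIx n m → SFun I m

/-- The point of `ℂ^{n+1}` (in real coordinates) underlying a point of a chart. -/
def SuperChart.bodyPt {I : Type} (φ : SuperChart n m I) (x : I → ℝ) : CplxIx (n + 1) → ℝ :=
  fun e => rbody (φ.param (Sum.inl e) x)

/-- Multiplication of a complex vector, given by real and imaginary parts, by a complex number. -/
def cmul {N : Type*} {V : Type*} [AddCommGroup V] [Module ℝ V] (c : ℂ) (a : N × Fin 2 → V) :
    N × Fin 2 → V :=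
  fun p => if p.2 = 0 then c.re • a (p.1, 0) - c.im • a (p.1, 1)
    else c.im • a (p.1, 0) + c.re • a (p.1, 1)

/-- Multiplication of both the even and the odd part of a vector by a complex number. -/
def superCmul {V : Type*} [AddCommGroup V] [Module ℝ V] (c : ℂ) (a : AmbIx n m → V) :
    AmbIx n m → V :=
  Sum.elim (cmul c fun p => a (Sum.inl p)) (cmul c fun p => a (Sum.inr p))

/-- The standard coordinates of `ℂ^{n+1|m}` at a point. -/
def stdCoord (x : CplxIx (n + 1) → ℝ) : AmbIx n m → Grass m :=
  Sum.elim (fun e => scal (x e : ℂ)) gen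

/-- The affine chart `z^k = 1`, `z^a = w^a` for `a ≠ k`, `ζ^μ = θ^μ` of `CP^{n|m}`. -/
def affineCoord (k : Fin (n + 1)) : AmbIx n m → SFun (CplxIx n) m :=
  Sum.elim
    (fun p x => scal
      (k.insertNth (α := fun _ => ℂ) (if p.2 = 0 then 1 else 0) (fun b => (x (b, p.2) : ℂ)) p.1))
    (fun κ _ => gen κ)

/-- The affine charts of `CP^{n|m}`. -/
def affineChart (n m : ℕ) (k : Fin (n + 1)) : SuperChart n m (CplxIx n) where
  dom := Set.univ
  param := affineCoord k

/-- `N = w·w̄ + i θ·θ̄`, including the summand `1`. -/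
def affineN (k : Fin (n + 1)) : SFun (CplxIx n) m := normSq (affineCoord k)

/-- The even coordinates of a Hopf chart: `none` is the angle `α`; the others are those of `w`. -/
abbrev HopfIx (n : ℕ) : Type := Option (CplxIx n)

/-- The Hopf coordinates: `z^a = R e^{iα} N^{-1/2} w^a`, `ζ^μ = R e^{iα} N^{-1/2} θ^μ`, `w^k = 1`. -/
def hopfCoord (R : ℝ) (k : Fin (n + 1)) : AmbIx n m → SFun (HopfIx n) m := fun e x =>
  superApply (fun t => t ^ (-(1 / 2) : ℝ)) (affineN k fun i => x (some i)) *
    superCmul (R * Complex.exp (Complex.I * (x none : ℂ)))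
      (fun e' => affineCoord k e' fun i => x (some i)) e

/-- The Hopf charts; the angle runs over an arbitrary open interval of length `2π`. -/
def hopfChart (m : ℕ) (R : ℝ) (c : Fin (n + 1) × ℝ) : SuperChart n m (HopfIx n) where
  dom := {x | x none ∈ Set.Ioo c.2 (c.2 + 2 * Real.pi)}
  param := hopfCoord R c.1

/-- `φ` is a chart of the supersphere `z·z̄ + i ζ·ζ̄ = R²` in `ℂ^{n+1|m}`: a real smooth map of a
superdomain of dimension `2n+1|2m` to the supersphere which is injective on the underlying points,
immersive, and compatible with the orientation of the odd directions. -/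
structure IsSphereChart {I : Type} [Fintype I] [DecidableEq I] (R : ℝ) (φ : SuperChart n m I) :
    Prop where
  dim : Fintype.card I = 2 * n + 1
  isOpen : IsOpen φ.dom
  smooth : ∀ e, SmoothOn φ.dom (φ.param e)
  real : ∀ e, ∀ x ∈ φ.dom, ∀ A, (coeff A (φ.param e x)).im = 0
  even : ∀ e, ∀ x ∈ φ.dom, IsEvenElt (φ.param (Sum.inl e) x)
  odd : ∀ κ, ∀ x ∈ φ.dom, IsOddElt (φ.param (Sum.inr κ) x)
  equation : ∀ x ∈ φ.dom, normSq φ.param x = scal ((R : ℂ) ^ 2)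
  injOn : Set.InjOn φ.bodyPt φ.dom
  immersion : ∀ x ∈ φ.dom, LinearIndependent ℝ fun (i : I) (e : CplxIx (n + 1)) =>
    rbody (jacobi φ.param (Sum.inl i) (Sum.inl e) x)
  odd_pos : ∀ x ∈ φ.dom, 0 < (Matrix.of fun κ κ' : OddIx m =>
    rbody (jacobi φ.param (Sum.inr κ) (Sum.inr κ') x)).det

/-- An atlas of the supersphere of radius `R`. -/
def IsSphereAtlas {I C : Type} [Fintype I] [DecidableEq I] (R : ℝ) (𝒜 : C → SuperChart n m I) :
    Prop :=
  (∀ c, IsSphereChart R (𝒜 c)) ∧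
    ∀ z : CplxIx (n + 1) → ℝ, ∑ e, z e ^ 2 = R ^ 2 → ∃ c, ∃ x ∈ (𝒜 c).dom, (𝒜 c).bodyPt x = z

end Charts

/-! ## Integration -/

section Integration

variable {n m : ℕ} {I C : Type} [Fintype I] [DecidableEq I]

/-- The restriction of a superfunction on `ℂ^{n+1|m}` to a chart. -/
def SuperChart.pull (φ : SuperChart n m I) (F : SFun (CplxIx (n + 1)) m) : SFun I m :=
  fun x => superEval F fun e => φ.param e x

/-- A finite partition of unity, subordinate to an atlas `𝒜`. The supermanifold is either
a submanifold of `ℂ^{n+1|m} ∖ 0` (then `Γ` is trivial) or the quotient by the scalars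
`Γ = ℂ^*`. Its functions are given by the `Γ`-invariant superfunctions on `ℂ^{n+1|m} ∖ 0`, and its
points by points of `ℂ^{n+1} ∖ 0` modulo `Γ`. The function `ρ j` has compact support in the
chart `𝒜 (c j)`. -/
structure IsPartition (Γ : Subgroup ℂˣ) (𝒜 : C → SuperChart n m I) {r : ℕ}
    (c : Fin r → C) (ρ : Fin r → SFun (CplxIx (n + 1)) m) : Prop where
  smooth : ∀ j, SmoothOn {z | z ≠ 0} (ρ j)
  even : ∀ j, ∀ z, z ≠ 0 → IsEvenElt (ρ j z)
  invariant : ∀ j, ∀ l ∈ Γ, ∀ z, z ≠ 0 →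
    superEval (ρ j) (superCmul (l : ℂ) (stdCoord z)) = ρ j z
  support : ∀ j, ∃ K ⊆ (𝒜 (c j)).dom, IsCompact K ∧ ∀ d, ∀ x ∈ (𝒜 d).dom,
    (∀ l ∈ Γ, ∀ y ∈ K, (𝒜 d).bodyPt x ≠ cmul (l : ℂ) ((𝒜 (c j)).bodyPt y)) →
      (𝒜 d).pull (ρ j) x = 0
  sum_one : ∀ d, ∀ x ∈ (𝒜 d).dom, ∑ j, (𝒜 d).pull (ρ j) x = 1

/-- The Berezin integral `∫_U D(x,ξ) f(x,ξ)` over a superdomain. -/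
def chartIntegral (U : Set (I → ℝ)) (f : SFun I m) : ℂ := ∫ x in U, berezin (f x)

/-- `v` is the total integral of the volume element with coefficients `f c` in the charts of `𝒜`:
partitions of unity subordinate to `𝒜` exist, and each of them yields the value `v`. -/
def HasTotalVolume (Γ : Subgroup ℂˣ) (𝒜 : C → SuperChart n m I) (f : C → SFun I m) (v : ℂ) :
    Prop :=
  (∃ (r : ℕ) (c : Fin r → C) (ρ : Fin r → SFun (CplxIx (n + 1)) m), IsPartition Γ 𝒜 c ρ) ∧
    ∀ (r : ℕ) (c : Fin r → C) (ρ : Fin r → SFun (CplxIx (n + 1)) m), IsPartition Γ 𝒜 c ρ →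
      ∑ j, chartIntegral (𝒜 (c j)).dom ((𝒜 (c j)).pull (ρ j) * f (c j)) = v

end Integration

/-! ## The volume elements -/

section Volumes

variable {n m : ℕ}

/-- The Riemannian volume element of `CP^{n|m}_R` in the coordinates of the `k`th affine chart. -/
def cpVolumeElement (m : ℕ) (R : ℝ) (k : Fin (n + 1)) : SFun (CplxIx n) m :=
  riemVolume (fubiniStudy R (affineCoord k))

/-- The Riemannian volume element of `S^{2n+1|2m}_R` in the Hopf coordinates. -/
def sphereVolumeElement (m : ℕ) (R : ℝ) (k : Fin (n + 1)) : SFun (HopfIx n) m :=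
  riemVolume (inducedMetric (hopfCoord R k))

/-- The coordinates `α, w^a, w̄^a | θ^μ, θ̄^μ`; here `(a, 0)` labels `w^a` and `(a, 1)` labels
`w̄^a`, and similarly for the odd ones. -/
def complexHopfCoord (n m : ℕ) : HopfIx n ⊕ OddIx m → SFun (HopfIx n) m
  | Sum.inl none, x => scal (x none : ℂ)
  | Sum.inl (some (a, s)), x => scal (if s = 0 then x (some (a, 0)) + Complex.I * x (some (a, 1))
      else x (some (a, 0)) - Complex.I * x (some (a, 1)))
  | Sum.inr (μ, s), _ => if s = 0 then gen (μ, 0) + Complex.I • gen (μ, 1)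
      else gen (μ, 0) - Complex.I • gen (μ, 1)

/-- The product of the volume elements `R dα` and `f(w,θ) D(w|θ)`, which is
`R f(w,θ) D(α,w|θ)`. -/
def arcTimes (R : ℝ) (f : SFun (CplxIx n) m) : SFun (HopfIx n) m :=
  fun x => (R : ℂ) • f fun i => x (some i)

/-- `v` is the volume of `CP^{n|m}_R`. -/
def IsVolumeCP (n m : ℕ) (R v : ℝ) : Prop :=
  HasTotalVolume ⊤ (affineChart n m) (fun k => cpVolumeElement m R k) v

/-- `v` is the volume of `S^{2n+1|2m}_R`. -/
def IsVolumeSphere (n m : ℕ) (R v : ℝ) : Prop :=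
  HasTotalVolume ⊥ (hopfChart (n := n) m R) (fun c => sphereVolumeElement m R c.1) v

end Volumes

end SuperHopf

end

/-! Write `J` for multiplication by `i`, `h` for half the differential of `N`, `ω` for the pairing
with `Jw`, and `g` for the flat metric. In Hopf coordinates the rows of the Jacobi matrix are `R
e^{iα} N^{-1/2}` times the vectors `Jw` (for the angle) and `e_a - N⁻¹ h_a w` (for the other
coordinates). Phases act isometrically, `w` and `Jw` are orthogonal, and both have square `N`. Hence
the metric of the sphere is `R²/N` times the Gram matrix with entries `N`, `ω_a` and `g_ab - N⁻¹ h_a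
h_b`. The Fubini–Study metric is `R²/N` times `g_ab - N⁻¹ (h_a h_b + ω_a ω_b)`, which is what
remains of the former after elimination of the angle: the Hopf map is a Riemannian submersion with
fibres of length `2πR`.

Both Berezinians are evaluated by `ber_eq_of_gram`. Their odd blocks are the symplectic matrix
perturbed by outer products of odd vectors, and for an odd rank-one matrix `T` one has `det (1 + T)
= 1 / (1 - tr T)` (`det_one_add_mul_one_sub_trace`). With `N = b + q`, `b` the body, the nilpotent
part `q` cancels from the even Schur complements. A numerical matrix remains, the identity minus
`b⁻¹` times the outer squares of two orthogonal vectors of square `b - 1`, and its determinant is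
`b⁻²`. The Berezinians come out as the squares of `R^{2n-2m} N^{-(n-m+1)}` and `R^{2n+1-2m}
N^{-(n-m+1)}`, and a square root with positive body is unique (`superApply_sqrt_eq`). The complex
bracket only contributes the constant `(-2i)^{n-m}`.

For the volumes no change of variables on superdomains is needed. A function `Q` on `ℂ^{n+1|m} ∖ 0`
which is invariant under positive dilations gives, after Berezin integration of `Q N^{-(n-m+1)}`, an
ordinary function `G` on `ℂ^{n+1} ∖ 0` that is homogeneous of degree `-2n-2`
(`berezin_mul_volDensity_cmul`). Polar coordinates in `z^k` identify the integral of `G` over a Hopf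
chart with its Lebesgue integral over the annulus `1 ≤ |z| ≤ e`, because the radial factor is the
integral of `dt/t` over an interval of logarithmic length one (`setIntegral_hopf`). The annulus
knows nothing of charts, so a partition of unity can be summed there. For `CP^{n|m}` the function
`G` is also invariant under the circle, and the angle integrates to `2π` (`integral_affine`). Both
volumes are thus multiples of one annulus integral. Partitions of unity are built from explicit
numerical cutoffs. -/

noncomputable section

namespace SuperHopf

/-! ### The Grassmann algebra: monomial basis, nilpotency, parity -/

section GrassmannBasics

variable {m : ℕ}

theorem gen_mul_self (κ : OddIx m) : gen κ * gen κ = 0 := ExteriorAlgebra.ι_sq_zero _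

theorem gen_mul_gen (κ κ' : OddIx m) : gen κ * gen κ' = -(gen κ' * gen κ) :=
  eq_neg_of_add_eq_zero_left (ExteriorAlgebra.ι_add_mul_swap _ _)

theorem ι_eq_sum_gen (v : OddIx m → ℂ) : ExteriorAlgebra.ι ℂ v = ∑ κ, v κ • gen κ := by
  conv_lhs => rw [pi_eq_sum_univ v]
  simp only [map_sum, map_smul, gen]
  refine Finset.sum_congr rfl fun κ _ => ?_
  congr 2
  ext j
  simp [Pi.single_apply, eq_comm]

theorem scal_mul (c : ℂ) (f : Grass m) : scal c * f = c • f := (Algebra.smul_def c f).symm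

theorem mul_scal (c : ℂ) (f : Grass m) : f * scal c = c • f := by
  rw [← scal_mul]; exact (Algebra.commutes c f).symm

@[simp] theorem scal_zero : scal (m := m) 0 = 0 := map_zero _
@[simp] theorem scal_one : scal (m := m) 1 = 1 := map_one _
theorem scal_eq_smul_one (c : ℂ) : scal (m := m) c = c • 1 := Algebra.algebraMap_eq_smul_one c

@[simp] theorem body_scal (c : ℂ) : body (scal (m := m) c) = c :=
  ExteriorAlgebra.algebraMap_leftInverse _ c
@[simp] theorem body_zero : body (0 : Grass m) = 0 := map_zero _
@[simp] theorem body_one : body (1 : Grass m) = 1 := map_one _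
@[simp] theorem body_add (f g : Grass m) : body (f + g) = body f + body g := map_add _ _ _
@[simp] theorem body_sub (f g : Grass m) : body (f - g) = body f - body g := map_sub _ _ _
@[simp] theorem body_mul (f g : Grass m) : body (f * g) = body f * body g := map_mul _ _ _
@[simp] theorem body_pow (f : Grass m) (k : ℕ) : body (f ^ k) = body f ^ k := map_pow _ _ _
@[simp] theorem body_smul (c : ℂ) (f : Grass m) : body (c • f) = c * body f := map_smul _ _ _
theorem body_sum {ι : Type*} (s : Finset ι) (f : ι → Grass m) :
    body (∑ i ∈ s, f i) = ∑ i ∈ s, body (f i) := map_sum _ _ _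
@[simp] theorem body_gen (κ : OddIx m) : body (gen κ) = 0 := by
  simp [body, gen, ExteriorAlgebra.algebraMapInv]

@[simp] theorem oddD_scal (κ : OddIx m) (c : ℂ) : oddD κ (scal c) = 0 :=
  CliffordAlgebra.contractLeft_algebraMap _ _ c
@[simp] theorem oddD_one (κ : OddIx m) : oddD κ (1 : Grass m) = 0 :=
  CliffordAlgebra.contractLeft_one _ _

theorem oddD_gen_mul (κ κ' : OddIx m) (f : Grass m) :
    oddD κ (gen κ' * f) = (if κ = κ' then f else 0) - gen κ' * oddD κ f := by
  unfold oddD gen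
  rw [show (ExteriorAlgebra.ι ℂ (Pi.single κ' 1 : OddIx m → ℂ) : Grass m) =
    CliffordAlgebra.ι 0 (Pi.single κ' 1) from rfl, CliffordAlgebra.contractLeft_ι_mul]
  congr 1
  by_cases h : κ = κ'
  · subst h; simp
  · simp [h]

theorem oddD_gen (κ κ' : OddIx m) : oddD κ (gen κ') = if κ = κ' then 1 else 0 := by
  have := oddD_gen_mul κ κ' 1
  simpa using this

theorem oddD_oddD_self (κ : OddIx m) (f : Grass m) : oddD κ (oddD κ f) = 0 :=
  CliffordAlgebra.contractLeft_contractLeft _ _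

theorem oddD_comm (κ κ' : OddIx m) (f : Grass m) : oddD κ (oddD κ' f) = -oddD κ' (oddD κ f) :=
  CliffordAlgebra.contractLeft_comm _ _ _

/-- A subspace containing `1` and stable under left multiplication by the generators is everything. -/
theorem submodule_eq_top_of_gen_mul (V : Submodule ℂ (Grass m)) (h1 : (1 : Grass m) ∈ V)
    (hg : ∀ κ, ∀ f ∈ V, gen κ * f ∈ V) (f : Grass m) : f ∈ V := by
  induction f using CliffordAlgebra.left_induction with
  | algebraMap r => rw [Algebra.algebraMap_eq_smul_one]; exact V.smul_mem _ h1
  | add x y hx hy => exact V.add_mem hx hy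
  | ι_mul x v hx =>
    have : (CliffordAlgebra.ι (0 : QuadraticForm ℂ (OddIx m → ℂ))) v
        = ∑ κ, v κ • (gen κ : Grass m) := ι_eq_sum_gen v
    rw [this, Finset.sum_mul]
    refine V.sum_mem fun κ _ => ?_
    rw [smul_mul_assoc]
    exact V.smul_mem _ (hg κ _ hx)

theorem gen_mul_prod_of_mem (κ : OddIx m) (l : List (OddIx m)) (h : κ ∈ l) :
    gen κ * (l.map gen).prod = 0 := by
  induction l with
  | nil => simp at h
  | cons a l ih =>
    rw [List.map_cons, List.prod_cons, ← mul_assoc]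
    by_cases ha : κ = a
    · rw [ha, gen_mul_self, zero_mul]
    · rw [gen_mul_gen, neg_mul, mul_assoc, ih (by simpa [ha] using h), mul_zero, neg_zero]

/-- The new generator anticommutes past the members of `A` that precede it in the list until it
reaches its own place. The sign depends on their number, which is irrelevant for spanning and for
reality of coefficients. -/
theorem gen_mul_filter_prod (κ : OddIx m) (A : Finset (OddIx m)) (l : List (OddIx m))
    (hl : l.Nodup) (hκ : κ ∈ l) (hA : κ ∉ A) :
    gen κ * ((l.filter (fun a => a ∈ A)).map gen).prod =
        ((l.filter (fun a => a ∈ insert κ A)).map gen).prod ∨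
    gen κ * ((l.filter (fun a => a ∈ A)).map gen).prod =
        -((l.filter (fun a => a ∈ insert κ A)).map gen).prod := by
  induction l with
  | nil => simp at hκ
  | cons a l ih =>
    obtain ⟨hal, hl'⟩ := List.nodup_cons.1 hl
    by_cases ha : κ = a
    · subst ha
      left
      rw [List.filter_cons_of_neg (by simpa using hA), List.filter_cons_of_pos (by simp),
        List.map_cons, List.prod_cons]
      congr 3
      refine List.filter_congr fun b hb => ?_
      have : b ≠ κ := fun h => hal (h ▸ hb)
      simp [this]
    · have ih' := ih hl' (by simpa [ha] using hκ)
      by_cases haA : a ∈ A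
      · rw [List.filter_cons_of_pos (by simpa using haA),
          List.filter_cons_of_pos (by simp [haA]), List.map_cons, List.prod_cons, ← mul_assoc,
          gen_mul_gen, neg_mul, mul_assoc, List.map_cons, List.prod_cons]
        rcases ih' with h | h <;> rw [h] <;> simp
      · rw [List.filter_cons_of_neg (by simpa using haA),
          List.filter_cons_of_neg (by simpa [haA] using fun h => ha h.symm)]
        exact ih'

theorem nodup_oddList : (oddList m).Nodup :=
  (List.nodup_finRange m).product (List.nodup_finRange 2)

@[simp] theorem mem_oddList (κ : OddIx m) : κ ∈ oddList m := by
  exact List.mem_product.2 ⟨List.mem_finRange _, List.mem_finRange _⟩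

@[simp] theorem mem_sortedList (κ : OddIx m) (A : Finset (OddIx m)) :
    κ ∈ sortedList A ↔ κ ∈ A := by
  simp [sortedList]

@[simp] theorem mono_empty : mono (∅ : Finset (OddIx m)) = 1 := by simp [mono, sortedList]

theorem mem_span_mono (f : Grass m) : f ∈ Submodule.span ℂ (Set.range (mono (m := m))) := by
  refine submodule_eq_top_of_gen_mul (Submodule.span ℂ (Set.range mono))
    (Submodule.subset_span ⟨∅, mono_empty⟩) ?_ f
  intro κ f hf
  induction hf using Submodule.span_induction with
  | zero => simp
  | add x y _ _ hx hy => rw [mul_add]; exact Submodule.add_mem _ hx hy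
  | smul c x _ hx => rw [mul_smul_comm]; exact Submodule.smul_mem _ _ hx
  | mem x hx =>
    obtain ⟨A, rfl⟩ := hx
    by_cases h : κ ∈ A
    · rw [mono, gen_mul_prod_of_mem _ _ (by simpa using h)]; exact zero_mem _
    · rcases gen_mul_filter_prod κ A (oddList m) nodup_oddList (mem_oddList κ) h with h | h
      · exact Submodule.subset_span ⟨insert κ A, h.symm⟩
      · rw [mono, sortedList, h]
        exact Submodule.neg_mem _ (Submodule.subset_span (Set.mem_range_self (insert κ A)))

theorem foldl_oddD_add (l : List (OddIx m)) (f g : Grass m) :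
    l.foldl (fun g κ => oddD κ g) (f + g) =
      l.foldl (fun g κ => oddD κ g) f + l.foldl (fun g κ => oddD κ g) g := by
  induction l generalizing f g with
  | nil => rfl
  | cons a l ih => simp [ih]

theorem foldl_oddD_smul (l : List (OddIx m)) (c : ℂ) (f : Grass m) :
    l.foldl (fun g κ => oddD κ g) (c • f) = c • l.foldl (fun g κ => oddD κ g) f := by
  induction l generalizing f with
  | nil => rfl
  | cons a l ih => simp [ih]

theorem foldl_oddD_zero (l : List (OddIx m)) :
    l.foldl (fun g κ => oddD κ g) (0 : Grass m) = 0 := by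
  simpa using foldl_oddD_smul l 0 0

/-- A generator that is never differentiated stays in front as a left factor, up to sign, and is
annihilated by the body. -/
theorem foldl_oddD_gen_mul (a : OddIx m) (l : List (OddIx m)) (ha : a ∉ l) (f : Grass m) :
    body (l.foldl (fun g κ => oddD κ g) (gen a * f)) = 0 := by
  induction l generalizing f with
  | nil => simp
  | cons b l ih =>
    have hb : b ≠ a := fun h => ha (by simp [h])
    rw [List.foldl_cons, oddD_gen_mul, if_neg hb, zero_sub, ← mul_neg]
    exact ih (fun h => ha (by simp [h])) _

theorem oddD_prod_of_notMem (a : OddIx m) (l : List (OddIx m)) (ha : a ∉ l) :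
    oddD a (l.map gen).prod = 0 := by
  induction l with
  | nil => simp
  | cons b l ih =>
    have hb : a ≠ b := fun h => ha (by simp [h])
    rw [List.map_cons, List.prod_cons, oddD_gen_mul, if_neg hb,
      ih (fun h => ha (by simp [h]))]
    simp

/-- Filters of an arbitrary list without repetitions allow an induction on one generator at a time:
a generator common to `A` and `B` is differentiated away, one in `A` only differentiates to zero,
and one in `B` only survives until the body is taken. -/
theorem coeff_filter_mono (A B : Finset (OddIx m)) (l : List (OddIx m)) (hl : l.Nodup) :
    body ((l.filter (fun κ => κ ∈ A)).foldl (fun g κ => oddD κ g)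
      ((l.filter (fun κ => κ ∈ B)).map gen).prod) = if ∀ κ ∈ l, κ ∈ A ↔ κ ∈ B then 1 else 0 := by
  induction l with
  | nil => simp
  | cons a l ih =>
    obtain ⟨hal, hl'⟩ := List.nodup_cons.1 hl
    have hB : a ∉ l.filter (fun κ => κ ∈ B) := fun h => hal (List.mem_filter.1 h).1
    have hA' : a ∉ l.filter (fun κ => κ ∈ A) := fun h => hal (List.mem_filter.1 h).1
    have pos : ∀ C : Finset (OddIx m), a ∈ C →
        (a :: l).filter (fun κ => κ ∈ C) = a :: l.filter (fun κ => κ ∈ C) :=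
      fun C h => List.filter_cons_of_pos (by simpa using h)
    have neg : ∀ C : Finset (OddIx m), a ∉ C →
        (a :: l).filter (fun κ => κ ∈ C) = l.filter (fun κ => κ ∈ C) :=
      fun C h => List.filter_cons_of_neg (by simpa using h)
    by_cases h1 : a ∈ A <;> by_cases h2 : a ∈ B
    · rw [pos A h1, pos B h2, List.map_cons, List.prod_cons, List.foldl_cons, oddD_gen_mul,
        if_pos rfl, oddD_prod_of_notMem _ _ hB, mul_zero, sub_zero, ih hl']
      simp [h1, h2]
    · rw [pos A h1, neg B h2, List.foldl_cons, oddD_prod_of_notMem _ _ hB, foldl_oddD_zero]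
      simp [h1, h2]
    · rw [neg A h1, pos B h2, List.map_cons, List.prod_cons, foldl_oddD_gen_mul _ _ hA']
      simp [h1, h2]
    · rw [neg A h1, neg B h2, ih hl']
      simp [h1, h2]

theorem coeff_mono (A B : Finset (OddIx m)) : coeff A (mono B) = if A = B then 1 else 0 := by
  rw [coeff, mono, sortedList, sortedList, coeff_filter_mono A B _ nodup_oddList]
  simp [Finset.ext_iff]

/-- The coefficient functional as a linear map. -/
def coeffₗ (A : Finset (OddIx m)) : Grass m →ₗ[ℂ] ℂ where
  toFun := coeff A
  map_add' f g := by simp [coeff, foldl_oddD_add]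
  map_smul' c f := by simp [coeff, foldl_oddD_smul]

theorem coeffₗ_apply (A : Finset (OddIx m)) (f : Grass m) : coeffₗ A f = coeff A f := rfl

@[simp] theorem coeff_zero (A : Finset (OddIx m)) : coeff A (0 : Grass m) = 0 := map_zero (coeffₗ A)
@[simp] theorem coeff_add (A : Finset (OddIx m)) (f g : Grass m) :
    coeff A (f + g) = coeff A f + coeff A g := map_add (coeffₗ A) f g
@[simp] theorem coeff_smul (A : Finset (OddIx m)) (c : ℂ) (f : Grass m) :
    coeff A (c • f) = c * coeff A f := map_smul (coeffₗ A) c f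
theorem coeff_sum {ι : Type*} (A : Finset (OddIx m)) (s : Finset ι) (f : ι → Grass m) :
    coeff A (∑ i ∈ s, f i) = ∑ i ∈ s, coeff A (f i) := map_sum (coeffₗ A) f s

theorem sum_coeff_mono (f : Grass m) : ∑ A, coeff A f • mono A = f := by
  have hf := mem_span_mono f
  induction hf using Submodule.span_induction with
  | zero => simp
  | add x y _ _ hx hy => simp only [coeff_add, add_smul, Finset.sum_add_distrib, hx, hy]
  | smul c x _ hx => simp only [coeff_smul, mul_smul, ← Finset.smul_sum, hx]
  | mem x hx =>
    obtain ⟨B, rfl⟩ := hx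
    simp [coeff_mono]

theorem linearMap_apply_eq_sum {V : Type*} [AddCommGroup V] [Module ℂ V] (T : Grass m →ₗ[ℂ] V)
    (f : Grass m) : T f = ∑ A, coeff A f • T (mono A) := by
  conv_lhs => rw [← sum_coeff_mono f]
  simp

theorem grass_ext {f g : Grass m} (h : ∀ A, coeff A f = coeff A g) : f = g := by
  rw [← sum_coeff_mono f, ← sum_coeff_mono g]; simp only [h]

@[simp] theorem coeff_empty (f : Grass m) : coeff ∅ f = body f := by simp [coeff, sortedList]

theorem coeff_scal (A : Finset (OddIx m)) (c : ℂ) :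
    coeff A (scal c) = if A = ∅ then c else 0 := by
  rw [scal_eq_smul_one, coeff_smul, ← mono_empty, coeff_mono]; simp

/-- The ideal powers of the augmentation: spans of products of at least `j` generators. -/
def augPow (m j : ℕ) : Submodule ℂ (Grass m) :=
  Submodule.span ℂ {f | ∃ l : List (OddIx m), j ≤ l.length ∧ f = (l.map gen).prod}

theorem augPow_mul_mem {i j : ℕ} {f g : Grass m} (hf : f ∈ augPow m i) (hg : g ∈ augPow m j) :
    f * g ∈ augPow m (i + j) := by
  have := Submodule.mul_mem_mul hf hg
  rw [augPow, augPow, Submodule.span_mul_span] at this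
  refine Submodule.span_mono ?_ this
  rintro _ ⟨_, ⟨l, hl, rfl⟩, _, ⟨l', hl', rfl⟩, rfl⟩
  exact ⟨l ++ l', by simp; omega, by simp⟩

theorem prod_gen_eq_zero_of_not_nodup (l : List (OddIx m)) (h : ¬ l.Nodup) :
    (l.map gen).prod = 0 := by
  induction l with
  | nil => simp at h
  | cons a l ih =>
    rw [List.map_cons, List.prod_cons]
    by_cases ha : a ∈ l
    · exact gen_mul_prod_of_mem a l ha
    · rw [ih (fun hl => h (List.nodup_cons.2 ⟨ha, hl⟩)), mul_zero]

/-- Among more than `2m` generators one is repeated. This is why all Taylor expansions in nilpotent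
parts may stop at degree `2m`. -/
theorem augPow_eq_bot : augPow m (2 * m + 1) = ⊥ := by
  rw [augPow, Submodule.span_eq_bot]
  rintro _ ⟨l, hl, rfl⟩
  refine prod_gen_eq_zero_of_not_nodup l fun hn => ?_
  have := hn.length_le_card
  simp at this
  omega

theorem mem_augPow_one {f : Grass m} (hf : body f = 0) : f ∈ augPow m 1 := by
  rw [← sum_coeff_mono f]
  refine Submodule.sum_mem _ fun A _ => ?_
  by_cases hA : A = ∅
  · subst hA; simp [hf]
  · refine Submodule.smul_mem _ _ (Submodule.subset_span ⟨sortedList A, ?_, rfl⟩)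
    obtain ⟨κ, hκ⟩ := Finset.nonempty_iff_ne_empty.2 hA
    exact List.length_pos_of_mem ((mem_sortedList κ A).2 hκ)

theorem pow_mem_augPow {f : Grass m} (hf : body f = 0) (k : ℕ) : f ^ k ∈ augPow m k := by
  induction k with
  | zero => exact Submodule.subset_span ⟨[], by simp, by simp⟩
  | succ k ih => rw [pow_succ]; exact augPow_mul_mem ih (mem_augPow_one hf)

theorem pow_eq_zero_of_body_eq_zero {f : Grass m} (hf : body f = 0) {k : ℕ} (hk : 2 * m < k) :
    f ^ k = 0 := by
  have : f ^ (2 * m + 1) = 0 := by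
    have := pow_mem_augPow hf (2 * m + 1)
    rwa [augPow_eq_bot, Submodule.mem_bot] at this
  exact pow_eq_zero_of_le hk this

theorem isNilpotent_of_body_eq_zero {f : Grass m} (hf : body f = 0) : IsNilpotent f :=
  ⟨2 * m + 1, pow_eq_zero_of_body_eq_zero hf (by omega)⟩

/-- The element is a nonzero scalar plus a nilpotent that commutes with it. -/
theorem isUnit_of_body_ne_zero {f : Grass m} (hf : body f ≠ 0) : IsUnit f := by
  have h1 : IsUnit (scal (m := m) (body f)) := (Ne.isUnit hf).map _
  have h2 : IsNilpotent (f - scal (body f)) := isNilpotent_of_body_eq_zero (by simp)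
  have := h2.isUnit_add_left_of_commute h1 (by
    change _ * _ = _ * _
    rw [scal_mul, mul_scal])
  simpa using this

/-! ### Parity -/

theorem IsEvenElt.add {f g : Grass m} (hf : IsEvenElt f) (hg : IsEvenElt g) : IsEvenElt (f + g) :=
  Submodule.add_mem _ hf hg
theorem IsEvenElt.sub {f g : Grass m} (hf : IsEvenElt f) (hg : IsEvenElt g) : IsEvenElt (f - g) :=
  Submodule.sub_mem _ hf hg
theorem IsEvenElt.smul {f : Grass m} (hf : IsEvenElt f) (c : ℂ) : IsEvenElt (c • f) :=
  Submodule.smul_mem _ _ hf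
theorem IsEvenElt.sum {ι : Type*} {s : Finset ι} {f : ι → Grass m}
    (hf : ∀ i ∈ s, IsEvenElt (f i)) : IsEvenElt (∑ i ∈ s, f i) := Submodule.sum_mem _ hf
theorem IsEvenElt.mul {f g : Grass m} (hf : IsEvenElt f) (hg : IsEvenElt g) : IsEvenElt (f * g) :=
  (CliffordAlgebra.even (0 : QuadraticForm ℂ (OddIx m → ℂ))).mul_mem hf hg
theorem IsEvenElt.pow {f : Grass m} (hf : IsEvenElt f) (k : ℕ) : IsEvenElt (f ^ k) :=
  (CliffordAlgebra.even (0 : QuadraticForm ℂ (OddIx m → ℂ))).pow_mem hf k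
theorem isEvenElt_scal (c : ℂ) : IsEvenElt (scal (m := m) c) :=
  (CliffordAlgebra.even (0 : QuadraticForm ℂ (OddIx m → ℂ))).algebraMap_mem c
theorem IsOddElt.add {f g : Grass m} (hf : IsOddElt f) (hg : IsOddElt g) : IsOddElt (f + g) :=
  Submodule.add_mem _ hf hg
theorem IsOddElt.smul {f : Grass m} (hf : IsOddElt f) (c : ℂ) : IsOddElt (c • f) :=
  Submodule.smul_mem _ _ hf
theorem isOddElt_gen (κ : OddIx m) : IsOddElt (gen κ) :=
  CliffordAlgebra.ι_mem_evenOdd_one _ _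
theorem IsOddElt.mul {f g : Grass m} (hf : IsOddElt f) (hg : IsOddElt g) : IsEvenElt (f * g) :=
  CliffordAlgebra.evenOdd_mul_le _ 1 1 (Submodule.mul_mem_mul hf hg)
theorem IsEvenElt.mul_odd {f g : Grass m} (hf : IsEvenElt f) (hg : IsOddElt g) : IsOddElt (f * g) :=
  CliffordAlgebra.evenOdd_mul_le _ 0 1 (Submodule.mul_mem_mul hf hg)

theorem IsEvenElt.commute {f : Grass m} (hf : IsEvenElt f) (g : Grass m) : Commute f g := by
  replace hf : f ∈ CliffordAlgebra.evenOdd (0 : QuadraticForm ℂ (OddIx m → ℂ)) 0 := hf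
  induction f, hf using CliffordAlgebra.even_induction with
  | algebraMap r => exact Algebra.commutes r _
  | add p q _ _ hp hq => exact hp.add_left hq
  | ι_mul_ι_mul a b p _ hp => exact (ι_mul_ι_commute a b _).mul_left hp

/-- A left derivative is an antiderivation; in passing a product of two generators the two sign
changes cancel. -/
theorem oddD_mul_of_even {f : Grass m} (hf : IsEvenElt f) (κ : OddIx m) (g : Grass m) :
    oddD κ (f * g) = oddD κ f * g + f * oddD κ g := by
  replace hf : f ∈ CliffordAlgebra.evenOdd (0 : QuadraticForm ℂ (OddIx m → ℂ)) 0 := hf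
  induction f, hf using CliffordAlgebra.even_induction with
  | algebraMap r =>
    have h0 : oddD κ (algebraMap ℂ (Grass m) r) = 0 := oddD_scal κ r
    change oddD κ (scal r * g) = oddD κ (algebraMap ℂ (Grass m) r) * g + scal r * oddD κ g
    rw [h0, scal_mul, map_smul, scal_mul, zero_mul, zero_add]
  | add p q _ _ hp hq => rw [add_mul, map_add, hp, hq, map_add, add_mul, add_mul]; abel
  | ι_mul_ι_mul a b p _ hp =>
    have key : ∀ (v : OddIx m → ℂ) (h : Grass m),
        oddD κ (CliffordAlgebra.ι 0 v * h) = v κ • h - CliffordAlgebra.ι 0 v * oddD κ h :=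
      fun v h => CliffordAlgebra.contractLeft_ι_mul _ _ _
    rw [mul_assoc, mul_assoc, mul_assoc, key, key, key, key, hp]
    simp only [mul_sub, sub_mul, mul_add, smul_mul_assoc, mul_smul_comm, mul_assoc]
    abel

end GrassmannBasics

/-! ### Functions of one variable applied to even elements -/

section FunctionalCalculus

variable {m : ℕ}

theorem cmul_eq {N : Type*} (c : ℂ) (a : N × Fin 2 → Grass m) (p : N × Fin 2) :
    cmul c a p = if p.2 = 0 then (c.re : ℂ) • a (p.1, 0) - (c.im : ℂ) • a (p.1, 1)
      else (c.im : ℂ) • a (p.1, 0) + (c.re : ℂ) • a (p.1, 1) := rfl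

/-- Terms of total degree at least `K` vanish by nilpotency, so truncation of power series is
compatible with the Cauchy product. -/
theorem sum_smul_pow_mul_sum_smul_pow {A : Type*} [Ring A] [Algebra ℂ A] {ν : A} {K : ℕ}
    (hν : ∀ k, K ≤ k → ν ^ k = 0) (a b : ℕ → ℂ) :
    (∑ i ∈ Finset.range K, a i • ν ^ i) * (∑ j ∈ Finset.range K, b j • ν ^ j) =
      ∑ k ∈ Finset.range K, (∑ i ∈ Finset.range (k + 1), a i * b (k - i)) • ν ^ k := by
  rw [Finset.sum_mul_sum, ← Finset.sum_product',
    ← Finset.sum_filter_add_sum_filter_not _ (fun p : ℕ × ℕ => p.1 + p.2 < K)]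
  rw [Finset.sum_eq_zero (s := Finset.filter (fun p : ℕ × ℕ => ¬ p.1 + p.2 < K) _), add_zero,
    ← Finset.sum_fiberwise_of_maps_to (t := Finset.range K) (g := fun p : ℕ × ℕ => p.1 + p.2)]
  · refine Finset.sum_congr rfl fun k hk => ?_
    have hk' := Finset.mem_range.1 hk
    rw [Finset.sum_smul, ← Finset.Nat.sum_antidiagonal_eq_sum_range_succ
      (fun i j => (a i * b j) • ν ^ k)]
    have : ((Finset.range K ×ˢ Finset.range K).filter (fun p : ℕ × ℕ => p.1 + p.2 < K)).filter
        (fun p => p.1 + p.2 = k) = Finset.HasAntidiagonal.antidiagonal k := by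
      ext ⟨i, j⟩
      simp only [Finset.mem_filter, Finset.mem_product, Finset.mem_range,
        Finset.HasAntidiagonal.mem_antidiagonal]
      omega
    rw [this]
    refine Finset.sum_congr rfl fun p hp => ?_
    rw [smul_mul_smul_comm, ← pow_add, Finset.HasAntidiagonal.mem_antidiagonal.1 hp]
  · intro p hp
    simpa using (Finset.mem_filter.1 hp).2
  · intro p hp
    rw [smul_mul_smul_comm, ← pow_add, hν _ (not_lt.1 (Finset.mem_filter.1 hp).2), smul_zero]

theorem superApply_congr {F G : ℝ → ℝ} {f : Grass m} (h : F =ᶠ[nhds (rbody f)] G) :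
    superApply F f = superApply G f := by
  unfold superApply
  refine Finset.sum_congr rfl fun k _ => ?_
  rw [h.iteratedDeriv_eq]

theorem superApply_congr_pos {F G : ℝ → ℝ} {f : Grass m} (hf : 0 < rbody f)
    (h : ∀ t, 0 < t → F t = G t) : superApply F f = superApply G f :=
  superApply_congr (by filter_upwards [lt_mem_nhds hf] with t ht using h t ht)

/-- Leibniz' rule for the `k`th derivative of a product, divided by `k!`, is the Cauchy product of
the Taylor coefficients. -/
theorem superApply_mul {F G : ℝ → ℝ} {f : Grass m} (hF : ContDiffAt ℝ ∞ F (rbody f))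
    (hG : ContDiffAt ℝ ∞ G (rbody f)) :
    superApply (fun t => F t * G t) f = superApply F f * superApply G f := by
  unfold superApply
  rw [sum_smul_pow_mul_sum_smul_pow fun k hk =>
    pow_eq_zero_of_body_eq_zero (f := f - scal (body f)) (by simp) (by omega)]
  refine Finset.sum_congr rfl fun k _ => ?_
  congr 1
  rw [iteratedDeriv_fun_mul (hF.of_le (by exact_mod_cast le_top))
    (hG.of_le (by exact_mod_cast le_top)), Finset.sum_div, Complex.ofReal_sum]
  refine Finset.sum_congr rfl fun i hi => ?_
  have hi' : i ≤ k := Nat.lt_succ_iff.1 (Finset.mem_range.1 hi)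
  rw [← Complex.ofReal_mul]
  congr 1
  have h1 : ((k.choose i : ℕ) : ℝ) * (i.factorial * (k - i).factorial) = k.factorial := by
    exact_mod_cast (by rw [← mul_assoc]; exact Nat.choose_mul_factorial_mul_factorial hi')
  have := Nat.factorial_ne_zero i
  have := Nat.factorial_ne_zero (k - i)
  have := Nat.factorial_ne_zero k
  rw [← h1]
  have hc : ((k.choose i : ℕ) : ℝ) ≠ 0 := by
    exact_mod_cast (Nat.choose_pos hi').ne'
  field_simp

theorem superApply_const (c : ℝ) (f : Grass m) : superApply (fun _ => c) f = scal (c : ℂ) := by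
  unfold superApply
  rw [Finset.sum_eq_single 0]
  · simp [scal_eq_smul_one]
  · intro k _ hk
    simp [iteratedDeriv_const, hk]
  · simp

theorem superApply_id {f : Grass m} (hf : (body f).im = 0) : superApply (fun t => t) f = f := by
  have hb : scal (((rbody f : ℝ) : ℂ)) = scal (m := m) (body f) := by
    congr 1; apply Complex.ext <;> simp [rbody, hf]
  unfold superApply
  -- For `m = 0` the Taylor sum stops before its linear term, but then `f` equals its body.
  -- Otherwise exactly the terms of degree 0 and 1 survive.
  rcases Nat.eq_zero_or_pos m with rfl | hm
  · have : f - scal (body f) = 0 := by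
      simpa using pow_eq_zero_of_body_eq_zero (f := f - scal (body f)) (k := 1) (by simp) (by simp)
    simp only [mul_zero, zero_add, Finset.sum_range_one]
    simp only [iteratedDeriv_zero, Nat.factorial_zero, Nat.cast_one, div_one, pow_zero]
    rw [← scal_eq_smul_one, hb]
    exact (sub_eq_zero.1 this).symm
  · rw [← Finset.sum_subset (s₁ := Finset.range 2)]
    · simp only [Finset.sum_range_succ, Finset.sum_range_zero, zero_add, iteratedDeriv_fun_id]
      simp only [↓reduceIte, Nat.factorial_zero, Nat.cast_one, div_one, pow_zero, one_ne_zero,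
        Nat.factorial_one, pow_one]
      rw [← scal_eq_smul_one, hb]
      simp
    · intro k hk; simp at hk ⊢; omega
    · intro k _ hk
      have h0 : k ≠ 0 := by rintro rfl; simp at hk
      have h1 : k ≠ 1 := by rintro rfl; simp at hk
      simp [iteratedDeriv_fun_id, h0, h1]

@[simp] theorem body_superApply (F : ℝ → ℝ) (f : Grass m) :
    body (superApply F f) = (F (rbody f) : ℂ) := by
  unfold superApply
  rw [body_sum, Finset.sum_eq_single 0]
  · simp [-Complex.coe_smul]
  · intro k _ hk
    simp [hk]
  · simp

theorem IsEvenElt.superApply {f : Grass m} (hf : IsEvenElt f) (F : ℝ → ℝ) :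
    IsEvenElt (superApply F f) :=
  IsEvenElt.sum fun _ _ => ((hf.sub (isEvenElt_scal _)).pow _).smul _

/-- An endomorphism that preserves bodies leaves the Taylor coefficients alone and carries nilpotent
part to nilpotent part. It is applied to `scaleHom`. -/
theorem map_superApply {φ : Grass m →ₐ[ℂ] Grass m} (hφ : ∀ f, body (φ f) = body f) (F : ℝ → ℝ)
    (f : Grass m) : φ (superApply F f) = superApply F (φ f) := by
  unfold superApply
  have hs : φ (scal (body f)) = scal (body f) := φ.commutes _
  simp only [map_sum, map_smul, map_pow, map_sub, rbody, hφ, hs]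

theorem iteratedDeriv_comp_const_mul' (F : ℝ → ℝ) (c : ℝ) (k : ℕ) :
    iteratedDeriv k (fun t => F (c * t)) = fun t => c ^ k * iteratedDeriv k F (c * t) := by
  induction k with
  | zero => simp
  | succ k ih =>
    rw [iteratedDeriv_succ, ih]
    funext t
    rw [deriv_const_mul_field, deriv_comp_mul_left, iteratedDeriv_succ, smul_eq_mul]
    ring

/-- Differentiating the homogeneity relation `k` times gives `c^k F^(k)(ct) = d F^(k)(t)`, and `c^k`
is the factor that the scaled nilpotent part produces. -/
theorem superApply_smul {F : ℝ → ℝ} {c d : ℝ} (hF : ∀ t, 0 < t → F (c * t) = d * F t)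
    {f : Grass m} (hf : 0 < rbody f) :
    superApply F ((c : ℂ) • f) = (d : ℂ) • superApply F f := by
  unfold superApply
  rw [Finset.smul_sum]
  refine Finset.sum_congr rfl fun k _ => ?_
  have hr : rbody ((c : ℂ) • f) = c * rbody f := by simp [rbody, -Complex.coe_smul]
  have hs : (c : ℂ) • f - scal (body ((c : ℂ) • f)) = (c : ℂ) • (f - scal (body f)) := by
    rw [body_smul, smul_sub, scal_eq_smul_one, scal_eq_smul_one, mul_smul]
  have hd : c ^ k * iteratedDeriv k F (c * rbody f) = d * iteratedDeriv k F (rbody f) := by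
    have h1 := congrFun (iteratedDeriv_comp_const_mul' F c k) (rbody f)
    have h2 : (fun t => F (c * t)) =ᶠ[nhds (rbody f)] fun t => d * F t := by
      filter_upwards [lt_mem_nhds hf] with t ht using hF t ht
    rw [← h1, h2.iteratedDeriv_eq, iteratedDeriv_const_mul_field]
  rw [hr, hs, smul_pow, smul_smul, smul_smul, ← Complex.ofReal_pow, ← Complex.ofReal_mul,
    ← Complex.ofReal_mul]
  congr 2
  rw [div_mul_eq_mul_div, mul_comm _ (c ^ k), hd, mul_div_assoc]

/-- Square roots with positive body are unique. -/
theorem eq_of_sq_eq_sq {r s : Grass m} (hr : IsEvenElt r) (h : r ^ 2 = s ^ 2)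
    (hb : body r + body s ≠ 0) : r = s := by
  have hu : IsUnit (r + s) := isUnit_of_body_ne_zero (by simpa using hb)
  have hc : r * s = s * r := hr.commute s
  have : (r - s) * (r + s) = 0 := by
    rw [sub_mul, mul_add, mul_add, ← pow_two, ← pow_two, h, hc]; abel
  exact sub_eq_zero.1 ((hu.mul_left_eq_zero).1 this)

/-- The square roots in the volume elements are evaluated in this way: each Berezinian is exhibited
as the square of an element with positive body, and the sum of two such roots is invertible, so
their difference must vanish. -/
theorem superApply_sqrt_eq {u s : Grass m} (hu : IsEvenElt u) (h : s ^ 2 = u) (hi : (body s).im = 0)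
    (hs : 0 < rbody s) : superApply Real.sqrt u = s := by
  have hbs : body s = ((rbody s : ℝ) : ℂ) := by apply Complex.ext <;> simp [rbody, hi]
  have hbu : body u = ((rbody s ^ 2 : ℝ) : ℂ) := by rw [← h, body_pow, hbs]; push_cast; rfl
  have hru : rbody u = rbody s ^ 2 := by rw [rbody, hbu, Complex.ofReal_re]
  have hpos : 0 < rbody u := by rw [hru]; positivity
  have hsm : ContDiffAt ℝ ∞ Real.sqrt (rbody u) := Real.contDiffAt_sqrt hpos.ne'
  refine eq_of_sq_eq_sq (hu.superApply _) ?_ ?_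
  · rw [h, pow_two, ← superApply_mul hsm hsm]
    rw [superApply_congr_pos hpos (G := fun t => t) fun t ht => Real.mul_self_sqrt ht.le]
    exact superApply_id (by rw [hbu, Complex.ofReal_im])
  · rw [body_superApply, hbs, hru, Real.sqrt_sq hs.le, ← Complex.ofReal_add]
    exact Complex.ofReal_ne_zero.2 (by positivity)

theorem superApply_zpow_mul {f : Grass m} (hf : 0 < rbody f) (j k : ℤ) :
    superApply (fun t => t ^ j) f * superApply (fun t => t ^ k) f =
      superApply (fun t => t ^ (j + k)) f := by
  have h (i : ℤ) : ContDiffAt ℝ ∞ (fun t : ℝ => t ^ i) (rbody f) :=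
    (analyticAt_id.zpow hf.ne').contDiffAt
  rw [← superApply_mul (h j) (h k)]
  exact superApply_congr_pos hf fun t ht => (zpow_add₀ ht.ne' j k).symm

theorem contDiffAt_rpow_neg_half {t : ℝ} (ht : 0 < t) :
    ContDiffAt ℝ ∞ (fun t : ℝ => t ^ (-(1 / 2) : ℝ)) t :=
  Real.contDiffAt_rpow_const_of_ne ht.ne'

theorem superApply_rsqrt_sq {f : Grass m} (hf : 0 < rbody f) :
    superApply (fun t => t ^ (-(1 / 2) : ℝ)) f * superApply (fun t => t ^ (-(1 / 2) : ℝ)) f =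
      superApply (fun t => t ^ (-1 : ℤ)) f := by
  rw [← superApply_mul (contDiffAt_rpow_neg_half hf) (contDiffAt_rpow_neg_half hf)]
  refine superApply_congr_pos hf fun t ht => ?_
  rw [← Real.rpow_add ht, ← Real.rpow_intCast]
  norm_num

/-! ### Elements with real coefficients -/

/-- Elements all of whose coefficients are real. -/
def IsRealElt (f : Grass m) : Prop := ∀ A, (coeff A f).im = 0

theorem IsRealElt.add {f g : Grass m} (hf : IsRealElt f) (hg : IsRealElt g) :
    IsRealElt (f + g) := fun A => by simp [hf A, hg A]
theorem IsRealElt.smul {f : Grass m} (hf : IsRealElt f) (r : ℝ) :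
    IsRealElt ((r : ℂ) • f) := fun A => by simp [hf A, -Complex.coe_smul]
theorem IsRealElt.sum {ι : Type*} {s : Finset ι} {f : ι → Grass m}
    (hf : ∀ i ∈ s, IsRealElt (f i)) : IsRealElt (∑ i ∈ s, f i) := fun A => by
  rw [coeff_sum, Complex.im_sum]; exact Finset.sum_eq_zero fun i hi => hf i hi A
theorem IsRealElt.neg {f : Grass m} (hf : IsRealElt f) : IsRealElt (-f) := by
  simpa using hf.smul (-1)
theorem IsRealElt.sub {f g : Grass m} (hf : IsRealElt f) (hg : IsRealElt g) :
    IsRealElt (f - g) := by rw [sub_eq_add_neg]; exact hf.add hg.neg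
theorem isRealElt_scal (r : ℝ) : IsRealElt (scal (m := m) (r : ℂ)) := fun A => by
  rw [coeff_scal]; split_ifs <;> simp
theorem isRealElt_mono (B : Finset (OddIx m)) : IsRealElt (mono B) := fun A => by
  rw [coeff_mono]; split_ifs <;> simp

theorem isRealElt_gen_mul_mono (κ : OddIx m) (B : Finset (OddIx m)) :
    IsRealElt (gen κ * mono B) := by
  by_cases h : κ ∈ B
  · rw [mono, gen_mul_prod_of_mem _ _ (by simpa using h)]
    intro A; simp
  · rcases gen_mul_filter_prod κ B (oddList m) nodup_oddList (mem_oddList κ) h with h | h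
    · rw [mono, sortedList, h]; exact isRealElt_mono (insert κ B)
    · rw [mono, sortedList, h]; exact (isRealElt_mono (insert κ B)).neg

theorem isRealElt_of_eq_sum {ι : Type*} {s : Finset ι} {c : ι → ℂ} {g : ι → Grass m}
    (hc : ∀ i ∈ s, (c i).im = 0) (hg : ∀ i ∈ s, IsRealElt (g i)) :
    IsRealElt (∑ i ∈ s, c i • g i) := by
  refine IsRealElt.sum fun i hi => ?_
  have : c i = ((c i).re : ℂ) := by apply Complex.ext <;> simp [hc i hi]
  rw [this]; exact (hg i hi).smul _

theorem IsRealElt.gen_mul {f : Grass m} (hf : IsRealElt f) (κ : OddIx m) :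
    IsRealElt (gen κ * f) := by
  rw [← sum_coeff_mono f, Finset.mul_sum]
  simp only [mul_smul_comm]
  exact isRealElt_of_eq_sum (fun A _ => hf A) fun A _ => isRealElt_gen_mul_mono κ A

theorem IsRealElt.mul {f g : Grass m} (hf : IsRealElt f) (hg : IsRealElt g) :
    IsRealElt (f * g) := by
  rw [← sum_coeff_mono f, Finset.sum_mul]
  simp only [smul_mul_assoc]
  refine isRealElt_of_eq_sum (fun A _ => hf A) fun A _ => ?_
  rw [mono]
  induction sortedList A with
  | nil => simpa using hg
  | cons a l ih => rw [List.map_cons, List.prod_cons, mul_assoc]; exact ih.gen_mul a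

theorem isRealElt_one : IsRealElt (1 : Grass m) := by simpa using isRealElt_scal (m := m) 1
theorem isRealElt_gen (κ : OddIx m) : IsRealElt (gen κ) := by
  simpa using isRealElt_one.gen_mul κ
theorem IsRealElt.pow {f : Grass m} (hf : IsRealElt f) (k : ℕ) : IsRealElt (f ^ k) := by
  induction k with
  | zero => simpa using isRealElt_one
  | succ k ih => rw [pow_succ]; exact ih.mul hf
theorem IsRealElt.body_im {f : Grass m} (hf : IsRealElt f) : (body f).im = 0 := by
  simpa using hf ∅
theorem IsRealElt.body_eq {f : Grass m} (hf : IsRealElt f) : body f = (rbody f : ℂ) := by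
  apply Complex.ext <;> simp [rbody, hf.body_im]
theorem IsRealElt.superApply {f : Grass m} (hf : IsRealElt f) (F : ℝ → ℝ) :
    IsRealElt (superApply F f) := by
  refine IsRealElt.sum fun k _ => IsRealElt.smul (IsRealElt.pow (hf.sub ?_) _) _
  rw [hf.body_eq]; exact isRealElt_scal _

/-- Differentiation of a product of generators only produces signs. The lemma makes the volume of
`CP^{n|m}` a real number. -/
theorem im_berezin_of_isRealElt {f : Grass m} (hf : IsRealElt f) : (berezin f).im = 0 := by
  have hD : ∀ (κ : OddIx m) (g : Grass m), IsRealElt g → IsRealElt (oddD κ g) := by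
    have hl : ∀ (κ : OddIx m) (l : List (OddIx m)), IsRealElt (oddD κ (l.map gen).prod) := by
      intro κ l
      induction l with
      | nil => intro A; simp
      | cons a l ih =>
        rw [List.map_cons, List.prod_cons, oddD_gen_mul]
        refine IsRealElt.sub ?_ (ih.gen_mul a)
        split_ifs
        · clear ih
          induction l with
          | nil => simpa using isRealElt_one
          | cons b l ih => rw [List.map_cons, List.prod_cons]; exact ih.gen_mul b
        · intro A; simp
    intro κ g hg
    rw [linearMap_apply_eq_sum]
    exact isRealElt_of_eq_sum (fun A _ => hg A) fun A _ => hl κ _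
  unfold berezin
  refine IsRealElt.body_im ?_
  induction oddList m with
  | nil => simpa using hf
  | cons a l ih => exact hD a _ ih

/-! ### Scaling of the odd generators by a complex number -/

/-- The algebra endomorphism induced by multiplying the odd coordinates `ζ` by `l`. -/
def scaleHom (l : ℂ) : Grass m →ₐ[ℂ] Grass m :=
  ExteriorAlgebra.map (∑ κ : OddIx m, (LinearMap.proj κ : (OddIx m → ℂ) →ₗ[ℂ] ℂ).smulRight
    (cmul l (fun κ => (Pi.single κ 1 : OddIx m → ℂ)) κ))

theorem scaleHom_gen (l : ℂ) (κ : OddIx m) : scaleHom l (gen κ) = cmul l gen κ := by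
  rw [scaleHom, gen, ExteriorAlgebra.map_apply_ι]
  have : (∑ κ : OddIx m, (LinearMap.proj κ : (OddIx m → ℂ) →ₗ[ℂ] ℂ).smulRight
    (cmul l (fun κ => (Pi.single κ 1 : OddIx m → ℂ)) κ)) (Pi.single κ 1) =
      cmul l (fun κ => (Pi.single κ 1 : OddIx m → ℂ)) κ := by
    simp [LinearMap.sum_apply, Pi.single_apply]
  rw [this]
  have hs : ∀ (r : ℝ) (v : OddIx m → ℂ), ExteriorAlgebra.ι ℂ (r • v) =
      r • (ExteriorAlgebra.ι ℂ v : Grass m) := fun r v =>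
    (ExteriorAlgebra.ι ℂ).map_smul (r : ℂ) v
  unfold cmul gen
  split_ifs
  · rw [map_sub, hs, hs]; rfl
  · rw [map_add, hs, hs]; rfl

theorem scaleHom_scal (l c : ℂ) : scaleHom (m := m) l (scal c) = scal c := (scaleHom l).commutes c

/-- The substitution is linear in the generators, so it cannot affect constant terms. -/
theorem body_scaleHom (l : ℂ) (f : Grass m) : body (scaleHom l f) = body f := by
  suffices h : (ExteriorAlgebra.algebraMapInv.comp (scaleHom l) : Grass m →ₐ[ℂ] ℂ) =
      ExteriorAlgebra.algebraMapInv from DFunLike.congr_fun h f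
  apply ExteriorAlgebra.hom_ext
  ext κ
  change body (scaleHom l (gen κ)) = body (gen κ)
  rw [scaleHom_gen, body_gen]
  rw [cmul_eq]
  split_ifs <;> simp [-Complex.coe_smul]

end FunctionalCalculus

/-! ### Differential calculus of superfunctions -/

section SmoothCalculus

variable {I : Type*} [Fintype I] {m : ℕ} {U : Set (I → ℝ)}

theorem contDiff_ofReal : ContDiff ℝ ∞ (fun t : ℝ => (t : ℂ)) := Complex.ofRealCLM.contDiff

theorem contDiff_comp_ofReal {h : (I → ℝ) → ℝ} (hh : ContDiff ℝ ∞ h) :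
    ContDiff ℝ ∞ (fun y => (h y : ℂ)) := contDiff_ofReal.comp hh

theorem SmoothOn.functional {f : SFun I m} (hf : SmoothOn U f) (T : Grass m →ₗ[ℂ] ℂ) :
    ContDiffOn ℝ ∞ (fun x => T (f x)) U := by
  have : (fun x => T (f x)) = fun x => ∑ A, coeff A (f x) * T (mono A) := by
    funext x; rw [linearMap_apply_eq_sum]; simp
  rw [this]
  exact ContDiffOn.sum fun A _ => (hf A).mul contDiffOn_const

theorem SmoothOn.linear {m' : ℕ} {f : SFun I m} (hf : SmoothOn U f) (T : Grass m →ₗ[ℂ] Grass m') :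
    SmoothOn U fun x => T (f x) := fun A => hf.functional (coeffₗ A ∘ₗ T)

theorem smoothOn_const (g : Grass m) : SmoothOn U fun _ => g := fun _ => contDiffOn_const

theorem SmoothOn.add {f g : SFun I m} (hf : SmoothOn U f) (hg : SmoothOn U g) :
    SmoothOn U (f + g) := fun A => by
  simpa using (hf A).add (hg A)

theorem SmoothOn.fun_add {f g : SFun I m} (hf : SmoothOn U f) (hg : SmoothOn U g) :
    SmoothOn U (fun x => f x + g x) := hf.add hg

theorem SmoothOn.const_smul {f : SFun I m} (hf : SmoothOn U f) (c : ℂ) :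
    SmoothOn U (fun x => c • f x) := hf.linear (c • LinearMap.id)

theorem SmoothOn.fun_sub {f g : SFun I m} (hf : SmoothOn U f) (hg : SmoothOn U g) :
    SmoothOn U (fun x => f x - g x) := by
  simpa [sub_eq_add_neg] using hf.fun_add (hg.const_smul (-1))

theorem SmoothOn.sum {ι : Type*} {s : Finset ι} {f : ι → SFun I m}
    (hf : ∀ i ∈ s, SmoothOn U (f i)) : SmoothOn U (fun x => ∑ i ∈ s, f i x) := fun A => by
  simp only [coeff_sum]
  exact ContDiffOn.sum fun i hi => hf i hi A

theorem SmoothOn.smul {f : SFun I m} {h : (I → ℝ) → ℂ} (hh : ContDiffOn ℝ ∞ h U)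
    (hf : SmoothOn U f) : SmoothOn U (fun x => h x • f x) := fun A => by
  simp only [coeff_smul]
  exact hh.mul (hf A)

theorem smoothOn_scal {h : (I → ℝ) → ℂ} (hh : ContDiffOn ℝ ∞ h U) :
    SmoothOn (m := m) U (fun x => scal (h x)) := by
  simp only [scal_eq_smul_one]
  exact SmoothOn.smul hh (smoothOn_const 1)

theorem SmoothOn.mul {f g : SFun I m} (hf : SmoothOn U f) (hg : SmoothOn U g) :
    SmoothOn U (fun x => f x * g x) := by
  have : (fun x => f x * g x) = fun x => ∑ A, coeff A (f x) • (mono A * g x) := by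
    funext x
    conv_lhs => rw [← sum_coeff_mono (f x)]
    simp only [Finset.sum_mul, smul_mul_assoc]
  rw [this]
  exact SmoothOn.sum fun A _ => SmoothOn.smul (hf A) (hg.linear (LinearMap.mulLeft ℂ (mono A)))

theorem SmoothOn.pow {f : SFun I m} (hf : SmoothOn U f) (k : ℕ) : SmoothOn U fun x => f x ^ k := by
  induction k with
  | zero => simpa using smoothOn_const 1
  | succ k ih => simp only [pow_succ]; exact ih.mul hf

theorem SmoothOn.body {f : SFun I m} (hf : SmoothOn U f) :
    ContDiffOn ℝ ∞ (fun x => body (f x)) U := by simpa using hf ∅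

theorem SmoothOn.rbody {f : SFun I m} (hf : SmoothOn U f) :
    ContDiffOn ℝ ∞ (fun x => rbody (f x)) U := Complex.reCLM.contDiff.comp_contDiffOn hf.body

theorem contDiffOn_iteratedDeriv {F : ℝ → ℝ} {s : Set ℝ} (hs : IsOpen s) (hF : ContDiffOn ℝ ∞ F s)
    (k : ℕ) : ContDiffOn ℝ ∞ (iteratedDeriv k F) s := by
  induction k with
  | zero => simpa using hF
  | succ k ih =>
    rw [iteratedDeriv_succ]
    exact ((contDiffOn_infty_iff_deriv_of_isOpen hs).1 ih).2

theorem SmoothOn.superApply {f : SFun I m} (hf : SmoothOn U f) {F : ℝ → ℝ}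
    (hF : ContDiffOn ℝ ∞ F (Set.Ioi 0)) (hpos : ∀ x ∈ U, 0 < SuperHopf.rbody (f x)) :
    SmoothOn U fun x => superApply F (f x) := by
  unfold SuperHopf.superApply
  refine SmoothOn.sum fun k _ => SmoothOn.smul ?_ (SmoothOn.pow (hf.fun_sub (smoothOn_scal hf.body)) k)
  refine contDiff_ofReal.comp_contDiffOn (ContDiffOn.div_const ?_ _)
  exact (contDiffOn_iteratedDeriv isOpen_Ioi hF k).comp hf.rbody hpos

variable [DecidableEq I]

/-- Partial derivatives of numerical functions, the odd ones being zero. -/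
def bd (a : I ⊕ OddIx m) (h : (I → ℝ) → ℝ) (x : I → ℝ) : ℝ :=
  Sum.elim (fun i => fderiv ℝ h x (Pi.single i 1)) (fun _ => 0) a

theorem coeff_pd_inl (i : I) (f : SFun I m) (x : I → ℝ) (A : Finset (OddIx m)) :
    coeff A (pd (Sum.inl i) f x) = fderiv ℝ (fun y => coeff A (f y)) x (Pi.single i 1) := by
  simp [pd, coeff_sum, coeff_mono]

theorem SmoothOn.differentiableAt {f : SFun I m} (hf : SmoothOn Set.univ f) (x : I → ℝ)
    (A : Finset (OddIx m)) : DifferentiableAt ℝ (fun y => coeff A (f y)) x :=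
  ((contDiffOn_univ.1 (hf A)).differentiable (by simp)).differentiableAt

theorem pd_linear {f : SFun I m} (hf : SmoothOn Set.univ f) (T : Grass m →ₗ[ℂ] Grass m) (i : I)
    (x : I → ℝ) : pd (Sum.inl i) (fun y => T (f y)) x = T (pd (Sum.inl i) f x) := by
  apply grass_ext
  intro A
  rw [coeff_pd_inl, ← coeffₗ_apply A (T _), ← LinearMap.comp_apply,
    linearMap_apply_eq_sum (coeffₗ A ∘ₗ T)]
  have : (fun y => coeff A (T (f y))) = fun y => ∑ B, coeff B (f y) * coeff A (T (mono B)) := by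
    funext y
    rw [← coeffₗ_apply A, ← LinearMap.comp_apply, linearMap_apply_eq_sum (coeffₗ A ∘ₗ T)]
    simp [coeffₗ_apply]
  rw [this, fderiv_fun_sum fun B _ => (hf.differentiableAt x B).mul_const _]
  simp only [_root_.sum_apply, coeff_pd_inl]
  refine Finset.sum_congr rfl fun B _ => ?_
  rw [fderiv_mul_const (hf.differentiableAt x B)]
  simp [coeffₗ_apply, mul_comm]

theorem pd_smul {a : I ⊕ OddIx m} {f : SFun I m} (hf : SmoothOn Set.univ f) (c : ℂ) (x : I → ℝ) :
    pd a (fun y => c • f y) x = c • pd a f x := by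
  cases a with
  | inl i =>
    have := pd_linear hf (c • LinearMap.id) i x
    simpa only [LinearMap.smul_apply, LinearMap.id_apply] using this
  | inr κ => exact map_smul _ _ _

theorem pd_sum {ι : Type*} {s : Finset ι} {f : ι → SFun I m} (a : I ⊕ OddIx m)
    (hf : ∀ j ∈ s, SmoothOn Set.univ (f j)) (x : I → ℝ) :
    pd a (fun y => ∑ j ∈ s, f j y) x = ∑ j ∈ s, pd a (f j) x := by
  cases a with
  | inr κ => exact map_sum _ _ _
  | inl i =>
    apply grass_ext
    intro A
    simp only [coeff_sum, coeff_pd_inl]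
    rw [fderiv_fun_sum fun j hj => (hf j hj).differentiableAt x A, _root_.sum_apply]

theorem pd_add {f g : SFun I m} (a : I ⊕ OddIx m) (hf : SmoothOn Set.univ f)
    (hg : SmoothOn Set.univ g) (x : I → ℝ) : pd a (fun y => f y + g y) x = pd a f x + pd a g x := by
  have := pd_sum (s := Finset.univ) (f := ![f, g]) a (by simp [hf, hg]) x
  simpa using this

theorem pd_const (a : I ⊕ OddIx m) (g : Grass m) (x : I → ℝ) :
    pd a (fun _ => g) x = Sum.elim (fun _ => 0) (fun κ => oddD κ g) a := by
  cases a with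
  | inl i => apply grass_ext; intro A; simp [coeff_pd_inl]
  | inr κ => rfl

theorem pd_ofReal_smul {f : SFun I m} {h : (I → ℝ) → ℝ} (hh : ContDiff ℝ ∞ h)
    (hf : SmoothOn Set.univ f) (a : I ⊕ OddIx m) (x : I → ℝ) :
    pd a (fun y => (h y : ℂ) • f y) x = (bd a h x : ℂ) • f x + (h x : ℂ) • pd a f x := by
  cases a with
  | inr κ => simp [pd, bd, -Complex.coe_smul]
  | inl i =>
    apply grass_ext
    intro A
    have hd : DifferentiableAt ℝ h x := hh.differentiable (by simp) x
    have hd' : HasFDerivAt (fun y => (h y : ℂ)) (Complex.ofRealCLM.comp (fderiv ℝ h x)) x :=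
      Complex.ofRealCLM.hasFDerivAt.comp x hd.hasFDerivAt
    simp only [coeff_add, coeff_smul, coeff_pd_inl]
    rw [(hd'.fun_mul (hf.differentiableAt x A).hasFDerivAt).fderiv]
    simp [bd, mul_comm, add_comm]

theorem pd_ofReal_scal {h : (I → ℝ) → ℝ} (hh : ContDiff ℝ ∞ h) (a : I ⊕ OddIx m) (x : I → ℝ) :
    pd a (fun y => scal (h y : ℂ)) x = scal (bd a h x : ℂ) := by
  have := pd_ofReal_smul hh (smoothOn_const (1 : Grass m)) a x
  simp only [← scal_eq_smul_one, pd_const] at this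
  rw [this]
  cases a <;> simp

/-- For odd derivatives the evenness of the left factor removes the sign. For even derivatives the
coefficients of a product are a constant bilinear expression in those of the factors. -/
theorem pd_mul_of_even {f g : SFun I m} (hf : SmoothOn Set.univ f) (hg : SmoothOn Set.univ g)
    (he : ∀ y, IsEvenElt (f y)) (a : I ⊕ OddIx m) (x : I → ℝ) :
    pd a (fun y => f y * g y) x = pd a f x * g x + f x * pd a g x := by
  cases a with
  | inr κ => exact oddD_mul_of_even (he x) κ _
  | inl i =>
    apply grass_ext
    intro A
    have key : ∀ (u v : Grass m), coeff A (u * v) =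
        ∑ B, ∑ C, coeff B u * coeff C v * coeff A (mono B * mono C) := by
      intro u v
      conv_lhs => rw [← sum_coeff_mono u, ← sum_coeff_mono v]
      simp only [Finset.sum_mul_sum, smul_mul_smul_comm, coeff_sum, coeff_smul]
    rw [coeff_pd_inl, coeff_add, key, key, ← Finset.sum_add_distrib]
    simp only [key (f _)]
    have hd : ∀ B C, DifferentiableAt ℝ
        (fun y => coeff B (f y) * coeff C (g y) * coeff A (mono B * mono C)) x := fun B C =>
      ((hf.differentiableAt x B).mul (hg.differentiableAt x C)).mul_const _
    rw [fderiv_fun_sum fun B _ => DifferentiableAt.fun_sum fun C _ => hd B C,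
      _root_.sum_apply]
    refine Finset.sum_congr rfl fun B _ => ?_
    rw [fderiv_fun_sum fun C _ => hd B C, _root_.sum_apply, ← Finset.sum_add_distrib]
    refine Finset.sum_congr rfl fun C _ => ?_
    rw [fderiv_mul_const ((hf.differentiableAt x B).fun_mul (hg.differentiableAt x C)),
      fderiv_fun_mul (hf.differentiableAt x B) (hg.differentiableAt x C), coeff_pd_inl,
      coeff_pd_inl]
    simp
    ring

theorem pd_pow_of_even {f : SFun I m} (hf : SmoothOn Set.univ f)
    (he : ∀ y, IsEvenElt (f y)) (a : I ⊕ OddIx m) (x : I → ℝ) (k : ℕ) :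
    pd a (fun y => f y ^ k) x = (k : ℂ) • (f x ^ (k - 1) * pd a f x) := by
  induction k with
  | zero => simp only [pow_zero, pd_const]; cases a <;> simp
  | succ k ih =>
    simp only [pow_succ']
    rw [pd_mul_of_even hf (hf.pow k) he, ih, ← (((he x).pow k).commute _).eq, add_tsub_cancel_right]
    rcases k with _ | k
    · simp
    · rw [add_tsub_cancel_right, mul_smul_comm, ← mul_assoc, ← pow_succ']
      push_cast
      module

theorem bd_comp {F : ℝ → ℝ} {h : (I → ℝ) → ℝ} {x : I → ℝ} (hF : DifferentiableAt ℝ F (h x))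
    (hh : DifferentiableAt ℝ h x) (a : I ⊕ OddIx m) :
    bd a (fun y => F (h y)) x = deriv F (h x) * bd a h x := by
  cases a with
  | inr κ => simp [bd]
  | inl i =>
    have := (hF.hasDerivAt.comp_hasFDerivAt x hh.hasFDerivAt).fderiv
    simp only [Function.comp_def] at this
    simp [bd, this]

/-- Split `f` into its body `b` and its nilpotent part `ν`. Differentiation of the coefficients
`F^(k)(b)/k!` yields the expansion of `F'` times the derivative of `b`; differentiation of `ν^k`
shifts the index by one and yields the same expansion times the derivative of `ν`. -/
theorem pd_superApply {f : SFun I m} (hf : SmoothOn Set.univ f) (he : ∀ y, IsEvenElt (f y))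
    (hr : ∀ y, (body (f y)).im = 0) (hpos : ∀ y, 0 < rbody (f y)) {F : ℝ → ℝ}
    (hF : ContDiffOn ℝ ∞ F (Set.Ioi 0)) (a : I ⊕ OddIx m) (x : I → ℝ) :
    pd a (fun y => superApply F (f y)) x = superApply (deriv F) (f x) * pd a f x := by
  set b : (I → ℝ) → ℝ := fun y => rbody (f y) with hb
  have hbs : ContDiff ℝ ∞ b := contDiffOn_univ.1 hf.rbody
  set ν : SFun I m := fun y => f y - scal (body (f y)) with hν
  have hνs : SmoothOn Set.univ ν := hf.fun_sub (smoothOn_scal hf.body)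
  have hνe : ∀ y, IsEvenElt (ν y) := fun y => (he y).sub (isEvenElt_scal _)
  have hbb : ∀ y, body (f y) = (b y : ℂ) := fun y => by
    apply Complex.ext <;> simp [hb, rbody, hr]
  have hfd : pd a f x = scal (bd a b x : ℂ) + pd a ν x := by
    rw [← pd_ofReal_scal hbs, ← pd_add a (smoothOn_scal (contDiffOn_univ.2
      (contDiff_comp_ofReal hbs))) hνs]
    congr 1
    funext y
    simp [hν, hbb]
  have hFk : ∀ k, ContDiff ℝ ∞ (fun y => iteratedDeriv k F (b y) / (k.factorial : ℝ)) := fun k =>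
    contDiffOn_univ.1 (((contDiffOn_iteratedDeriv isOpen_Ioi hF k).comp hf.rbody
      fun y _ => hpos y).div_const _)
  have hbd : ∀ k, bd a (fun y => iteratedDeriv k F (b y) / (k.factorial : ℝ)) x =
      iteratedDeriv (k + 1) F (b x) / k.factorial * bd a b x := fun k => by
    have hk : DifferentiableAt ℝ (iteratedDeriv k F) (b x) :=
      ((contDiffOn_iteratedDeriv isOpen_Ioi hF k).contDiffAt
        (Ioi_mem_nhds (hpos x))).differentiableAt (by simp)
    rw [bd_comp (F := fun t => iteratedDeriv k F t / (k.factorial : ℝ)) (hk.div_const _)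
      (hbs.differentiable (by simp) x), deriv_div_const, iteratedDeriv_succ]
  have hexp : (fun y => superApply F (f y)) = fun y => ∑ k ∈ Finset.range (2 * m + 1),
      ((iteratedDeriv k F (b y) / (k.factorial : ℝ) : ℝ) : ℂ) • ν y ^ k := rfl
  have hexp' : superApply (deriv F) (f x) = ∑ k ∈ Finset.range (2 * m + 1),
      ((iteratedDeriv (k + 1) F (b x) / (k.factorial : ℝ) : ℝ) : ℂ) • ν x ^ k := by
    unfold superApply
    simp only [iteratedDeriv_succ']
    rfl
  -- After the index shift the second sum is one term short of the expansion of `F'`. The missing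
  -- term contains `ν^{2m}` times the derivative of `ν`, a multiple of the derivative of `ν^{2m+1} =
  -- 0`.
  have htop : ν x ^ (2 * m) * pd a ν x = 0 := by
    have h1 := pd_pow_of_even hνs hνe a x (2 * m + 1)
    have h2 : (fun y => ν y ^ (2 * m + 1)) = fun _ => 0 := by
      funext y; exact pow_eq_zero_of_body_eq_zero (by simp [hν]) (by omega)
    rw [h2, pd_const, add_tsub_cancel_right] at h1
    have h3 : (0 : Grass m) = ((2 * m + 1 : ℕ) : ℂ) • (ν x ^ (2 * m) * pd a ν x) := by
      rw [← h1]; cases a <;> simp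
    exact (smul_eq_zero.1 h3.symm).resolve_left (Nat.cast_ne_zero.2 (Nat.succ_ne_zero _))
  rw [hexp, pd_sum a (fun k _ => SmoothOn.smul (contDiffOn_univ.2 (contDiff_comp_ofReal (hFk k)))
    (hνs.pow k)), hexp', hfd, mul_add, Finset.sum_mul, Finset.sum_mul]
  simp only [pd_ofReal_smul (hFk _) (hνs.pow _), Finset.sum_add_distrib, hbd]
  congr 1
  · refine Finset.sum_congr rfl fun k _ => ?_
    rw [smul_mul_assoc, mul_scal, smul_smul, Complex.ofReal_mul]
  · rw [Finset.sum_range_succ', Finset.sum_range_succ]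
    simp only [pd_pow_of_even hνs hνe]
    rw [smul_mul_assoc, htop]
    simp only [Nat.cast_zero, zero_smul, smul_zero, add_zero]
    refine Finset.sum_congr rfl fun k _ => ?_
    rw [smul_smul, add_tsub_cancel_right, smul_mul_assoc]
    congr 1
    have : ((k.factorial : ℕ) : ℂ) ≠ 0 := by exact_mod_cast Nat.factorial_ne_zero k
    have : ((k : ℂ) + 1) ≠ 0 := by exact_mod_cast Nat.succ_ne_zero k
    rw [Nat.factorial_succ]
    push_cast
    field_simp

end SmoothCalculus

/-! ### Determinants of odd rank-one perturbations of the identity -/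

section OddDeterminant

/-- The hypothesis is satisfied by `T i j = p i * r j` with odd vectors `p`, `r`. This is the odd
counterpart of the matrix determinant lemma: anticommutation turns `1 + tr T` into `1 / (1 - tr T)`.
The induction takes the Schur complement at the last diagonal entry `1 + u`. -/
theorem det_one_add_mul_one_sub_trace_aux {R : Type*} [CommRing R] [Algebra ℂ R] (p : ℕ)
    (T : Matrix (Fin p) (Fin p) R) (hT : ∀ i j k l, T i j * T k l = -(T i l * T k j)) :
    (1 + T).det * (1 - T.trace) = 1 := by
  induction p with
  | zero => simp [Matrix.trace]
  | succ p ih =>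
    set e : Fin p ⊕ Fin 1 ≃ Fin (p + 1) := finSumFinEquiv
    set u := T (e (Sum.inr 0)) (e (Sum.inr 0)) with hu
    have h2 : ∀ i j l, T i j * T i l = -(T i l * T i j) := fun i j l => hT i j i l
    have hu2 : u * u = 0 := by
      have h := h2 (e (Sum.inr 0)) (e (Sum.inr 0)) (e (Sum.inr 0))
      -- The exchange relation only gives `u * u = -(u * u)`; the complex scalars permit division by
      -- 2.
      have h' : (2 : ℂ) • (u * u) = 0 := by
        rw [two_smul]; nth_rewrite 1 [h]; simp [hu]
      have := congrArg (fun r => (2 : ℂ)⁻¹ • r) h'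
      simpa [smul_smul] using this
    -- By the exchange relation the product of the entries `(i, last)` and `(last, j)` is `-u` times
    -- the entry `(i, j)`. Since `(1 + u)⁻¹ = 1 - u` and `(1 - u) u = u`, elimination leaves `1 +
    -- T'`, and `T'` obeys the same relation.
    set T' : Matrix (Fin p) (Fin p) R :=
      Matrix.of fun i j => (1 + u) * T (e (Sum.inl i)) (e (Sum.inl j)) with hT'
    have hdet : (1 + T).det = (1 + u) * (1 + T').det := by
      rw [← Matrix.det_submatrix_equiv_self e, ← Matrix.fromBlocks_toBlocks ((1 + T).submatrix e e)]
      have h22 : ((1 + T).submatrix e e).toBlocks₂₂ = Matrix.diagonal fun _ => 1 + u := by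
        ext i j
        rw [Subsingleton.elim i 0, Subsingleton.elim j 0]
        simp [Matrix.toBlocks₂₂, hu]
      have hinv : (1 - u) * (1 + u) = 1 := by linear_combination -hu2
      let _ : Invertible (Matrix.diagonal fun _ : Fin 1 => 1 + u) :=
        ⟨Matrix.diagonal fun _ => 1 - u, by rw [Matrix.diagonal_mul_diagonal]; simp [hinv],
          by rw [Matrix.diagonal_mul_diagonal]; simp [mul_comm (1 + u), hinv]⟩
      rw [h22, Matrix.det_fromBlocks₂₂, Matrix.det_diagonal, Fin.prod_univ_one]
      congr 2
      ext i j
      have h0 : ⅟(Matrix.diagonal fun _ : Fin 1 => 1 + u) = Matrix.diagonal fun _ => 1 - u := rfl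
      rw [h0]
      simp only [Matrix.sub_apply, Matrix.mul_apply, Matrix.diagonal_apply, Fin.sum_univ_one,
        Matrix.toBlocks₁₁, Matrix.toBlocks₁₂, Matrix.toBlocks₂₁, Matrix.of_apply,
        Matrix.submatrix_apply, Matrix.add_apply, Matrix.one_apply, if_true, hT', reduceCtorEq,
        EmbeddingLike.apply_eq_iff_eq, Sum.inl.injEq, if_false, zero_add]
      have := hT (e (Sum.inl i)) (e (Sum.inr 0)) (e (Sum.inr 0)) (e (Sum.inl j))
      rw [← hu] at this
      linear_combination -(1 - u) * this - T (e (Sum.inl i)) (e (Sum.inl j)) * hu2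
    have htr : T.trace = u + ∑ i, T (e (Sum.inl i)) (e (Sum.inl i)) := by
      rw [Matrix.trace, ← Equiv.sum_comp e, Fintype.sum_sum_type, Fin.sum_univ_one, add_comm]
      rfl
    have htr' : T'.trace = (1 + u) * ∑ i, T (e (Sum.inl i)) (e (Sum.inl i)) := by
      rw [Matrix.trace, Finset.mul_sum]; rfl
    have hT'' : ∀ i j k l, T' i j * T' k l = -(T' i l * T' k j) := fun i j k l => by
      simp only [hT', Matrix.of_apply]
      linear_combination (1 + u) ^ 2 * hT (e (Sum.inl i)) (e (Sum.inl j)) (e (Sum.inl k)) (e (Sum.inl l))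
    have := ih T' hT''
    rw [htr'] at this
    rw [hdet, htr]
    linear_combination this - (1 + T').det * hu2

theorem det_one_add_mul_one_sub_trace {R : Type*} [CommRing R] [Algebra ℂ R] {ι : Type*}
    [Fintype ι] [DecidableEq ι] (T : Matrix ι ι R)
    (hT : ∀ i j k l, T i j * T k l = -(T i l * T k j)) :
    (1 + T).det * (1 - T.trace) = 1 := by
  set e := (Fintype.equivFin ι).symm
  have h := det_one_add_mul_one_sub_trace_aux _ (T.submatrix e e) fun i j k l => hT _ _ _ _
  have h1 : (1 + T.submatrix e e) = (1 + T).submatrix e e := by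
    ext i j; simp [Matrix.one_apply]
  have h2 : (T.submatrix e e).trace = T.trace := Equiv.sum_comp e fun i => T i i
  rwa [h1, Matrix.det_submatrix_equiv_self, h2] at h

end OddDeterminant

/-! ### The odd block of the metrics: determinant and inverse -/

section OddPairing

variable {m : ℕ} {R V : Type*} [CommRing R] [InvolutiveNeg V] {B : V → V → R}

/-- A pairing with the algebraic properties of the product of two odd elements of a supercommutative
algebra, with values in the even elements. -/
structure IsOddPairing (B : V → V → R) : Prop where
  anticomm : ∀ a b, B a b = -B b a
  exchange : ∀ a b c d, B a b * B c d = B b c * B a d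
  neg_right : ∀ a b, B a (-b) = -B a b

theorem IsOddPairing.neg_left (hB : IsOddPairing B) (a b : V) : B (-a) b = -B a b := by
  rw [hB.anticomm, hB.neg_right, hB.anticomm b a, neg_neg]

/-- Multiplication by the matrix of the symplectic form on the odd directions. -/
def sympl (v : OddIx m → V) : OddIx m → V :=
  fun κ => if κ.2 = 0 then -v (κ.1, 1) else v (κ.1, 0)

/-- The matrix of products of the entries of two odd vectors. -/
def outer (B : V → V → R) (p r : OddIx m → V) : Matrix (OddIx m) (OddIx m) R :=
  Matrix.of fun i j => B (p i) (r j)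

/-- The scalar product of odd vectors. -/
def odot (B : V → V → R) (p r : OddIx m → V) : R := ∑ k, B (p k) (r k)

/-- The matrix of the symplectic form. -/
def symplMat (R : Type*) [CommRing R] (m : ℕ) : Matrix (OddIx m) (OddIx m) R :=
  Matrix.of fun κ κ' => if κ.1 = κ'.1 then
      (if κ.2 = 1 ∧ κ'.2 = 0 then 1 else if κ.2 = 0 ∧ κ'.2 = 1 then -1 else 0) else 0

/-- The inner factors combine to an even scalar that moves to the front, as for ordinary rank-one
matrices. -/
theorem outer_mul_outer (hB : IsOddPairing B) (p r p' r' : OddIx m → V) :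
    outer B p r * outer B p' r' = odot B r p' • outer B p r' := by
  ext i j
  simp only [Matrix.mul_apply, outer, Matrix.of_apply, Matrix.smul_apply, odot, smul_eq_mul,
    Finset.sum_mul]
  exact Finset.sum_congr rfl fun k _ => hB.exchange _ _ _ _

theorem odot_anticomm (hB : IsOddPairing B) (p r : OddIx m → V) : odot B p r = -odot B r p := by
  simp only [odot, ← Finset.sum_neg_distrib]
  exact Finset.sum_congr rfl fun k _ => hB.anticomm _ _

theorem sympl_sympl (v : OddIx m → V) : sympl (sympl v) = -v := by
  funext ⟨μ, s⟩
  fin_cases s <;> simp [sympl]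

theorem symplMat_mul_outer (hB : IsOddPairing B) (p r : OddIx m → V) :
    symplMat R m * outer B p r = outer B (sympl p) r := by
  ext ⟨μ, s⟩ j
  simp only [Matrix.mul_apply, Fintype.sum_prod_type, Fin.sum_univ_two, symplMat, outer,
    Matrix.of_apply, sympl]
  fin_cases s <;> simp [ite_mul, hB.neg_left]

theorem outer_mul_symplMat (hB : IsOddPairing B) (p r : OddIx m → V) :
    outer B p r * symplMat R m = -outer B p (sympl r) := by
  ext i ⟨μ, s⟩
  simp only [Matrix.mul_apply, Fintype.sum_prod_type, Fin.sum_univ_two, symplMat, outer,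
    Matrix.of_apply, sympl, Matrix.neg_apply]
  fin_cases s <;> simp [mul_ite, hB.neg_right]

theorem symplMat_mul_self (R : Type*) [CommRing R] :
    symplMat R m * symplMat R m = -1 := by
  ext ⟨μ, s⟩ ⟨μ', s'⟩
  simp only [Matrix.mul_apply, Fintype.sum_prod_type, Fin.sum_univ_two, symplMat,
    Matrix.of_apply, Matrix.neg_apply, Matrix.one_apply, Prod.mk.injEq]
  fin_cases s <;> fin_cases s' <;> by_cases h : μ = μ' <;> simp [h]

theorem det_symplMat (R : Type*) [CommRing R] : (symplMat R m).det = 1 := by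
  have : symplMat R m = Matrix.kroneckerMap (· * ·) (1 : Matrix (Fin m) (Fin m) R) !![0, -1; 1, 0] := by
    ext ⟨μ, s⟩ ⟨μ', s'⟩
    fin_cases s <;> fin_cases s' <;> by_cases h : μ = μ' <;>
      simp [symplMat, h]
  rw [this, Matrix.det_kronecker]
  simp [Matrix.det_fin_two]

theorem det_one_add_smul_outer [Algebra ℂ R] (hB : IsOddPairing B) (c : R) (p r : OddIx m → V) :
    (1 + c • outer B p r).det * (1 - c * odot B p r) = 1 := by
  have h := det_one_add_mul_one_sub_trace (c • outer B p r) fun i j k l => ?_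
  · simpa [Matrix.trace, Matrix.diag, outer, odot, Finset.mul_sum] using h
  · simp only [Matrix.smul_apply, outer, Matrix.of_apply, smul_eq_mul]
    have h1 : B (p i) (r j) * B (p k) (r l) = -(B (p i) (r l) * B (p k) (r j)) := by
      rw [hB.exchange, hB.anticomm (r j) (p k)]; ring
    linear_combination c ^ 2 * h1

/-- The odd block `ε - Σ ν_a w_a w_aᵀ`, its determinant. -/
theorem det_symplMat_sub [Algebra ℂ R] (hB : IsOddPairing B) (w₁ w₂ : OddIx m → V) (ν₁ ν₂ q s₁ s₂ : R)
    (h₁ : odot B w₁ (sympl w₁) = -q) (h₂ : odot B w₂ (sympl w₂) = -q) (h₁₂ : odot B w₁ (sympl w₂) = 0)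
    (hs₁ : s₁ * (1 - ν₁ * q) = 1) (hs₂ : s₂ * (1 - ν₂ * q) = 1) :
    (symplMat R m - ν₁ • outer B w₁ w₁ - ν₂ • outer B w₂ w₂).det = s₁ * s₂ := by
  -- The symplectic matrix squares to `-1`, which restores the two outer products, and the cross
  -- term carries the factor `odot B w₁ (sympl w₂) = 0`.
  have hfac : symplMat R m - ν₁ • outer B w₁ w₁ - ν₂ • outer B w₂ w₂ =
      symplMat R m * (1 + ν₁ • outer B (sympl w₁) w₁) *
        (1 + ν₂ • outer B (sympl w₂) w₂) := by
    have hneg : ∀ p r : OddIx m → V, outer B (-p) r = -outer B p r := fun p r => by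
      ext i j; exact hB.neg_left _ _
    simp only [mul_add, add_mul, Matrix.mul_smul, Matrix.smul_mul, mul_one, symplMat_mul_outer hB,
      sympl_sympl, hneg, outer_mul_outer hB, h₁₂, zero_smul, Matrix.neg_mul]
    module
  have e₁ := det_one_add_smul_outer hB ν₁ (sympl w₁) w₁
  have e₂ := det_one_add_smul_outer hB ν₂ (sympl w₂) w₂
  rw [odot_anticomm hB, h₁, neg_neg] at e₁
  rw [odot_anticomm hB, h₂, neg_neg] at e₂
  rw [hfac, Matrix.det_mul, Matrix.det_mul, det_symplMat, one_mul,
    show (1 + ν₁ • outer B (sympl w₁) w₁).det = s₁ by linear_combination s₁ * e₁ -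
      (1 + ν₁ • outer B (sympl w₁) w₁).det * hs₁,
    show (1 + ν₂ • outer B (sympl w₂) w₂).det = s₂ by linear_combination s₂ * e₂ -
      (1 + ν₂ • outer B (sympl w₂) w₂).det * hs₂]

/-- This is the Sherman–Morrison formula for two symplectically orthogonal rank-one perturbations:
they do not interact, and each coefficient becomes `ν / (1 - ν q) = s ν`. -/
theorem symplMat_sub_mul_inverse (hB : IsOddPairing B) (w₁ w₂ : OddIx m → V) (ν₁ ν₂ q s₁ s₂ : R)
    (h₁ : odot B w₁ (sympl w₁) = -q) (h₂ : odot B w₂ (sympl w₂) = -q) (h₁₂ : odot B w₁ (sympl w₂) = 0)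
    (h₂₁ : odot B w₂ (sympl w₁) = 0)
    (hs₁ : s₁ * (1 - ν₁ * q) = 1) (hs₂ : s₂ * (1 - ν₂ * q) = 1) :
    (symplMat R m - ν₁ • outer B w₁ w₁ - ν₂ • outer B w₂ w₂) *
      (-symplMat R m - (s₁ * ν₁) • outer B (sympl w₁) (sympl w₁)
        - (s₂ * ν₂) • outer B (sympl w₂) (sympl w₂)) = 1 := by
  have hneg : ∀ p r : OddIx m → V, outer B (-p) r = -outer B p r := fun p r => by
    ext i j; exact hB.neg_left _ _
  simp only [mul_sub, sub_mul, mul_neg, Matrix.mul_smul, Matrix.smul_mul, symplMat_mul_outer hB,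
      outer_mul_symplMat hB, symplMat_mul_self, sympl_sympl, hneg, outer_mul_outer hB, h₁, h₂, h₁₂, h₂₁]
  have k₁ : s₁ * ν₁ - ν₁ - s₁ * ν₁ * ν₁ * q = 0 := by linear_combination ν₁ * hs₁
  have k₂ : s₂ * ν₂ - ν₂ - s₂ * ν₂ * ν₂ * q = 0 := by linear_combination ν₂ * hs₂
  calc _ = 1 + (s₁ * ν₁ - ν₁ - s₁ * ν₁ * ν₁ * q) • outer B w₁ (sympl w₁) +
        (s₂ * ν₂ - ν₂ - s₂ * ν₂ * ν₂ * q) • outer B w₂ (sympl w₂) := by module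
    _ = 1 := by rw [k₁, k₂]; simp

/-- The inverse odd block enters the Berezinian only through such contractions with odd vectors. The
exchange rule splits each rank-one term into a product of two scalar products. -/
theorem sum_inverse_mul_pairing (hB : IsOddPairing B) (w₁ w₂ p r : OddIx m → V) (c₁ c₂ : R) :
    ∑ κ, ∑ l, (-symplMat R m - c₁ • outer B (sympl w₁) (sympl w₁)
        - c₂ • outer B (sympl w₂) (sympl w₂)) κ l * B (p κ) (r l) =
      -odot B p (sympl r) - c₁ * (odot B p (sympl w₁) * odot B (sympl w₁) r)
        - c₂ * (odot B p (sympl w₂) * odot B (sympl w₂) r) := by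
  have h1 : ∀ w : OddIx m → V, ∑ κ, ∑ l, outer B (sympl w) (sympl w) κ l * B (p κ) (r l) =
      odot B p (sympl w) * odot B (sympl w) r := by
    intro w
    simp only [odot, Finset.sum_mul_sum, outer, Matrix.of_apply]
    exact Finset.sum_congr rfl fun κ _ => Finset.sum_congr rfl fun l _ =>
      (hB.exchange _ _ _ _).symm
  have h2 : ∑ κ, ∑ l, symplMat R m κ l * B (p κ) (r l) = odot B p (sympl r) := by
    simp only [odot]
    refine Finset.sum_congr rfl fun κ _ => ?_
    obtain ⟨μ, s⟩ := κ
    simp only [Fintype.sum_prod_type, Fin.sum_univ_two, symplMat, Matrix.of_apply, sympl]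
    fin_cases s <;> simp [ite_mul, hB.neg_right]
  simp only [Matrix.sub_apply, Matrix.neg_apply, Matrix.smul_apply, smul_eq_mul, sub_mul, neg_mul,
    Finset.sum_sub_distrib, Finset.sum_neg_distrib, mul_assoc, ← Finset.mul_sum, h1, h2]

end OddPairing

/-! ### Products of odd elements of the Grassmann algebra -/

section OddVectors

variable {m : ℕ}

/-- The odd part of the Grassmann algebra. -/
abbrev OddGrass (m : ℕ) : Type :=
  CliffordAlgebra.evenOdd (0 : QuadraticForm ℂ (OddIx m → ℂ)) 1

/-- The product of two odd elements. -/
def oddMul (a b : OddGrass m) : EvenGrass m := ⟨(a : Grass m) * b, IsOddElt.mul a.2 b.2⟩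

@[simp] theorem coe_oddMul (a b : OddGrass m) : (oddMul a b : Grass m) = (a : Grass m) * b := rfl

theorem odd_mul_odd {a b : Grass m} (ha : IsOddElt a) (hb : IsOddElt b) : a * b = -(b * a) := by
  have hgen : ∀ (v : OddIx m → ℂ) (b : Grass m), IsOddElt b →
      CliffordAlgebra.ι 0 v * b = -(b * CliffordAlgebra.ι 0 v) := by
    intro v b hb
    replace hb : b ∈ CliffordAlgebra.evenOdd (0 : QuadraticForm ℂ (OddIx m → ℂ)) 1 := hb
    induction b, hb using CliffordAlgebra.odd_induction with
    | ι w => exact eq_neg_of_add_eq_zero_left (ExteriorAlgebra.ι_add_mul_swap v w)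
    | add x y _ _ hx hy => rw [mul_add, hx, hy, add_mul, neg_add]
    | ι_mul_ι_mul w w' x _ hx =>
      have := (ι_mul_ι_commute w w' (CliffordAlgebra.ι 0 v)).eq
      change CliffordAlgebra.ι 0 w * CliffordAlgebra.ι 0 w' * CliffordAlgebra.ι 0 v =
        CliffordAlgebra.ι 0 v * (CliffordAlgebra.ι 0 w * CliffordAlgebra.ι 0 w') at this
      rw [← mul_assoc, ← this, mul_assoc, hx, mul_neg]; simp only [mul_assoc]
  replace ha : a ∈ CliffordAlgebra.evenOdd (0 : QuadraticForm ℂ (OddIx m → ℂ)) 1 := ha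
  induction a, ha using CliffordAlgebra.odd_induction with
  | ι v => exact hgen v b hb
  | add x y _ _ hx hy => rw [add_mul, hx, hy, mul_add, neg_add]
  | ι_mul_ι_mul w w' x _ hx =>
    have := (ι_mul_ι_commute w w' b).eq
    change CliffordAlgebra.ι 0 w * CliffordAlgebra.ι 0 w' * b =
        b * (CliffordAlgebra.ι 0 w * CliffordAlgebra.ι 0 w') at this
    rw [mul_assoc, hx, mul_neg, ← mul_assoc, this, mul_assoc]

theorem oddMul_anticomm (a b : OddGrass m) : oddMul a b = -oddMul b a :=
  Subtype.ext (odd_mul_odd a.2 b.2)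

theorem oddMul_mul_oddMul (a b c d : OddGrass m) :
    oddMul a b * oddMul c d = oddMul b c * oddMul a d := by
  apply Subtype.ext
  change (a : Grass m) * b * (c * d) = b * c * (a * d)
  have h : Commute ((b : Grass m) * c) (a : Grass m) := (IsOddElt.mul b.2 c.2).commute _
  rw [← mul_assoc _ (a : Grass m) (d : Grass m), h.eq]
  simp only [mul_assoc]

theorem oddMul_neg (a b : OddGrass m) : oddMul a (-b) = -oddMul a b :=
  Subtype.ext (mul_neg _ _)

theorem isOddPairing_oddMul : IsOddPairing (oddMul (m := m)) :=
  ⟨oddMul_anticomm, oddMul_mul_oddMul, oddMul_neg⟩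

end OddVectors

/-! ### Berezinians of matrices of Gram type -/

section Berezinian

variable {m : ℕ}

theorem evenPart_coe (e : EvenGrass m) : evenPart (e : Grass m) = e := by
  apply Subtype.ext
  exact DirectSum.decompose_of_mem_same _ e.2

theorem coe_mul_coe_mul_coe (a e b : EvenGrass m) (x y : OddGrass m) :
    ((a : Grass m) * x) * e * (b * y) = ((a * e * b * oddMul x y : EvenGrass m) : Grass m) := by
  have h : ∀ (e : EvenGrass m) (f : Grass m), f * (e : Grass m) = e * f := fun e f =>
    (IsEvenElt.commute e.2 f).eq.symm
  change _ = (a : Grass m) * e * b * (x * y)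
  rw [mul_assoc (a : Grass m), h e x, mul_assoc (a : Grass m), mul_assoc (e : Grass m),
    ← mul_assoc (x : Grass m) (b : Grass m), h b x]
  simp only [mul_assoc]

/-- The computation moves to matrices over the commutative ring of even elements, with the inverse
of the odd block supplied by hand. -/
theorem ber_of_coe {I : Type*} [Fintype I] [DecidableEq I]
    {M : Matrix (I ⊕ OddIx m) (I ⊕ OddIx m) (Grass m)} {D D' : Matrix (OddIx m) (OddIx m) (EvenGrass m)}
    {S : Matrix I I (EvenGrass m)} (hM : M.toBlocks₂₂ = D.map (fun e => (e : Grass m)))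
    (hD : D * D' = 1)
    (hS : M.toBlocks₁₁ - M.toBlocks₁₂ * D'.map (fun e => (e : Grass m)) * M.toBlocks₂₁ =
      S.map (fun e => (e : Grass m))) :
    ber M = ((S.det * Ring.inverse D.det : EvenGrass m) : Grass m) := by
  have h1 : M.toBlocks₂₂.map evenPart = D := by
    rw [hM]; ext i j : 1; exact evenPart_coe _
  unfold ber
  dsimp only
  rw [h1, Matrix.inv_eq_right_inv hD, hS]
  have h2 : (S.map (fun e => (e : Grass m))).map evenPart = S := by ext i j : 1; exact evenPart_coe _
  rw [h2]

/-- Sphere and projective space are both instances. The mixed entries involve only two odd vectors,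
symplectically orthogonal and with the same square `-q`. The inverse odd block contracts `w₁` with
itself to `s₁ q`, `w₂` with itself to `s₂ q`, and mixed pairs to zero; hence odd elimination merely
subtracts multiples of the outer squares of `A₁` and `A₂` from the even block. -/
theorem ber_eq_of_gram {I : Type*} [Fintype I] [DecidableEq I]
    {M : Matrix (I ⊕ OddIx m) (I ⊕ OddIx m) (Grass m)} {c c' : EvenGrass m} (hc : c * c' = 1)
    {w₁ w₂ : OddIx m → OddGrass m} {ν₁ ν₂ q s₁ s₂ : EvenGrass m}
    (h₁ : odot oddMul w₁ (sympl w₁) = -q) (h₂ : odot oddMul w₂ (sympl w₂) = -q)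
    (h₁₂ : odot oddMul w₁ (sympl w₂) = 0) (h₂₁ : odot oddMul w₂ (sympl w₁) = 0)
    (hs₁ : s₁ * (1 - ν₁ * q) = 1) (hs₂ : s₂ * (1 - ν₂ * q) = 1)
    {B : Matrix I I (EvenGrass m)} {A₁ A₂ : I → EvenGrass m}
    (h11 : ∀ i j, M (Sum.inl i) (Sum.inl j) = ((c * B i j : EvenGrass m) : Grass m))
    (h12 : ∀ i κ, M (Sum.inl i) (Sum.inr κ) = ((c * A₁ i : EvenGrass m) : Grass m) * w₁ κ +
      ((c * A₂ i : EvenGrass m) : Grass m) * w₂ κ)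
    (h21 : ∀ i κ, M (Sum.inr κ) (Sum.inl i) = ((c * A₁ i : EvenGrass m) : Grass m) * w₁ κ +
      ((c * A₂ i : EvenGrass m) : Grass m) * w₂ κ)
    (h22 : ∀ κ l, M (Sum.inr κ) (Sum.inr l) = ((c * (symplMat (EvenGrass m) m
      - ν₁ • outer oddMul w₁ w₁ - ν₂ • outer oddMul w₂ w₂) κ l : EvenGrass m) : Grass m)) :
    ber M = ((c ^ Fintype.card I * (Matrix.of fun i j => B i j - s₁ * q * (A₁ i * A₁ j)
      - s₂ * q * (A₂ i * A₂ j)).det * Ring.inverse (c ^ (2 * m) * (s₁ * s₂)) : EvenGrass m) : Grass m) := by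
  have hB := isOddPairing_oddMul (m := m)
  set D := symplMat (EvenGrass m) m - ν₁ • outer oddMul w₁ w₁ - ν₂ • outer oddMul w₂ w₂ with hDdef
  set D' := -symplMat (EvenGrass m) m - (s₁ * ν₁) • outer oddMul (sympl w₁) (sympl w₁)
        - (s₂ * ν₂) • outer oddMul (sympl w₂) (sympl w₂) with hD'def
  have hDD : D * D' = 1 := symplMat_sub_mul_inverse hB w₁ w₂ ν₁ ν₂ q s₁ s₂ h₁ h₂ h₁₂ h₂₁ hs₁ hs₂
  have hdet : D.det = s₁ * s₂ := det_symplMat_sub hB w₁ w₂ ν₁ ν₂ q s₁ s₂ h₁ h₂ h₁₂ hs₁ hs₂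
  have hcard : Fintype.card (OddIx m) = 2 * m := by simp [mul_comm]
  rw [ber_of_coe (D := c • D) (D' := c' • D') (S := c • Matrix.of fun i j => B i j -
    s₁ * q * (A₁ i * A₁ j) - s₂ * q * (A₂ i * A₂ j)), Matrix.det_smul, Matrix.det_smul, hdet, hcard]
  · ext κ l : 1; exact h22 κ l
  · rw [Matrix.smul_mul, Matrix.mul_smul, smul_smul, hc, hDD, one_smul]
  · have form : ∀ p r : OddIx m → OddGrass m, ∑ κ, ∑ l, D' κ l * oddMul (p κ) (r l) =
        -odot oddMul p (sympl r) - s₁ * ν₁ * (odot oddMul p (sympl w₁) * odot oddMul (sympl w₁) r)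
        - s₂ * ν₂ * (odot oddMul p (sympl w₂) * odot oddMul (sympl w₂) r) := fun p r =>
      sum_inverse_mul_pairing hB w₁ w₂ p r (s₁ * ν₁) (s₂ * ν₂)
    have f11 : ∑ κ, ∑ l, D' κ l * oddMul (w₁ κ) (w₁ l) = s₁ * q := by
      rw [form, odot_anticomm hB (sympl w₁), odot_anticomm hB (sympl w₂), h₁, h₁₂]
      linear_combination -q * hs₁
    have f22 : ∑ κ, ∑ l, D' κ l * oddMul (w₂ κ) (w₂ l) = s₂ * q := by
      rw [form, odot_anticomm hB (sympl w₁), odot_anticomm hB (sympl w₂), h₂, h₂₁]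
      linear_combination -q * hs₂
    have f12 : ∑ κ, ∑ l, D' κ l * oddMul (w₁ κ) (w₂ l) = 0 := by
      rw [form, odot_anticomm hB (sympl w₁), odot_anticomm hB (sympl w₂), h₂, h₂₁, h₁₂]
      ring
    have f21 : ∑ κ, ∑ l, D' κ l * oddMul (w₂ κ) (w₁ l) = 0 := by
      rw [form, odot_anticomm hB (sympl w₁), odot_anticomm hB (sympl w₂), h₂₁, h₁₂]
      ring
    have coe_sum : ∀ (g : OddIx m → OddIx m → EvenGrass m),
        ∑ l, ∑ κ, (g κ l : Grass m) = ((∑ κ, ∑ l, g κ l : EvenGrass m) : Grass m) := fun g => by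
      rw [Finset.sum_comm]
      simp only [AddSubmonoidClass.coe_finsetSum]
    ext i j : 1
    have hprod : (M.toBlocks₁₂ * (c' • D').map (fun e => (e : Grass m)) * M.toBlocks₂₁) i j =
        ((c * (s₁ * q * (A₁ i * A₁ j) + s₂ * q * (A₂ i * A₂ j)) : EvenGrass m) : Grass m) := by
      -- The two mixed blocks contribute `c` each and the inverse odd block contributes `c'`, so a
      -- single `c` remains.
      have hterm : ∀ l κ, M (Sum.inl i) (Sum.inr κ) * ((c' * D' κ l : EvenGrass m) : Grass m) *
          M (Sum.inr l) (Sum.inl j) =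
          ((c * (A₁ i * A₁ j * (D' κ l * oddMul (w₁ κ) (w₁ l)) +
            A₁ i * A₂ j * (D' κ l * oddMul (w₁ κ) (w₂ l)) +
            A₂ i * A₁ j * (D' κ l * oddMul (w₂ κ) (w₁ l)) +
            A₂ i * A₂ j * (D' κ l * oddMul (w₂ κ) (w₂ l))) : EvenGrass m) : Grass m) := by
        intro l κ
        rw [h12, h21, add_mul, add_mul, mul_add, mul_add, coe_mul_coe_mul_coe, coe_mul_coe_mul_coe,
          coe_mul_coe_mul_coe, coe_mul_coe_mul_coe]
        simp only [← Subalgebra.coe_add]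
        congr 1
        linear_combination c * (A₁ i * A₁ j * (D' κ l * oddMul (w₁ κ) (w₁ l)) +
            A₁ i * A₂ j * (D' κ l * oddMul (w₁ κ) (w₂ l)) +
            A₂ i * A₁ j * (D' κ l * oddMul (w₂ κ) (w₁ l)) +
            A₂ i * A₂ j * (D' κ l * oddMul (w₂ κ) (w₂ l))) * hc
      simp only [Matrix.mul_apply, Finset.sum_mul, Matrix.map_apply, Matrix.smul_apply, smul_eq_mul,
        Matrix.toBlocks₁₂, Matrix.toBlocks₂₁, Matrix.of_apply, hterm]
      rw [coe_sum]
      congr 1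
      simp only [← Finset.mul_sum, Finset.sum_add_distrib, f11, f12, f21, f22]
      ring
    rw [Matrix.sub_apply, hprod]
    change M (Sum.inl i) (Sum.inl j) - _ = _
    rw [h11, ← Subalgebra.coe_sub]
    simp only [Matrix.map_apply, Matrix.smul_apply, Matrix.of_apply, smul_eq_mul]
    congr 1
    ring

end Berezinian

/-! ### The Euclidean pairing in affine coordinates -/

section AffineMetric

variable {n m : ℕ}

/-- Half of the differential of `N`, in affine coordinates. -/
def halfDN (x : CplxIx n → ℝ) : CplxIx n ⊕ OddIx m → Grass m :=
  Sum.elim (fun i => scal (x i : ℂ)) fun κ => if κ.2 = 0 then gen (κ.1, 1) else -gen (κ.1, 0)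

/-- The components of the connection form `Im(δw·w̄ + i δθ·θ̄)`, in affine coordinates. -/
def connForm (x : CplxIx n → ℝ) : CplxIx n ⊕ OddIx m → Grass m :=
  Sum.elim (fun i => if i.2 = 0 then -scal (x (i.1, 1) : ℂ) else scal (x (i.1, 0) : ℂ)) gen

/-- The nilpotent part of `N`. -/
def nilN (m : ℕ) : Grass m := (2 : ℂ) • ∑ μ : Fin m, gen (μ, 0) * gen (μ, 1)

/-- The rows of the Jacobi matrix of the affine coordinates. -/
def affineRow (k : Fin (n + 1)) (a : CplxIx n ⊕ OddIx m) (e : AmbIx n m) : Grass m :=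
  if Sum.map (fun i : CplxIx n => (k.succAbove i.1, i.2)) id a = e then 1 else 0

/-- The bilinear form of the Euclidean metric. -/
def pairG (U V : AmbIx n m → Grass m) : Grass m :=
  ∑ p, U (Sum.inl p) * V (Sum.inl p) +
    ∑ μ, (U (Sum.inr (μ, 1)) * V (Sum.inr (μ, 0)) - U (Sum.inr (μ, 0)) * V (Sum.inr (μ, 1)))

/-- Sign change of the odd components. -/
def flipOdd (V : AmbIx n m → Grass m) : AmbIx n m → Grass m :=
  Sum.elim (fun p => V (Sum.inl p)) fun κ => -V (Sum.inr κ)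

/-- The sign rule of the supertranspose, depending on the parity of the coordinate. -/
def signOdd {I : Type*} (b : I ⊕ OddIx m) (V : AmbIx n m → Grass m) : AmbIx n m → Grass m :=
  Sum.elim (fun _ => flipOdd V) (fun _ => V) b

/-- The supertranspose changes signs only where an odd component meets an even coordinate, and
`signOdd` records this. Afterwards metrics are computed with a bilinear pairing of rows instead of
matrix products. -/
theorem inducedMetric_apply {I : Type*} [Fintype I] [DecidableEq I] (Z : AmbIx n m → SFun I m)
    (a b : I ⊕ OddIx m) (x : I → ℝ) :
    inducedMetric Z a b x = pairG (fun e => pd a (Z e) x) (signOdd b fun e => pd b (Z e) x) := by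
  have key : ∀ c : AmbIx n m, (jacobi Z * (euclid n m : Matrix (AmbIx n m) (AmbIx n m) (SFun I m))) a c =
      Sum.elim (fun p => pd a (Z (Sum.inl p)))
        (fun κ => if κ.2 = 0 then pd a (Z (Sum.inr (κ.1, 1))) else -pd a (Z (Sum.inr (κ.1, 0)))) c := by
    intro c
    rw [Matrix.mul_apply, Fintype.sum_sum_type]
    rcases c with p | ⟨μ, s⟩
    · simp [euclid, jacobi, Matrix.one_apply]
    · simp only [euclid, jacobi, Matrix.of_apply, Matrix.fromBlocks_apply₁₂, Matrix.zero_apply,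
        mul_zero, Finset.sum_const_zero, zero_add, Matrix.fromBlocks_apply₂₂,
        Fintype.sum_prod_type, Fin.sum_univ_two]
      fin_cases s <;> simp
  rw [inducedMetric, Matrix.mul_apply, Fintype.sum_sum_type]
  simp only [key]
  rcases b with i | κ
  · simp [superTranspose, jacobi, signOdd, flipOdd, pairG, Matrix.toBlocks₁₁, Matrix.toBlocks₁₂,
      Fintype.sum_prod_type, Finset.sum_apply]
    rw [← Finset.sum_neg_distrib]
    refine Finset.sum_congr rfl fun μ _ => ?_
    abel
  · simp [superTranspose, jacobi, signOdd, pairG, Matrix.toBlocks₂₁, Matrix.toBlocks₂₂,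
      Fintype.sum_prod_type, Finset.sum_apply, sub_eq_add_neg]

theorem pairG_sub_left (U U' V : AmbIx n m → Grass m) :
    pairG (U - U') V = pairG U V - pairG U' V := by
  simp only [pairG, Pi.sub_apply, sub_mul, Finset.sum_sub_distrib]
  abel

theorem pairG_sub_right (U V V' : AmbIx n m → Grass m) :
    pairG U (V - V') = pairG U V - pairG U V' := by
  simp only [pairG, Pi.sub_apply, mul_sub, Finset.sum_sub_distrib]
  abel

theorem pairG_mul_left (f : Grass m) (U V : AmbIx n m → Grass m) :
    pairG (fun e => f * U e) V = f * pairG U V := by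
  simp only [pairG, mul_add, mul_sub, Finset.mul_sum, mul_assoc]

theorem pairG_mul_right (f : Grass m) (U V : AmbIx n m → Grass m) :
    pairG U (fun e => V e * f) = pairG U V * f := by
  simp only [pairG, add_mul, sub_mul, Finset.sum_mul, mul_assoc]

theorem affineCoord_inl_same (k : Fin (n + 1)) (s : Fin 2) (x : CplxIx n → ℝ) :
    affineCoord (m := m) k (Sum.inl (k, s)) x = if s = 0 then 1 else 0 := by
  simp only [affineCoord, Sum.elim_inl, Fin.insertNth_apply_same]
  split_ifs <;> simp

theorem affineCoord_inl_succAbove (k : Fin (n + 1)) (j : Fin n) (s : Fin 2) (x : CplxIx n → ℝ) :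
    affineCoord (m := m) k (Sum.inl (k.succAbove j, s)) x = scal (x (j, s) : ℂ) := by
  simp only [affineCoord, Sum.elim_inl, Fin.insertNth_apply_succAbove]

theorem affineCoord_inr (k : Fin (n + 1)) (κ : OddIx m) (x : CplxIx n → ℝ) :
    affineCoord (m := m) k (Sum.inr κ) x = gen κ := rfl

theorem sum_cplxIx_succAbove {A : Type*} [AddCommMonoid A] (k : Fin (n + 1))
    (f : CplxIx (n + 1) → A) : ∑ p, f p = f (k, 0) + f (k, 1) + ∑ i : CplxIx n, f (k.succAbove i.1, i.2) := by
  simp only [Fintype.sum_prod_type, Fin.sum_univ_two]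
  rw [Fin.sum_univ_succAbove _ k]

theorem smoothOn_affineCoord (k : Fin (n + 1)) (e : AmbIx n m) :
    SmoothOn Set.univ (affineCoord k e) := by
  rcases e with ⟨p, s⟩ | κ
  · refine Fin.succAboveCases (α := fun p => SmoothOn Set.univ (affineCoord k (Sum.inl (p, s))))
      k ?_ ?_ p
    · have : affineCoord (m := m) k (Sum.inl (k, s)) = fun _ => if s = 0 then 1 else 0 := by
        funext x; exact affineCoord_inl_same k s x
      rw [this]; exact smoothOn_const _
    · intro j
      have : affineCoord (m := m) k (Sum.inl (k.succAbove j, s)) = fun x => scal (x (j, s) : ℂ) := by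
        funext x; exact affineCoord_inl_succAbove k j s x
      rw [this]
      exact smoothOn_scal (contDiff_comp_ofReal (contDiff_apply ℝ ℝ (j, s))).contDiffOn
  · exact smoothOn_const _

theorem bd_apply {I : Type*} [Fintype I] [DecidableEq I] (a : I ⊕ OddIx m) (i : I) (x : I → ℝ) :
    bd a (fun y => y i) x = if a = Sum.inl i then 1 else 0 := by
  rcases a with j | κ
  · have : fderiv ℝ (fun y : I → ℝ => y i) x = ContinuousLinearMap.proj i :=
      (ContinuousLinearMap.proj (R := ℝ) (φ := fun _ : I => ℝ) i).fderiv
    simp [bd, this, Pi.single_apply, eq_comm]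
  · simp [bd]

theorem pd_affineCoord (k : Fin (n + 1)) (a : CplxIx n ⊕ OddIx m) (e : AmbIx n m)
    (x : CplxIx n → ℝ) : pd a (affineCoord k e) x = affineRow k a e := by
  rcases e with ⟨p, s⟩ | κ
  · refine Fin.succAboveCases (α := fun p => pd a (affineCoord k (Sum.inl (p, s))) x =
      affineRow k a (Sum.inl (p, s))) k ?_ ?_ p
    · have : affineCoord (m := m) k (Sum.inl (k, s)) = fun _ => if s = 0 then 1 else 0 := by
        funext x; exact affineCoord_inl_same k s x
      rw [this, pd_const]
      rcases a with i | κ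
      · simp [affineRow, Fin.succAbove_ne]
      · simp only [affineRow, Sum.elim_inr]; split_ifs <;> simp_all
    · intro j
      have : affineCoord (m := m) k (Sum.inl (k.succAbove j, s)) = fun x => scal (x (j, s) : ℂ) := by
        funext x; exact affineCoord_inl_succAbove k j s x
      rw [this, pd_ofReal_scal (contDiff_apply ℝ ℝ (j, s)), bd_apply]
      rcases a with i | κ
      · by_cases h : i = (j, s)
        · simp [affineRow, h]
        · have h' : ¬ (i.1 = j ∧ i.2 = s) := fun h' => h (Prod.ext h'.1 h'.2)
          simp [affineRow, h, h']
      · simp [affineRow]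
  · have : affineCoord (n := n) (m := m) k (Sum.inr κ) = fun _ => gen κ := rfl
    rw [this, pd_const]
    rcases a with i | κ'
    · simp [affineRow]
    · simp [affineRow, oddD_gen]

theorem gen_mul_gen_zero_one (μ : Fin m) :
    (gen (μ, 1) : Grass m) * gen (μ, 0) = -(gen (μ, 0) * gen (μ, 1)) := gen_mul_gen _ _

/-- The point of `ℂ^{n+1} ∖ 0` with the given affine coordinates, turned by a right angle. -/
def affineJ (k : Fin (n + 1)) (x : CplxIx n → ℝ) : AmbIx n m → Grass m :=
  superCmul Complex.I fun e => affineCoord k e x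

theorem superCmul_inl (c : ℂ) (V : AmbIx n m → Grass m) (p : CplxIx (n + 1)) :
    superCmul c V (Sum.inl p) = if p.2 = 0
      then (c.re : ℂ) • V (Sum.inl (p.1, 0)) - (c.im : ℂ) • V (Sum.inl (p.1, 1))
      else (c.im : ℂ) • V (Sum.inl (p.1, 0)) + (c.re : ℂ) • V (Sum.inl (p.1, 1)) := rfl

theorem superCmul_inr (c : ℂ) (V : AmbIx n m → Grass m) (p : OddIx m) :
    superCmul c V (Sum.inr p) = if p.2 = 0
      then (c.re : ℂ) • V (Sum.inr (p.1, 0)) - (c.im : ℂ) • V (Sum.inr (p.1, 1))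
      else (c.im : ℂ) • V (Sum.inr (p.1, 0)) + (c.re : ℂ) • V (Sum.inr (p.1, 1)) := rfl

theorem scal_add (c d : ℂ) : scal (m := m) (c + d) = scal c + scal d := map_add _ _ _
theorem scal_mul_scal (c d : ℂ) : scal (m := m) c * scal d = scal (c * d) := (map_mul _ _ _).symm
theorem scal_sum {ι : Type*} (s : Finset ι) (f : ι → ℂ) :
    scal (m := m) (∑ i ∈ s, f i) = ∑ i ∈ s, scal (f i) := map_sum _ _ _

/-- The body of `N`. -/
def bodyN (x : CplxIx n → ℝ) : ℝ := 1 + ∑ i, x i ^ 2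

theorem bodyN_pos (x : CplxIx n → ℝ) : 0 < bodyN x := by
  have : 0 ≤ ∑ i, x i ^ 2 := Finset.sum_nonneg fun i _ => sq_nonneg _
  unfold bodyN; linarith

theorem pairG_affine_flipOdd (k : Fin (n + 1)) (x : CplxIx n → ℝ) :
    pairG (fun e => affineCoord k e x) (flipOdd fun e => affineCoord k e x) =
      scal (bodyN x : ℂ) + nilN m := by
  unfold pairG nilN
  congr 1
  · rw [sum_cplxIx_succAbove k]
    simp only [flipOdd, Sum.elim_inl, affineCoord_inl_same, affineCoord_inl_succAbove]
    simp [bodyN, scal_add, scal_mul_scal, scal_sum, pow_two]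
  · rw [Finset.smul_sum]
    refine Finset.sum_congr rfl fun μ _ => ?_
    simp only [flipOdd, Sum.elim_inr, affineCoord_inr, mul_neg, gen_mul_gen_zero_one μ]
    module

/-- In the even products the mixed terms cancel by commutation; in the odd ones the squares vanish
and the mixed terms add up. The lemma serves for affine and for Hopf coordinates. -/
theorem normSq_apply {I : Type*} (Z : AmbIx n m → SFun I m) (x : I → ℝ)
    (hc : ∀ c, Commute (Z (Sum.inl (c, 0)) x) (Z (Sum.inl (c, 1)) x))
    (ho : ∀ μ, Z (Sum.inr (μ, 0)) x * Z (Sum.inr (μ, 1)) x = -(Z (Sum.inr (μ, 1)) x * Z (Sum.inr (μ, 0)) x))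
    (h0 : ∀ κ, Z (Sum.inr κ) x * Z (Sum.inr κ) x = 0) :
    normSq Z x = pairG (fun e => Z e x) (flipOdd fun e => Z e x) := by
  simp only [normSq, pairG, Pi.add_apply, Finset.sum_apply, Pi.mul_apply, Pi.smul_apply, zc, zbar,
    zeta, zetabar, Pi.sub_apply, flipOdd, Sum.elim_inl, Sum.elim_inr, Finset.smul_sum,
    Fintype.sum_prod_type, Fin.sum_univ_two]
  congr 1
  · refine Finset.sum_congr rfl fun c _ => ?_
    simp only [add_mul, mul_sub, smul_mul_assoc, mul_smul_comm, (hc c).eq]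
    simp only [smul_add, smul_smul, Complex.I_mul_I]
    module
  · refine Finset.sum_congr rfl fun μ _ => ?_
    simp only [add_mul, mul_sub, smul_mul_assoc, mul_smul_comm, ho μ, h0, mul_neg]
    simp only [smul_sub, smul_add, smul_smul, smul_neg, smul_zero, Complex.I_mul_I]
    module

theorem affineN_eq (k : Fin (n + 1)) (x : CplxIx n → ℝ) :
    affineN k x = scal (bodyN x : ℂ) + nilN m := by
  rw [affineN, normSq_apply, pairG_affine_flipOdd]
  · intro c
    exact IsEvenElt.commute (isEvenElt_scal _) _
  · intro μ
    exact gen_mul_gen _ _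
  · intro κ
    exact gen_mul_self κ

theorem pairG_affineRow_flipOdd (k : Fin (n + 1)) (a : CplxIx n ⊕ OddIx m) (V : AmbIx n m → Grass m) :
    pairG (affineRow k a) V = Sum.elim (fun i => V (Sum.inl (k.succAbove i.1, i.2)))
      (fun κ => if κ.2 = 0 then -V (Sum.inr (κ.1, 1)) else V (Sum.inr (κ.1, 0))) a := by
  unfold pairG
  rcases a with i | ⟨ν, s⟩
  · simp [affineRow]
  · fin_cases s <;> simp [affineRow, Finset.sum_ite_eq]

theorem pairG_affineRow_right (k : Fin (n + 1)) (a : CplxIx n ⊕ OddIx m) (V : AmbIx n m → Grass m) :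
    pairG V (signOdd a (affineRow k a)) = Sum.elim (fun i => V (Sum.inl (k.succAbove i.1, i.2)))
      (fun κ => if κ.2 = 0 then V (Sum.inr (κ.1, 1)) else -V (Sum.inr (κ.1, 0))) a := by
  unfold pairG
  rcases a with i | ⟨ν, s⟩
  · simp [affineRow, signOdd, flipOdd]
  · fin_cases s <;> simp [affineRow, signOdd, Finset.sum_ite_eq]

theorem affineJ_inl_succAbove (k : Fin (n + 1)) (x : CplxIx n → ℝ) (i : CplxIx n) :
    affineJ (m := m) k x (Sum.inl (k.succAbove i.1, i.2)) = connForm x (Sum.inl i) := by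
  rw [affineJ, superCmul_inl]
  simp only [affineCoord_inl_succAbove, connForm, Sum.elim_inl]
  simp

theorem affineJ_inl_same (k : Fin (n + 1)) (x : CplxIx n → ℝ) (s : Fin 2) :
    affineJ (m := m) k x (Sum.inl (k, s)) = if s = 0 then 0 else 1 := by
  rw [affineJ, superCmul_inl]
  simp only [affineCoord_inl_same]
  simp

theorem affineJ_inr (k : Fin (n + 1)) (x : CplxIx n → ℝ) (κ : OddIx m) :
    affineJ (n := n) (m := m) k x (Sum.inr κ) = if κ.2 = 0 then -gen (κ.1, 1) else gen (κ.1, 0) := by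
  rw [affineJ, superCmul_inr]
  simp only [affineCoord_inr]
  simp

theorem pairG_affineRow_affine (k : Fin (n + 1)) (a : CplxIx n ⊕ OddIx m) (x : CplxIx n → ℝ) :
    pairG (affineRow k a) (flipOdd fun e => affineCoord k e x) = halfDN x a := by
  rw [pairG_affineRow_flipOdd]
  rcases a with i | κ
  · simp [flipOdd, affineCoord_inl_succAbove, halfDN]
  · simp [flipOdd, affineCoord_inr, halfDN]

theorem pairG_affine_affineRow (k : Fin (n + 1)) (a : CplxIx n ⊕ OddIx m) (x : CplxIx n → ℝ) :
    pairG (fun e => affineCoord k e x) (signOdd a (affineRow k a)) = halfDN x a := by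
  rw [pairG_affineRow_right]
  rcases a with i | κ
  · simp [affineCoord_inl_succAbove, halfDN]
  · simp [affineCoord_inr, halfDN]

theorem pairG_affineRow_affineJ (k : Fin (n + 1)) (a : CplxIx n ⊕ OddIx m) (x : CplxIx n → ℝ) :
    pairG (affineRow k a) (flipOdd (affineJ k x)) = connForm x a := by
  rw [pairG_affineRow_flipOdd]
  rcases a with i | ⟨μ, s⟩
  · simp [flipOdd, affineJ_inl_succAbove]
  · fin_cases s <;> simp [flipOdd, affineJ_inr, connForm]

theorem pairG_affineJ_affineRow (k : Fin (n + 1)) (a : CplxIx n ⊕ OddIx m) (x : CplxIx n → ℝ) :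
    pairG (affineJ k x) (signOdd a (affineRow k a)) = connForm x a := by
  rw [pairG_affineRow_right]
  rcases a with i | ⟨μ, s⟩
  · simp [affineJ_inl_succAbove]
  · fin_cases s <;> simp [affineJ_inr, connForm]

/-- Multiplication by `i` is skew with respect to the pairing. It is also isometric, so `w` and `Jw`
are orthogonal vectors with the same square `N`; the shape of the Hopf Gram matrix rests on this. -/
theorem pairG_affineJ_affine (k : Fin (n + 1)) (x : CplxIx n → ℝ) :
    pairG (affineJ k x) (flipOdd fun e => affineCoord (m := m) k e x) = 0 := by
  unfold pairG
  rw [sum_cplxIx_succAbove k]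
  simp only [flipOdd, Sum.elim_inl, Sum.elim_inr, affineJ_inl_same, affineJ_inl_succAbove, affineJ_inr,
    affineCoord_inl_same, affineCoord_inl_succAbove, affineCoord_inr, connForm,
    Fintype.sum_prod_type, Fin.sum_univ_two]
  simp [gen_mul_self, scal_mul_scal, mul_comm]

theorem pairG_affine_affineJ (k : Fin (n + 1)) (x : CplxIx n → ℝ) :
    pairG (fun e => affineCoord (m := m) k e x) (flipOdd (affineJ k x)) = 0 := by
  unfold pairG
  rw [sum_cplxIx_succAbove k]
  simp only [flipOdd, Sum.elim_inl, Sum.elim_inr, affineJ_inl_same, affineJ_inl_succAbove, affineJ_inr,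
    affineCoord_inl_same, affineCoord_inl_succAbove, affineCoord_inr, connForm,
    Fintype.sum_prod_type, Fin.sum_univ_two]
  simp [gen_mul_self, scal_mul_scal, mul_comm]

theorem pairG_affineJ_affineJ (k : Fin (n + 1)) (x : CplxIx n → ℝ) :
    pairG (affineJ k x) (flipOdd (affineJ k x)) = scal (bodyN x : ℂ) + nilN m := by
  unfold pairG nilN
  congr 1
  · rw [sum_cplxIx_succAbove k]
    simp only [flipOdd, Sum.elim_inl, affineJ_inl_same, affineJ_inl_succAbove, connForm]
    simp only [Fintype.sum_prod_type, Fin.sum_univ_two, bodyN]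
    simp [scal_add, scal_mul_scal, scal_sum, pow_two, add_comm]
  · rw [Finset.smul_sum]
    refine Finset.sum_congr rfl fun μ _ => ?_
    simp only [flipOdd, Sum.elim_inr, affineJ_inr]
    simp [gen_mul_gen_zero_one μ]
    module

end AffineMetric

/-! ### Determinants over commutative rings -/

section NumericDeterminants

/-- By orthogonality the matrix is the product of the two rank-one perturbations, and the matrix
determinant lemma applies to each. -/
theorem det_one_sub_outer_sub_outer {R I : Type*} [CommRing R] [Fintype I] [DecidableEq I]
    (u v : I → R) (t : R) (huv : ∑ i, u i * v i = 0) :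
    (Matrix.of fun i j => (1 : Matrix I I R) i j - t * (u i * u j) - t * (v i * v j)).det =
      (1 - t * ∑ i, u i * u i) * (1 - t * ∑ i, v i * v i) := by
  have h1 : ∀ w : I → R, (Matrix.of fun i j => (1 : Matrix I I R) i j - t * (w i * w j)).det =
      1 - t * ∑ i, w i * w i := by
    intro w
    have : (Matrix.of fun i j => (1 : Matrix I I R) i j - t * (w i * w j)) =
        1 + Matrix.replicateCol Unit (fun i => -t * w i) * Matrix.replicateRow Unit w := by
      ext i j
      simp [Matrix.mul_apply]
      ring
    rw [this, Matrix.det_one_add_replicateCol_mul_replicateRow, dotProduct, Finset.mul_sum,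
      sub_eq_add_neg, ← Finset.sum_neg_distrib]
    congr 1
    exact Finset.sum_congr rfl fun i _ => by ring
  rw [← h1 u, ← h1 v, ← Matrix.det_mul]
  congr 1
  ext i j
  simp only [Matrix.of_apply, Matrix.mul_apply, sub_mul, mul_sub, Finset.sum_sub_distrib]
  have e1 : ∑ k, (1 : Matrix I I R) i k * (1 : Matrix I I R) k j = (1 : Matrix I I R) i j := by
    rw [← Matrix.mul_apply, one_mul]
  have e2 : ∑ k, (1 : Matrix I I R) i k * (t * (v k * v j)) = t * (v i * v j) := by
    simp [Matrix.one_apply]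
  have e3 : ∑ k, t * (u i * u k) * (1 : Matrix I I R) k j = t * (u i * u j) := by
    simp [Matrix.one_apply]
  have e4 : ∑ k, t * (u i * u k) * (t * (v k * v j)) = 0 := by
    have : ∑ k, t * (u i * u k) * (t * (v k * v j)) = t * u i * (t * v j) * ∑ k, u k * v k := by
      rw [Finset.mul_sum]; exact Finset.sum_congr rfl fun k _ => by ring
    rw [this, huv, mul_zero]
  rw [e1, e2, e3, e4]
  ring

/-- This is the Schur complement at the entry `none`, by which the angle is eliminated from the
metric of the sphere. -/
theorem det_option {R I : Type*} [CommRing R] [Fintype I] [DecidableEq I]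
    (M : Matrix (Option I) (Option I) R) {b b' : R} (hb : b * b' = 1) (hM : M none none = b) :
    M.det = b * (Matrix.of fun i j => M (some i) (some j) - b' * (M (some i) none * M none (some j))).det := by
  set e := (Equiv.optionEquivSumPUnit.{0} I).symm
  rw [← Matrix.det_submatrix_equiv_self e, ← Matrix.fromBlocks_toBlocks (M.submatrix e e)]
  have h22 : (M.submatrix e e).toBlocks₂₂ = Matrix.diagonal fun _ => b := by
    ext i j
    simp [Matrix.toBlocks₂₂, e, hM]
  let _ : Invertible (Matrix.diagonal fun _ : PUnit.{1} => b) :=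
    ⟨Matrix.diagonal fun _ => b', by rw [Matrix.diagonal_mul_diagonal]; simp [mul_comm b', hb],
      by rw [Matrix.diagonal_mul_diagonal]; simp [hb]⟩
  have h0 : ⅟(Matrix.diagonal fun _ : PUnit.{1} => b) = Matrix.diagonal fun _ => b' := rfl
  rw [h22, Matrix.det_fromBlocks₂₂, Matrix.det_diagonal, h0]
  simp only [Finset.univ_unique, Finset.prod_singleton]
  congr 2
  ext i j
  simp [Matrix.mul_apply, Matrix.toBlocks₁₁, Matrix.toBlocks₁₂, Matrix.toBlocks₂₁, e,
    Matrix.diagonal_apply]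
  ring

theorem ring_inverse_eq {R : Type*} [CommRing R] {x y : R} (h : x * y = 1) : Ring.inverse x = y := by
  have hx : IsUnit x := IsUnit.of_mul_eq_one y h
  calc Ring.inverse x = Ring.inverse x * (x * y) := by rw [h, mul_one]
    _ = y := by rw [← mul_assoc, Ring.inverse_mul_cancel x hx, one_mul]

end NumericDeterminants

/-! ### The entries of the Fubini–Study metric -/

section MetricEntries

variable {n m : ℕ}

/-- The Euclidean metric of `ℂ^{n|m}`. -/
def flatMetric (n m : ℕ) : Matrix (CplxIx n ⊕ OddIx m) (CplxIx n ⊕ OddIx m) ℂ :=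
  Matrix.fromBlocks 1 0 0 (symplMat ℂ m)

theorem pairG_affineRow_affineRow (k : Fin (n + 1)) (a b : CplxIx n ⊕ OddIx m) :
    pairG (affineRow k a) (signOdd b (affineRow k b)) = scal (flatMetric n m a b) := by
  rw [pairG_affineRow_right]
  rcases b with ⟨j, t⟩ | ⟨l, t⟩ <;> rcases a with ⟨i, s⟩ | ⟨κ, s⟩
  · by_cases h : i = j <;> by_cases h' : s = t <;>
      simp [affineRow, flatMetric, h, h']
  · simp [affineRow, flatMetric]
  · simp [affineRow, flatMetric]
  · by_cases h : κ = l
    · fin_cases s <;> fin_cases t <;> simp [affineRow, flatMetric, symplMat, h, scal_eq_smul_one]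
    · simp [affineRow, flatMetric, symplMat, h]

theorem pd_zc_affine (k : Fin (n + 1)) (a : CplxIx n ⊕ OddIx m) (c : Fin (n + 1)) (x : CplxIx n → ℝ) :
    pd a (zc (affineCoord k) c) x =
      affineRow k a (Sum.inl (c, 0)) + Complex.I • affineRow k a (Sum.inl (c, 1)) := by
  have := pd_add a (smoothOn_affineCoord (m := m) k (Sum.inl (c, 0)))
    ((smoothOn_affineCoord (m := m) k (Sum.inl (c, 1))).const_smul Complex.I) x
  rw [pd_smul (smoothOn_affineCoord k _), pd_affineCoord, pd_affineCoord] at this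
  exact this

theorem pd_zbar_affine (k : Fin (n + 1)) (a : CplxIx n ⊕ OddIx m) (c : Fin (n + 1)) (x : CplxIx n → ℝ) :
    pd a (zbar (affineCoord k) c) x =
      affineRow k a (Sum.inl (c, 0)) - Complex.I • affineRow k a (Sum.inl (c, 1)) := by
  have := pd_add a (smoothOn_affineCoord (m := m) k (Sum.inl (c, 0)))
    ((smoothOn_affineCoord (m := m) k (Sum.inl (c, 1))).const_smul (-Complex.I)) x
  rw [pd_smul (smoothOn_affineCoord k _), pd_affineCoord, pd_affineCoord] at this
  simp only [neg_smul, ← sub_eq_add_neg] at this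
  exact this

theorem pd_zeta_affine (k : Fin (n + 1)) (a : CplxIx n ⊕ OddIx m) (c : Fin m) (x : CplxIx n → ℝ) :
    pd a (zeta (affineCoord k) c) x =
      affineRow k a (Sum.inr (c, 0)) + Complex.I • affineRow k a (Sum.inr (c, 1)) := by
  have := pd_add a (smoothOn_affineCoord (m := m) k (Sum.inr (c, 0)))
    ((smoothOn_affineCoord (m := m) k (Sum.inr (c, 1))).const_smul Complex.I) x
  rw [pd_smul (smoothOn_affineCoord k _), pd_affineCoord, pd_affineCoord] at this
  exact this

theorem pd_zetabar_affine (k : Fin (n + 1)) (a : CplxIx n ⊕ OddIx m) (c : Fin m) (x : CplxIx n → ℝ) :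
    pd a (zetabar (affineCoord k) c) x =
      affineRow k a (Sum.inr (c, 0)) - Complex.I • affineRow k a (Sum.inr (c, 1)) := by
  have := pd_add a (smoothOn_affineCoord (m := m) k (Sum.inr (c, 0)))
    ((smoothOn_affineCoord (m := m) k (Sum.inr (c, 1))).const_smul (-Complex.I)) x
  rw [pd_smul (smoothOn_affineCoord k _), pd_affineCoord, pd_affineCoord] at this
  simp only [neg_smul, ← sub_eq_add_neg] at this
  exact this

/-- The Hermitian product with `w` has the pairing with `w` as its real part and the pairing with
`Jw` as its imaginary part. -/
theorem radial_affine (k : Fin (n + 1)) (a : CplxIx n ⊕ OddIx m) (x : CplxIx n → ℝ) :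
    radial (affineCoord k) a x = halfDN x a + Complex.I • connForm x a := by
  rw [← pairG_affineRow_affine k, ← pairG_affineRow_affineJ k]
  simp only [radial, pairG, Pi.add_apply, Finset.sum_apply, Pi.mul_apply, Pi.smul_apply,
    pd_zc_affine, pd_zeta_affine, zbar, zetabar, Pi.sub_apply, flipOdd, Sum.elim_inl, Sum.elim_inr,
    affineJ, superCmul_inl, superCmul_inr, Fintype.sum_prod_type, Fin.sum_univ_two,
    Finset.smul_sum, Complex.I_re, Complex.I_im, smul_add]
  rw [add_add_add_comm, ← Finset.sum_add_distrib, ← Finset.sum_add_distrib]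
  congr 1
  · refine Finset.sum_congr rfl fun c _ => ?_
    simp only [add_mul, mul_sub, mul_add, smul_mul_assoc, mul_smul_comm, smul_sub, smul_add, smul_smul,
      Complex.I_mul_I, if_true, one_ne_zero, if_false]
    module
  · refine Finset.sum_congr rfl fun c _ => ?_
    simp only [add_mul, mul_sub, mul_add, mul_neg, smul_mul_assoc, mul_smul_comm, smul_sub, smul_add,
      smul_neg, smul_smul, Complex.I_mul_I, if_true, one_ne_zero, if_false]
    module

theorem radialBar_affine (k : Fin (n + 1)) (a : CplxIx n ⊕ OddIx m) (x : CplxIx n → ℝ) :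
    radialBar (affineCoord k) a x = halfDN x a - Complex.I • connForm x a := by
  rw [← pairG_affineRow_affine k, ← pairG_affineRow_affineJ k]
  simp only [radialBar, pairG, Pi.add_apply, Finset.sum_apply, Pi.mul_apply, Pi.smul_apply,
    pd_zbar_affine, pd_zetabar_affine, zc, zeta, Pi.sub_apply, flipOdd, Sum.elim_inl, Sum.elim_inr,
    affineJ, superCmul_inl, superCmul_inr, Fintype.sum_prod_type, Fin.sum_univ_two,
    Finset.smul_sum, Complex.I_re, Complex.I_im, smul_add]
  rw [add_sub_add_comm, ← Finset.sum_sub_distrib, ← Finset.sum_sub_distrib, sub_eq_add_neg,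
    ← Finset.sum_neg_distrib]
  congr 1
  · refine Finset.sum_congr rfl fun c _ => ?_
    simp only [sub_mul, mul_sub, mul_add, smul_mul_assoc, mul_smul_comm, smul_sub, smul_add, smul_smul,
      Complex.I_mul_I, if_true, one_ne_zero, if_false]
    module
  · refine Finset.sum_congr rfl fun c _ => ?_
    simp only [sub_mul, mul_sub, mul_add, mul_neg, smul_mul_assoc, mul_smul_comm, smul_sub, smul_add,
      smul_neg, smul_smul, Complex.I_mul_I, if_true, one_ne_zero, if_false]
    module

theorem isEvenElt_nilN : IsEvenElt (nilN m) :=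
  IsEvenElt.smul (IsEvenElt.sum fun _ _ => IsOddElt.mul (isOddElt_gen _) (isOddElt_gen _)) _

theorem isEvenElt_affineN (k : Fin (n + 1)) (x : CplxIx n → ℝ) : IsEvenElt (affineN (m := m) k x) := by
  rw [affineN_eq]; exact (isEvenElt_scal _).add isEvenElt_nilN

theorem body_nilN : body (nilN m) = 0 := by simp [nilN, body_sum]

theorem body_affineN (k : Fin (n + 1)) (x : CplxIx n → ℝ) :
    body (affineN (m := m) k x) = (bodyN x : ℂ) := by
  rw [affineN_eq, body_add, body_scal, body_nilN, add_zero]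

theorem rbody_affineN (k : Fin (n + 1)) (x : CplxIx n → ℝ) :
    rbody (affineN (m := m) k x) = bodyN x := by
  rw [rbody, body_affineN, Complex.ofReal_re]

theorem rbody_affineN_pos (k : Fin (n + 1)) (x : CplxIx n → ℝ) :
    0 < rbody (affineN (m := m) k x) := by rw [rbody_affineN]; exact bodyN_pos x

theorem im_body_affineN (k : Fin (n + 1)) (x : CplxIx n → ℝ) :
    (body (affineN (m := m) k x)).im = 0 := by rw [body_affineN, Complex.ofReal_im]

theorem contDiff_bodyN : ContDiff ℝ ∞ (bodyN (n := n)) :=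
  contDiff_const.add (ContDiff.sum fun i _ => (contDiff_apply ℝ ℝ i).pow 2)

theorem smoothOn_affineN (k : Fin (n + 1)) : SmoothOn Set.univ (affineN (n := n) (m := m) k) := by
  have : affineN (n := n) (m := m) k = fun x => scal (bodyN x : ℂ) + nilN m := by
    funext x; exact affineN_eq k x
  rw [this]
  exact (smoothOn_scal (contDiff_comp_ofReal contDiff_bodyN).contDiffOn).fun_add (smoothOn_const _)

/-- Integral powers of `N`. -/
def powN (k : Fin (n + 1)) (x : CplxIx n → ℝ) (j : ℤ) : EvenGrass m :=
  ⟨superApply (fun t => t ^ j) (affineN k x), (isEvenElt_affineN k x).superApply _⟩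

theorem powN_mul (k : Fin (n + 1)) (x : CplxIx n → ℝ) (i j : ℤ) :
    powN (m := m) k x i * powN k x j = powN k x (i + j) :=
  Subtype.ext (superApply_zpow_mul (rbody_affineN_pos k x) i j)

theorem powN_zero (k : Fin (n + 1)) (x : CplxIx n → ℝ) : powN (m := m) k x 0 = 1 := by
  apply Subtype.ext
  change superApply (fun t => t ^ (0 : ℤ)) (affineN k x) = 1
  simp [superApply_const]

theorem powN_pow (k : Fin (n + 1)) (x : CplxIx n → ℝ) (j : ℤ) (l : ℕ) :
    powN (m := m) k x j ^ l = powN k x (l * j) := by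
  induction l with
  | zero => simp [powN_zero]
  | succ l ih => rw [pow_succ, ih, powN_mul]; congr 1; push_cast; ring

theorem coe_powN_one (k : Fin (n + 1)) (x : CplxIx n → ℝ) :
    ((powN (m := m) k x 1 : EvenGrass m) : Grass m) = affineN k x := by
  change superApply (fun t => t ^ (1 : ℤ)) (affineN k x) = _
  simp only [zpow_one]
  exact superApply_id (im_body_affineN k x)

/-- The two radial forms are `h + iω` and `h - iω`. In the symmetrized product the mixed terms
cancel, and half of it is `h_a h_b + ω_a ω_b`. -/
theorem fubiniStudy_affine (R : ℝ) (k : Fin (n + 1)) (a b : CplxIx n ⊕ OddIx m) (x : CplxIx n → ℝ) :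
    fubiniStudy R (affineCoord k) a b x = ((R : ℂ) ^ 2) • (scal (flatMetric n m a b) * ((powN k x (-1) : EvenGrass m) : Grass m) -
      (halfDN x a * halfDN x b + connForm x a * connForm x b) * ((powN k x (-2) : EvenGrass m) : Grass m)) := by
  change ((R : ℂ) ^ 2) • (inducedMetric (affineCoord k) a b x * ((powN k x (-1) : EvenGrass m) : Grass m) - (1 / 2 : ℂ) •
    ((radial (affineCoord k) a x * radialBar (affineCoord k) b x +
      radialBar (affineCoord k) a x * radial (affineCoord k) b x) * ((powN k x (-2) : EvenGrass m) : Grass m))) = _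
  rw [inducedMetric_apply]
  simp only [pd_affineCoord]
  rw [show (fun e => affineRow (m := m) k b e) = affineRow k b from rfl,
    show (fun e => affineRow (m := m) k a e) = affineRow k a from rfl, pairG_affineRow_affineRow,
    radial_affine, radial_affine, radialBar_affine, radialBar_affine, ← smul_mul_assoc]
  congr 3
  simp only [add_mul, mul_sub, sub_mul, mul_add, smul_mul_assoc, mul_smul_comm, smul_sub, smul_add,
    smul_smul, Complex.I_mul_I]
  module

end MetricEntries

/-! ### The volume element of the projective superspace -/

section ProjectiveVolume

variable {n m : ℕ}

theorem mul_ring_inverse_eq {R : Type*} [CommRing R] {a x y t : R} (hx : x * y = 1) (h : t * x = a) :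
    a * Ring.inverse x = t := by
  rw [← h, Ring.mul_inverse_cancel_right _ _ (IsUnit.of_mul_eq_one y hx)]

/-- The odd components of `halfDN`. -/
def oddHalfDN (m : ℕ) (κ : OddIx m) : OddGrass m :=
  if κ.2 = 0 then ⟨gen (κ.1, 1), isOddElt_gen _⟩ else -⟨gen (κ.1, 0), isOddElt_gen _⟩

/-- The generators, as odd elements. -/
def oddGen (κ : OddIx m) : OddGrass m := ⟨gen κ, isOddElt_gen κ⟩

theorem coe_oddHalfDN (x : CplxIx n → ℝ) (κ : OddIx m) :
    (oddHalfDN m κ : Grass m) = halfDN x (Sum.inr κ) := by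
  simp only [oddHalfDN, halfDN, Sum.elim_inr]
  split_ifs <;> rfl

theorem sympl_oddHalfDN : sympl (oddHalfDN m) = oddGen := by
  funext ⟨μ, s⟩
  fin_cases s <;> simp [sympl, oddHalfDN, oddGen]

theorem sympl_oddGen : sympl (oddGen (m := m)) = -oddHalfDN m := by
  funext ⟨μ, s⟩
  fin_cases s <;> simp [sympl, oddHalfDN, oddGen]

/-- The nilpotent part of `N`, as an even element. -/
def evenNilN (m : ℕ) : EvenGrass m := ⟨nilN m, isEvenElt_nilN⟩

theorem odot_oddHalfDN_oddGen : odot oddMul (oddHalfDN m) oddGen = -evenNilN m := by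
  apply Subtype.ext
  change ((∑ k, oddMul (oddHalfDN m k) (oddGen k) : EvenGrass m) : Grass m) = -nilN m
  rw [AddSubmonoidClass.coe_finsetSum]
  simp only [coe_oddMul, Fintype.sum_prod_type, Fin.sum_univ_two, nilN, Finset.smul_sum,
    ← Finset.sum_neg_distrib]
  refine Finset.sum_congr rfl fun μ _ => ?_
  simp [oddHalfDN, oddGen, gen_mul_gen_zero_one μ]
  module

theorem oddMul_self (a : OddGrass m) : oddMul a a = 0 := by
  have h := isOddPairing_oddMul.anticomm a a
  have h2 : (2 : ℂ) • oddMul a a = 0 := by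
    rw [two_smul]; nth_rewrite 1 [h]; simp
  exact (smul_eq_zero.mp h2).resolve_left two_ne_zero

theorem oddMul_neg_right (a b : OddGrass m) : oddMul a (-b) = -oddMul a b :=
  isOddPairing_oddMul.neg_right a b

theorem odot_oddHalfDN : odot oddMul (oddHalfDN m) (sympl (oddHalfDN m)) = -evenNilN m := by
  rw [sympl_oddHalfDN, odot_oddHalfDN_oddGen]

theorem odot_oddGen : odot oddMul (oddGen (m := m)) (sympl oddGen) = -evenNilN m := by
  rw [sympl_oddGen, ← odot_oddHalfDN_oddGen]
  refine Finset.sum_congr rfl fun k _ => ?_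
  rw [Pi.neg_apply, oddMul_neg_right, ← isOddPairing_oddMul.anticomm]

theorem odot_oddHalfDN_sympl_oddGen : odot oddMul (oddHalfDN m) (sympl oddGen) = 0 := by
  rw [sympl_oddGen]
  exact Finset.sum_eq_zero fun k _ => by rw [Pi.neg_apply, oddMul_neg_right, oddMul_self, neg_zero]

theorem odot_oddGen_sympl_oddHalfDN : odot oddMul (oddGen (m := m)) (sympl (oddHalfDN m)) = 0 := by
  rw [sympl_oddHalfDN]
  exact Finset.sum_eq_zero fun k _ => oddMul_self _

/-- Complex numbers as even elements. -/
def escal (m : ℕ) : ℂ →+* EvenGrass m := algebraMap ℂ (EvenGrass m)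

theorem coe_escal (c : ℂ) : ((escal m c : EvenGrass m) : Grass m) = scal c := rfl

theorem powN_one_eq (k : Fin (n + 1)) (x : CplxIx n → ℝ) :
    powN (m := m) k x 1 = escal m (bodyN x) + evenNilN m :=
  Subtype.ext (by rw [coe_powN_one, affineN_eq]; rfl)

theorem powN_neg_one_mul_one (k : Fin (n + 1)) (x : CplxIx n → ℝ) :
    powN (m := m) k x (-1) * powN k x 1 = 1 := by
  rw [powN_mul, neg_add_cancel, powN_zero]

/-- The even components of `connForm`. -/
def evenConn (x : CplxIx n → ℝ) (i : CplxIx n) : ℝ := if i.2 = 0 then -x (i.1, 1) else x (i.1, 0)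

theorem connForm_inl (x : CplxIx n → ℝ) (i : CplxIx n) :
    connForm (m := m) x (Sum.inl i) = scal (evenConn x i : ℂ) := by
  simp only [connForm, Sum.elim_inl, evenConn]
  split_ifs
  · rw [Complex.ofReal_neg, scal, scal, map_neg]
  · rfl

theorem halfDN_inl (x : CplxIx n → ℝ) (i : CplxIx n) :
    halfDN (m := m) x (Sum.inl i) = scal (x i : ℂ) := rfl

theorem sum_escal_sq (x : CplxIx n → ℝ) :
    ∑ i, escal m (x i : ℂ) * escal m (x i) = escal m (bodyN x) - 1 := by
  simp only [← map_mul, ← map_sum, ← map_one (escal m), ← map_sub]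
  congr 1
  simp [bodyN, pow_two]

theorem sum_escal_evenConn_sq (x : CplxIx n → ℝ) :
    ∑ i, escal m (evenConn x i : ℂ) * escal m (evenConn x i) = escal m (bodyN x) - 1 := by
  rw [← sum_escal_sq]
  simp only [Fintype.sum_prod_type, Fin.sum_univ_two, evenConn]
  simp [add_comm]

theorem sum_escal_mul_evenConn (x : CplxIx n → ℝ) :
    ∑ i, escal m (x i : ℂ) * escal m (evenConn x i : ℂ) = 0 := by
  simp only [Fintype.sum_prod_type, Fin.sum_univ_two, evenConn]
  simp [mul_comm]

theorem escal_bodyN_mul_inv (x : CplxIx n → ℝ) :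
    escal m (bodyN x) * escal m ((bodyN x : ℂ)⁻¹) = 1 := by
  rw [← map_mul, mul_inv_cancel₀ (by exact_mod_cast (bodyN_pos x).ne'), map_one]

theorem escal_mul_inv {R : ℝ} (hR : 0 < R) : escal m (R : ℂ) * escal m ((R : ℂ)⁻¹) = 1 := by
  rw [← map_mul, mul_inv_cancel₀ (by exact_mod_cast hR.ne'), map_one]

theorem coe_mul_even (a b : EvenGrass m) : ((a * b : EvenGrass m) : Grass m) = (a : Grass m) * b := rfl

theorem even_mul_odd_comm (a : EvenGrass m) (f : Grass m) : f * (a : Grass m) = a * f :=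
  (IsEvenElt.commute a.2 f).eq.symm

theorem mixed_entry (r a b c : EvenGrass m) (f g : Grass m) :
    (r : Grass m) * (0 - ((a : Grass m) * f + b * g) * c) =
      ((-(r * c * a) : EvenGrass m) : Grass m) * f + ((-(r * c * b) : EvenGrass m) : Grass m) * g := by
  have h : ∀ (a : EvenGrass m) (f : Grass m),
      (r : Grass m) * (a * f * c) = ((r * c * a : EvenGrass m) : Grass m) * f := by
    intro a f
    rw [mul_assoc (a : Grass m), even_mul_odd_comm c f, ← mul_assoc (a : Grass m), ← mul_assoc,
      ← coe_mul_even, ← coe_mul_even]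
    congr 2; ring
  rw [zero_sub, mul_neg, add_mul, mul_add, h, h]
  change _ = -_ * _ + -_ * _
  rw [neg_mul, neg_mul, neg_add]

theorem escal_symplMat (κ l : OddIx m) : escal m (symplMat ℂ m κ l) = symplMat (EvenGrass m) m κ l := by
  simp only [symplMat, Matrix.of_apply]
  split_ifs <;> simp

/-- In `ber_eq_of_gram` take `c = R²/N`, `ν₁ = ν₂ = 1/N`, and for `w₁`, `w₂` the odd parts of `h`
and `ω`. From `N = b + q` follows `1 - q/N = b/N`, so both `s` are `N/b`. The even determinant turns
out to be `b⁻²`, and the Berezinian is `(R²/N)^{2n-2m} b⁻² (b/N)² = (R²/N)^{2n-2m} N⁻²`. -/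
theorem ber_fubiniStudy {R : ℝ} (hR : 0 < R) (k : Fin (n + 1)) (x : CplxIx n → ℝ) :
    ber ((fubiniStudy R (affineCoord (m := m) k)).map fun f => f x) =
      (((escal m R ^ (2 * n) * escal m ((R : ℂ)⁻¹) ^ (2 * m) *
        (powN k x (-1) ^ (n + 1) * powN k x 1 ^ m)) ^ 2 : EvenGrass m) : Grass m) := by
  set ν := powN (m := m) k x (-1) with hν
  set N := powN (m := m) k x 1 with hN
  set b := escal m (bodyN x) with hb
  set β := escal m ((bodyN x : ℂ)⁻¹) with hβ
  set r := escal m (R : ℂ) with hr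
  set r' := escal m ((R : ℂ)⁻¹) with hr'
  set q := evenNilN m with hq
  have hrr : r * r' = 1 := escal_mul_inv hR
  have hνN : ν * N = 1 := powN_neg_one_mul_one k x
  have hbβ : b * β = 1 := escal_bodyN_mul_inv x
  have hNq : N = b + q := powN_one_eq k x
  have hν2 : powN (m := m) k x (-2) = ν * ν := by rw [hν, powN_mul]; rfl
  set c := r ^ 2 * ν with hc
  have hcoeR : ∀ f : Grass m, ((R : ℂ) ^ 2) • f = ((r ^ 2 : EvenGrass m) : Grass m) * f := by
    intro f
    rw [hr, ← map_pow, coe_escal, scal_mul]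
  have hs : N * β * (1 - ν * q) = 1 := by
    linear_combination (-β * q) * hνN + hbβ + β * hNq
  rw [ber_eq_of_gram (c := c) (c' := r' ^ 2 * N) (ν₁ := ν) (ν₂ := ν) (q := q) (s₁ := N * β)
    (s₂ := N * β) (w₁ := oddHalfDN m) (w₂ := oddGen)
    (B := Matrix.of fun i j => (1 : Matrix (CplxIx n) (CplxIx n) (EvenGrass m)) i j - ν *
      (escal m (x i) * escal m (x j)) - ν * (escal m (evenConn x i) * escal m (evenConn x j)))
    (A₁ := fun i => -ν * escal m (x i)) (A₂ := fun i => -ν * escal m (evenConn x i))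
    (by rw [hc]; linear_combination (r * r' + 1) * hrr + r ^ 2 * r' ^ 2 * hνN)
    odot_oddHalfDN odot_oddGen
    odot_oddHalfDN_sympl_oddGen odot_oddGen_sympl_oddHalfDN hs hs]
  · congr 1
    have hdet : (Matrix.of fun i j => (Matrix.of fun i j =>
        (1 : Matrix (CplxIx n) (CplxIx n) (EvenGrass m)) i j - ν * (escal m (x i) * escal m (x j)) -
          ν * (escal m (evenConn x i) * escal m (evenConn x j))) i j
        - N * β * q * (-ν * escal m (x i) * (-ν * escal m (x j)))
        - N * β * q * (-ν * escal m (evenConn x i) * (-ν * escal m (evenConn x j)))) =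
        Matrix.of fun i j => (1 : Matrix (CplxIx n) (CplxIx n) (EvenGrass m)) i j -
          β * (escal m (x i) * escal m (x j)) - β * (escal m (evenConn x i) * escal m (evenConn x j)) := by
      -- The nilpotent part disappears here: `1/N + (N/b) q / N² = (b + q) / (bN) = 1/b`.
      have hcf : ν + N * β * q * ν ^ 2 = β := by
        linear_combination (β * q * ν + β) * hνN - ν * β * hNq - ν * hbβ
      ext i j : 1
      simp only [Matrix.of_apply]
      linear_combination (-(escal m (x i) * escal m (x j)) -
        escal m (evenConn x i) * escal m (evenConn x j)) * hcf
    rw [hdet, det_one_sub_outer_sub_outer _ _ _ (sum_escal_mul_evenConn x), sum_escal_sq,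
      sum_escal_evenConn_sq, ← hb]
    -- Both numerical vectors have square `b - 1`, so each of the two factors of the determinant
    -- equals `1/b`.
    have h1 : 1 - β * (b - 1) = β := by linear_combination -hbβ
    rw [h1, Fintype.card_prod, Fintype.card_fin, Fintype.card_fin]
    -- The witness inverts `c^{2m} (N/b)²`: the inverse of `c` is `r'² N` and that of `N/b` is `ν
    -- b`.
    refine mul_ring_inverse_eq (y := (r' ^ 2 * N) ^ (2 * m) * (ν * b) ^ 2) ?_ ?_
    · calc _ = (r * r') ^ (4 * m) * (ν * N) ^ (2 * m) * ((ν * N) ^ 2 * (b * β) ^ 2) := by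
            rw [hc]; ring
        _ = 1 := by rw [hrr, hνN, hbβ]; simp
    · calc _ = (r * r') ^ (4 * m) * (ν * N) ^ (2 * m + 2) * (c ^ (n * 2) * (β * β)) := by
            rw [hc]; ring
        _ = _ := by rw [hrr, hνN]; simp
  · intro i j
    simp only [Matrix.map_apply, fubiniStudy_affine, flatMetric, Matrix.fromBlocks_apply₁₁,
      halfDN_inl, connForm_inl, hcoeR, hν2]
    have : (1 : Matrix (CplxIx n) (CplxIx n) (EvenGrass m)) i j = escal m ((1 : Matrix (CplxIx n) (CplxIx n) ℂ) i j) := by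
      by_cases h : i = j <;> simp [Matrix.one_apply, h]
    simp only [Matrix.of_apply, this]
    exact congrArg Subtype.val (show r ^ 2 * (escal m ((1 : Matrix (CplxIx n) (CplxIx n) ℂ) i j) * ν -
      (escal m (x i) * escal m (x j) + escal m (evenConn x i) * escal m (evenConn x j)) * (ν * ν)) = _ by
        rw [hc]; ring)
  · intro i κ
    simp only [Matrix.map_apply, fubiniStudy_affine, flatMetric, Matrix.fromBlocks_apply₁₂,
      halfDN_inl, connForm_inl, hcoeR, hν2, ← coe_oddHalfDN x, Matrix.zero_apply, scal_zero, zero_mul]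
    refine (mixed_entry (r ^ 2) (escal m (x i)) (escal m (evenConn x i)) (ν * ν) _ _).trans ?_
    congr 3 <;> rw [hc] <;> ring
  · intro i κ
    simp only [Matrix.map_apply, fubiniStudy_affine, flatMetric, Matrix.fromBlocks_apply₂₁,
      halfDN_inl, connForm_inl, hcoeR, hν2, ← coe_oddHalfDN x, Matrix.zero_apply, scal_zero, zero_mul,
      mul_scal, ← scal_mul]
    refine (mixed_entry (r ^ 2) (escal m (x i)) (escal m (evenConn x i)) (ν * ν) _ _).trans ?_
    congr 3 <;> rw [hc] <;> ring
  · intro κ l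
    simp only [Matrix.map_apply, fubiniStudy_affine, flatMetric, Matrix.fromBlocks_apply₂₂, hcoeR, hν2,
      ← coe_oddHalfDN x]
    refine congrArg Subtype.val (show r ^ 2 * (escal m (symplMat ℂ m κ l) * ν -
      (oddMul (oddHalfDN m κ) (oddHalfDN m l) + oddMul (oddGen κ) (oddGen l)) * (ν * ν)) = _ from ?_)
    rw [escal_symplMat]
    simp only [Matrix.sub_apply, Matrix.smul_apply, smul_eq_mul, outer, Matrix.of_apply]
    rw [hc]; ring

theorem isEvenElt_coe (a : EvenGrass m) : IsEvenElt (a : Grass m) := a.2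

theorem coe_volume_factor {R : ℝ} (hR : 0 < R) (k : Fin (n + 1)) (x : CplxIx n → ℝ) (a : ℕ) :
    ((escal m R ^ a * escal m ((R : ℂ)⁻¹) ^ (2 * m) *
        (powN k x (-1) ^ (n + 1) * powN k x 1 ^ m) : EvenGrass m) : Grass m) =
      ((R : ℂ) ^ (a - 2 * m : ℤ)) • ((powN k x (-(n - m + 1)) : EvenGrass m) : Grass m) := by
  have hR' : (R : ℂ) ≠ 0 := by exact_mod_cast hR.ne'
  rw [powN_pow, powN_pow, powN_mul, ← map_pow, ← map_pow, ← map_mul, coe_mul_even, coe_escal, scal_mul]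
  congr 2
  · rw [inv_pow, zpow_sub₀ hR', div_eq_mul_inv, zpow_natCast]
    norm_cast
  · congr 1; push_cast; ring

theorem body_coe_powN (k : Fin (n + 1)) (x : CplxIx n → ℝ) (j : ℤ) :
    body ((powN k x j : EvenGrass m) : Grass m) = ((bodyN x ^ j : ℝ) : ℂ) := by
  change body (superApply (fun t => t ^ j) (affineN k x)) = _
  rw [body_superApply, rbody_affineN]

/-- The element under the outer square has body `R^{a-2m} b^{-(n-m+1)}`, which is positive, so it is
the square root. The exponent `a` is `2n` for the projective superspace and `2n + 1` for the sphere.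
-/
theorem sqrt_volume_factor {R : ℝ} (hR : 0 < R) (k : Fin (n + 1)) (x : CplxIx n → ℝ) (a : ℕ) :
    superApply Real.sqrt (((escal m R ^ a * escal m ((R : ℂ)⁻¹) ^ (2 * m) *
        (powN k x (-1) ^ (n + 1) * powN k x 1 ^ m)) ^ 2 : EvenGrass m) : Grass m) =
      ((R : ℂ) ^ (a - 2 * m : ℤ)) • ((powN k x (-(n - m + 1)) : EvenGrass m) : Grass m) := by
  rw [← coe_volume_factor hR]
  have hb : body ((escal m R ^ a * escal m ((R : ℂ)⁻¹) ^ (2 * m) *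
        (powN k x (-1) ^ (n + 1) * powN k x 1 ^ m) : EvenGrass m) : Grass m) =
      ((R ^ (a - 2 * m : ℤ) * bodyN x ^ (-(n - m + 1) : ℤ) : ℝ) : ℂ) := by
    rw [coe_volume_factor hR, body_smul, body_coe_powN]
    push_cast
    rfl
  refine superApply_sqrt_eq (isEvenElt_coe _) rfl ?_ ?_
  · rw [hb, Complex.ofReal_im]
  · rw [rbody, hb, Complex.ofReal_re]
    have := bodyN_pos x
    positivity

theorem cpVolumeElement_eq {R : ℝ} (hR : 0 < R) (k : Fin (n + 1)) (x : CplxIx n → ℝ) :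
    cpVolumeElement m R k x = ((R : ℂ) ^ (2 * n - 2 * m : ℤ)) •
      superApply (fun t => t ^ (-(n - m + 1) : ℤ)) (affineN k x) := by
  rw [cpVolumeElement, riemVolume, ber_fubiniStudy hR, sqrt_volume_factor hR]
  push_cast
  rfl

end ProjectiveVolume

/-! ### The metric and the volume element of the sphere in Hopf coordinates -/

section HopfMetric

variable {n m : ℕ}

theorem contDiffOn_rpow_neg_half : ContDiffOn ℝ ∞ (fun t : ℝ => t ^ (-(1 / 2) : ℝ)) (Set.Ioi 0) :=
  fun _ ht => (contDiffAt_rpow_neg_half ht).contDiffWithinAt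

theorem bd_bodyN (x : CplxIx n → ℝ) (i : CplxIx n) :
    bd (m := m) (Sum.inl i) bodyN x = 2 * x i := by
  have h : HasFDerivAt (bodyN (n := n))
      (∑ j, (2 * x j) • (ContinuousLinearMap.proj (R := ℝ) (φ := fun _ : CplxIx n => ℝ) j)) x := by
    refine HasFDerivAt.const_add 1 (HasFDerivAt.fun_sum fun j _ => ?_)
    have := ((ContinuousLinearMap.proj (R := ℝ) (φ := fun _ : CplxIx n => ℝ) j).hasFDerivAt
      (x := x)).pow 2
    simpa using this
  simp [bd, h.fderiv, Pi.single_apply]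

theorem oddD_nilN (κ : OddIx m) :
    oddD κ (nilN m) = (2 : ℂ) • (if κ.2 = 0 then gen (κ.1, 1) else -gen (κ.1, 0)) := by
  obtain ⟨ν, s⟩ := κ
  simp only [nilN, map_smul, map_sum, oddD_gen_mul, oddD_gen]
  congr 1
  fin_cases s <;> simp [Finset.sum_ite_eq]

theorem pd_affineN (k : Fin (n + 1)) (a : CplxIx n ⊕ OddIx m) (x : CplxIx n → ℝ) :
    pd a (affineN k) x = (2 : ℂ) • halfDN x a := by
  have : affineN (n := n) (m := m) k = fun x => scal (bodyN x : ℂ) + nilN m := by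
    funext x; exact affineN_eq k x
  rw [this, pd_add a (smoothOn_scal (contDiff_comp_ofReal contDiff_bodyN).contDiffOn) (smoothOn_const _),
    pd_ofReal_scal contDiff_bodyN, pd_const]
  rcases a with i | κ
  · simp only [bd_bodyN, halfDN, Sum.elim_inl, add_zero, Complex.ofReal_mul, Complex.ofReal_ofNat]
    rw [← scal_mul_scal, scal_mul]
  · simp only [Sum.elim_inr, halfDN, oddD_nilN, bd]
    simp [scal]

/-- `N^{-1/2}`. -/
def rsqrtN (k : Fin (n + 1)) (x : CplxIx n → ℝ) : Grass m :=
  superApply (fun t => t ^ (-(1 / 2) : ℝ)) (affineN k x)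

theorem isEvenElt_rsqrtN (k : Fin (n + 1)) (x : CplxIx n → ℝ) : IsEvenElt (rsqrtN (m := m) k x) :=
  (isEvenElt_affineN k x).superApply _

theorem smoothOn_rsqrtN (k : Fin (n + 1)) : SmoothOn Set.univ (rsqrtN (n := n) (m := m) k) :=
  (smoothOn_affineN k).superApply contDiffOn_rpow_neg_half fun x _ => rbody_affineN_pos k x

theorem rsqrtN_mul_self (k : Fin (n + 1)) (x : CplxIx n → ℝ) :
    rsqrtN (m := m) k x * rsqrtN k x = ((powN k x (-1) : EvenGrass m) : Grass m) :=
  superApply_rsqrt_sq (rbody_affineN_pos k x)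

theorem body_rsqrtN (k : Fin (n + 1)) (x : CplxIx n → ℝ) :
    body (rsqrtN (m := m) k x) = ((bodyN x ^ (-(1 / 2) : ℝ) : ℝ) : ℂ) := by
  rw [rsqrtN, body_superApply, rbody_affineN]

/-- This is the chain rule for `t^{-1/2}`; the factor `1/2` cancels against `dN = 2h`. -/
theorem pd_rsqrtN (k : Fin (n + 1)) (a : CplxIx n ⊕ OddIx m) (x : CplxIx n → ℝ) :
    pd a (rsqrtN k) x =
      -(rsqrtN k x * (((powN k x (-1) : EvenGrass m) : Grass m) * halfDN x a)) := by
  have h := pd_superApply (smoothOn_affineN k) (isEvenElt_affineN k) (im_body_affineN k)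
    (rbody_affineN_pos k) contDiffOn_rpow_neg_half a x
  have hd : superApply (deriv fun t : ℝ => t ^ (-(1 / 2) : ℝ)) (affineN (m := m) k x) =
      (-(1 / 2) : ℂ) • (rsqrtN k x * ((powN k x (-1) : EvenGrass m) : Grass m)) := by
    have hpos := rbody_affineN_pos (m := m) k x
    have hz : ContDiffAt ℝ ∞ (fun t : ℝ => t ^ (-1 : ℤ)) (rbody (affineN (m := m) k x)) := by
      simp only [zpow_neg, zpow_one]
      exact contDiffAt_inv _ hpos.ne'
    change _ = _ • (superApply (fun t => t ^ (-(1 / 2) : ℝ)) (affineN k x) *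
      superApply (fun t => t ^ (-1 : ℤ)) (affineN k x))
    rw [← superApply_mul (contDiffAt_rpow_neg_half hpos) hz, ← scal_mul,
      show (scal (-(1 / 2) : ℂ) : Grass m) = superApply (fun _ => (-(1 / 2) : ℝ)) (affineN k x) by
        rw [superApply_const]; push_cast; rfl, ← superApply_mul contDiffAt_const
        ((contDiffAt_rpow_neg_half hpos).mul hz)]
    refine superApply_congr_pos hpos fun t ht => ?_
    rw [Real.deriv_rpow_const, ← Real.rpow_intCast, ← Real.rpow_add ht]
    norm_num
  refine h.trans ?_
  rw [hd, pd_affineN, smul_mul_assoc, mul_smul_comm, smul_smul, ← mul_assoc]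
  norm_num

theorem SmoothOn.comp_some {f : SFun (CplxIx n) m} (hf : SmoothOn Set.univ f) :
    SmoothOn Set.univ fun y : HopfIx n → ℝ => f fun i => y (some i) := fun A =>
  ((contDiffOn_univ.1 (hf A)).comp (contDiff_pi.2 fun i => contDiff_apply ℝ ℝ (some i))).contDiffOn

/-- The coordinates of the base of the Hopf fibration, among the Hopf coordinates. -/
def baseIx : CplxIx n ⊕ OddIx m → HopfIx n ⊕ OddIx m := Sum.map some id

theorem fderiv_comp_some {E : Type*} [NormedAddCommGroup E] [NormedSpace ℝ E] {f : (CplxIx n → ℝ) → E}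
    (hf : Differentiable ℝ f) (x v : HopfIx n → ℝ) :
    fderiv ℝ (fun y : HopfIx n → ℝ => f fun i => y (some i)) x v =
      fderiv ℝ f (fun i => x (some i)) fun i => v (some i) := by
  have h : HasFDerivAt (fun y : HopfIx n → ℝ => fun i : CplxIx n => y (some i))
      (ContinuousLinearMap.pi fun i => ContinuousLinearMap.proj (R := ℝ) (φ := fun _ : HopfIx n => ℝ) (some i)) x :=
    (ContinuousLinearMap.pi fun i => ContinuousLinearMap.proj (R := ℝ) (φ := fun _ : HopfIx n => ℝ) (some i)).hasFDerivAt
  have := (hf (fun i => x (some i))).hasFDerivAt.comp x h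
  rw [show (fun y : HopfIx n → ℝ => f fun i => y (some i)) = f ∘ fun y i => y (some i) from rfl, this.fderiv]
  rfl

theorem pd_comp_some {f : SFun (CplxIx n) m} (hf : SmoothOn Set.univ f) (a : CplxIx n ⊕ OddIx m)
    (x : HopfIx n → ℝ) :
    pd (baseIx a) (fun y : HopfIx n → ℝ => f fun i => y (some i)) x = pd a f fun i => x (some i) := by
  rcases a with i | κ
  · apply grass_ext
    intro A
    simp only [baseIx, Sum.map_inl]
    rw [coeff_pd_inl, coeff_pd_inl, fderiv_comp_some (f := fun y => coeff A (f y))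
      ((contDiffOn_univ.1 (hf A)).differentiable (by simp))]
    congr 1
    funext j
    simp [Pi.single_apply]
  · rfl

theorem pd_none_comp_some {f : SFun (CplxIx n) m} (hf : SmoothOn Set.univ f) (x : HopfIx n → ℝ) :
    pd (Sum.inl none) (fun y : HopfIx n → ℝ => f fun i => y (some i)) x = 0 := by
  apply grass_ext
  intro A
  rw [coeff_pd_inl, fderiv_comp_some (f := fun y => coeff A (f y))
      ((contDiffOn_univ.1 (hf A)).differentiable (by simp)), coeff_zero]
  have : (fun i : CplxIx n => (Pi.single none 1 : HopfIx n → ℝ) (some i)) = 0 := by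
    funext j; simp
  rw [this, map_zero]

/-- The factor `R e^{iα}`. -/
def phase (R α : ℝ) : ℂ := R * Complex.exp (Complex.I * (α : ℂ))

theorem phase_re (R α : ℝ) : (phase R α).re = R * Real.cos α := by
  rw [phase, mul_comm Complex.I, Complex.re_ofReal_mul, Complex.exp_ofReal_mul_I_re]

theorem phase_im (R α : ℝ) : (phase R α).im = R * Real.sin α := by
  rw [phase, mul_comm Complex.I, Complex.im_ofReal_mul, Complex.exp_ofReal_mul_I_im]

theorem hopfCoord_apply (R : ℝ) (k : Fin (n + 1)) (e : AmbIx n m) (x : HopfIx n → ℝ) :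
    hopfCoord R k e x = rsqrtN k (fun i => x (some i)) *
      superCmul (phase R (x none)) (fun e' => affineCoord k e' fun i => x (some i)) e := rfl

/-- The conjugate index: real part for imaginary part and vice versa. -/
def flipIx : AmbIx n m → AmbIx n m :=
  Sum.map (fun p => (p.1, 1 - p.2)) (fun p => (p.1, 1 - p.2))

/-- Is the index that of a real part? -/
def reSign : AmbIx n m → ℝ :=
  Sum.elim (fun p => if p.2 = 0 then -1 else 1) (fun p => if p.2 = 0 then -1 else 1)

theorem superCmul_apply (c : ℂ) (V : AmbIx n m → Grass m) (e : AmbIx n m) :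
    superCmul c V e = (c.re : ℂ) • V e + ((reSign e * c.im : ℝ) : ℂ) • V (flipIx e) := by
  rcases e with ⟨p, s⟩ | ⟨p, s⟩ <;> fin_cases s <;>
    simp [superCmul_inl, superCmul_inr, reSign, flipIx, -Complex.coe_smul, sub_eq_add_neg, add_comm]

theorem superCmul_superCmul (c d : ℂ) (V : AmbIx n m → Grass m) :
    superCmul c (superCmul d V) = superCmul (c * d) V := by
  funext e
  rcases e with ⟨p, s⟩ | ⟨p, s⟩ <;> fin_cases s <;>
    simp [superCmul_inl, superCmul_inr, -Complex.coe_smul] <;> module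

theorem contDiff_phase_re (R : ℝ) : ContDiff ℝ ∞ fun y : HopfIx n → ℝ => (phase R (y none)).re := by
  simp only [phase_re]
  exact contDiff_const.mul (Real.contDiff_cos.comp (contDiff_apply ℝ ℝ none))

theorem contDiff_phase_im (R : ℝ) : ContDiff ℝ ∞ fun y : HopfIx n → ℝ => (phase R (y none)).im := by
  simp only [phase_im]
  exact contDiff_const.mul (Real.contDiff_sin.comp (contDiff_apply ℝ ℝ none))

theorem bd_comp_none {F : ℝ → ℝ} (hF : Differentiable ℝ F) (x : HopfIx n → ℝ) (a : HopfIx n ⊕ OddIx m) :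
    bd a (fun y : HopfIx n → ℝ => F (y none)) x = if a = Sum.inl none then deriv F (x none) else 0 := by
  rw [bd_comp (h := fun y : HopfIx n → ℝ => y none) (hF _) (differentiableAt_apply _ _), bd_apply]
  split_ifs <;> simp

theorem smoothOn_phase_affine (R : ℝ) (k : Fin (n + 1)) (e : AmbIx n m) :
    SmoothOn Set.univ fun y : HopfIx n → ℝ =>
      superCmul (phase R (y none)) (fun e' => affineCoord k e' fun i => y (some i)) e := by
  simp only [superCmul_apply]
  exact (SmoothOn.smul (contDiff_comp_ofReal (contDiff_phase_re R)).contDiffOn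
      (smoothOn_affineCoord k e).comp_some).fun_add
    (SmoothOn.smul (contDiff_comp_ofReal (contDiff_const.mul (contDiff_phase_im R))).contDiffOn
      (smoothOn_affineCoord k _).comp_some)

theorem smoothOn_hopfCoord (R : ℝ) (k : Fin (n + 1)) (e : AmbIx n m) :
    SmoothOn Set.univ (hopfCoord R k e) :=
  (smoothOn_rsqrtN k).comp_some.mul (smoothOn_phase_affine R k e)

theorem pd_phase_affine (R : ℝ) (k : Fin (n + 1)) (e : AmbIx n m) (x : HopfIx n → ℝ)
    (a : HopfIx n ⊕ OddIx m) :
    pd a (fun y : HopfIx n → ℝ =>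
      superCmul (phase R (y none)) (fun e' => affineCoord k e' fun i => y (some i)) e) x =
    ((bd a (fun y : HopfIx n → ℝ => (phase R (y none)).re) x : ℂ) • affineCoord k e (fun i => x (some i)) +
      ((phase R (x none)).re : ℂ) • pd a (fun y : HopfIx n → ℝ => affineCoord k e fun i => y (some i)) x) +
    ((bd a (fun y : HopfIx n → ℝ => reSign e * (phase R (y none)).im) x : ℂ) •
        affineCoord k (flipIx e) (fun i => x (some i)) +
      ((reSign e * (phase R (x none)).im : ℝ) : ℂ) •
        pd a (fun y : HopfIx n → ℝ => affineCoord k (flipIx e) fun i => y (some i)) x) := by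
  simp only [superCmul_apply]
  rw [pd_add a, pd_ofReal_smul (contDiff_phase_re R) (smoothOn_affineCoord k e).comp_some,
    pd_ofReal_smul (contDiff_const.mul (contDiff_phase_im R)) (smoothOn_affineCoord k _).comp_some]
  · exact (SmoothOn.smul (contDiff_comp_ofReal (contDiff_phase_re R)).contDiffOn
      (smoothOn_affineCoord k e).comp_some)
  · exact (SmoothOn.smul (contDiff_comp_ofReal (contDiff_const.mul (contDiff_phase_im R))).contDiffOn
      (smoothOn_affineCoord k _).comp_some)

theorem pd_phase_affine_base (R : ℝ) (k : Fin (n + 1)) (e : AmbIx n m) (x : HopfIx n → ℝ)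
    (a : CplxIx n ⊕ OddIx m) :
    pd (baseIx a) (fun y : HopfIx n → ℝ =>
      superCmul (phase R (y none)) (fun e' => affineCoord k e' fun i => y (some i)) e) x =
    superCmul (phase R (x none)) (affineRow k a) e := by
  have hne : baseIx (n := n) (m := m) a ≠ Sum.inl none := by rcases a with i | κ <;> simp [baseIx]
  rw [pd_phase_affine, pd_comp_some (smoothOn_affineCoord k _), pd_comp_some (smoothOn_affineCoord k _),
    pd_affineCoord, pd_affineCoord, superCmul_apply]
  simp only [phase_re, phase_im]
  rw [bd_comp_none (F := fun t => R * Real.cos t) (by fun_prop),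
    bd_comp_none (F := fun t => reSign e * (R * Real.sin t)) (by fun_prop), if_neg hne, if_neg hne]
  simp [-Complex.coe_smul]

theorem pd_phase_affine_none (R : ℝ) (k : Fin (n + 1)) (e : AmbIx n m) (x : HopfIx n → ℝ) :
    pd (Sum.inl none) (fun y : HopfIx n → ℝ =>
      superCmul (phase R (y none)) (fun e' => affineCoord k e' fun i => y (some i)) e) x =
    superCmul (phase R (x none)) (affineJ k fun i => x (some i)) e := by
  rw [pd_phase_affine, pd_none_comp_some (smoothOn_affineCoord k _),
    pd_none_comp_some (smoothOn_affineCoord k _), affineJ, superCmul_superCmul, superCmul_apply]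
  simp only [phase_re, phase_im, Complex.mul_re, Complex.mul_im, Complex.I_re, Complex.I_im]
  rw [bd_comp_none (F := fun t => R * Real.cos t) (by fun_prop),
    bd_comp_none (F := fun t => reSign e * (R * Real.sin t)) (by fun_prop), if_pos rfl, if_pos rfl]
  simp [-Complex.coe_smul]

/-- The rows of the Jacobi matrix of the Hopf coordinates, up to the factor `R e^{iα} N^{-1/2}`. -/
def hopfRow (k : Fin (n + 1)) (x : CplxIx n → ℝ) (a : CplxIx n ⊕ OddIx m) : AmbIx n m → Grass m :=
  affineRow k a - fun e => ((powN k x (-1) : EvenGrass m) : Grass m) * halfDN x a * affineCoord k e x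

theorem superCmul_sub (c : ℂ) (V V' : AmbIx n m → Grass m) :
    superCmul c (V - V') = superCmul c V - superCmul c V' := by
  funext e; simp only [superCmul_apply, Pi.sub_apply]; module

theorem superCmul_mul_left (c : ℂ) (f : Grass m) (V : AmbIx n m → Grass m) (e : AmbIx n m) :
    superCmul c (fun e => f * V e) e = f * superCmul c V e := by
  simp only [superCmul_apply, mul_add, mul_smul_comm]

/-- The derivative of `N^{-1/2}` subtracts the radial component: the row is the projection of `e_a`
to the complement of `w`. -/
theorem pd_hopfCoord_base (R : ℝ) (k : Fin (n + 1)) (e : AmbIx n m) (x : HopfIx n → ℝ)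
    (a : CplxIx n ⊕ OddIx m) :
    pd (baseIx a) (hopfCoord R k e) x = rsqrtN k (fun i => x (some i)) *
      superCmul (phase R (x none)) (hopfRow k (fun i => x (some i)) a) e := by
  have h := pd_mul_of_even (smoothOn_rsqrtN k).comp_some (smoothOn_phase_affine R k e)
    (fun y => isEvenElt_rsqrtN k _) (baseIx a) x
  refine h.trans ?_
  rw [pd_comp_some (smoothOn_rsqrtN k), pd_rsqrtN, pd_phase_affine_base, hopfRow, superCmul_sub,
    Pi.sub_apply, superCmul_mul_left, mul_sub, neg_mul, neg_add_eq_sub]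
  simp only [mul_assoc]

theorem pd_hopfCoord_none (R : ℝ) (k : Fin (n + 1)) (e : AmbIx n m) (x : HopfIx n → ℝ) :
    pd (Sum.inl none) (hopfCoord R k e) x = rsqrtN k (fun i => x (some i)) *
      superCmul (phase R (x none)) (affineJ k fun i => x (some i)) e := by
  have h := pd_mul_of_even (smoothOn_rsqrtN k).comp_some (smoothOn_phase_affine R k e)
    (fun y => isEvenElt_rsqrtN k _) (Sum.inl none) x
  refine h.trans ?_
  rw [pd_none_comp_some (smoothOn_rsqrtN k), pd_phase_affine_none, zero_mul, zero_add]

/-- The rows of the Jacobi matrix of the Hopf coordinates, up to the factor `R e^{iα} N^{-1/2}`,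
including the angle. -/
def hopfRows (k : Fin (n + 1)) (x : CplxIx n → ℝ) : HopfIx n ⊕ OddIx m → AmbIx n m → Grass m
  | Sum.inl none => affineJ k x
  | Sum.inl (some i) => hopfRow k x (Sum.inl i)
  | Sum.inr κ => hopfRow k x (Sum.inr κ)

theorem pd_hopfCoord (R : ℝ) (k : Fin (n + 1)) (e : AmbIx n m) (x : HopfIx n → ℝ)
    (a : HopfIx n ⊕ OddIx m) :
    pd a (hopfCoord R k e) x = rsqrtN k (fun i => x (some i)) *
      superCmul (phase R (x none)) (hopfRows k (fun i => x (some i)) a) e := by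
  rcases a with (_ | i) | κ
  · exact pd_hopfCoord_none R k e x
  · exact pd_hopfCoord_base R k e x (Sum.inl i)
  · exact pd_hopfCoord_base R k e x (Sum.inr κ)

/-- The scalar acts on every pair of real and imaginary parts by a rotation and a dilation. The
symmetric form on even pairs and the symplectic form on odd pairs are both multiplied by its squared
modulus. -/
theorem pairG_superCmul (c : ℂ) (U V : AmbIx n m → Grass m) :
    pairG (superCmul c U) (superCmul c V) = ((c.re ^ 2 + c.im ^ 2 : ℝ) : ℂ) • pairG U V := by
  simp only [pairG, superCmul_inl, superCmul_inr, Fintype.sum_prod_type, Fin.sum_univ_two, smul_add,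
    Finset.smul_sum]
  congr 1
  · refine Finset.sum_congr rfl fun μ _ => ?_
    simp only [if_true, one_ne_zero, if_false, add_mul, sub_mul, mul_add, mul_sub, smul_mul_assoc,
      mul_smul_comm]
    push_cast
    module
  · refine Finset.sum_congr rfl fun μ _ => ?_
    simp only [if_true, one_ne_zero, if_false, add_mul, sub_mul, mul_add, mul_sub, smul_mul_assoc,
      mul_smul_comm]
    push_cast
    module

theorem signOdd_superCmul {I : Type*} (b : I ⊕ OddIx m) (c : ℂ) (V : AmbIx n m → Grass m) :
    signOdd b (superCmul c V) = superCmul c (signOdd b V) := by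
  rcases b with b | b
  · funext e
    rcases e with ⟨p, s⟩ | ⟨p, s⟩ <;> fin_cases s <;>
      simp [signOdd, flipOdd, superCmul_inl, superCmul_inr, -Complex.coe_smul] <;> module
  · rfl

theorem signOdd_mul_left {I : Type*} (b : I ⊕ OddIx m) (f : Grass m) (V : AmbIx n m → Grass m) :
    signOdd b (fun e => f * V e) = fun e => f * signOdd b V e := by
  funext e
  rcases b with b | b <;> rcases e with e | e <;> simp [signOdd, flipOdd]

theorem phase_normSq (R α : ℝ) : (phase R α).re ^ 2 + (phase R α).im ^ 2 = R ^ 2 := by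
  rw [phase_re, phase_im]
  linear_combination R ^ 2 * Real.sin_sq_add_cos_sq α

/-- The phase disappears as an isometry, its modulus leaves `R²`, and the two factors `N^{-1/2}`
combine to `N⁻¹`. In particular the metric does not depend on the angle. -/
theorem inducedMetric_hopfCoord (R : ℝ) (k : Fin (n + 1)) (x : HopfIx n → ℝ) (a b : HopfIx n ⊕ OddIx m) :
    inducedMetric (hopfCoord R k) a b x = ((R : ℂ) ^ 2) •
      (((powN k (fun i => x (some i)) (-1) : EvenGrass m) : Grass m) *
        pairG (hopfRows k (fun i => x (some i)) a) (signOdd b (hopfRows k (fun i => x (some i)) b))) := by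
  rw [inducedMetric_apply]
  simp only [pd_hopfCoord]
  have hcomm : ∀ (V : AmbIx n m → Grass m), (fun e => rsqrtN k (fun i => x (some i)) * V e) =
      fun e => V e * rsqrtN k (fun i => x (some i)) := by
    intro V; funext e; exact (isEvenElt_rsqrtN k _).commute _
  rw [signOdd_mul_left, hcomm (signOdd _ _), pairG_mul_right, pairG_mul_left, signOdd_superCmul,
    pairG_superCmul, phase_normSq, ((isEvenElt_rsqrtN k _).commute _).eq.symm, ← mul_assoc,
    rsqrtN_mul_self, mul_smul_comm]
  push_cast
  rfl

theorem pairG_mul_right' (f : Grass m) (hf : IsEvenElt f) (U V : AmbIx n m → Grass m) :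
    pairG U (fun e => f * V e) = f * pairG U V := by
  rw [show (fun e => f * V e) = fun e => V e * f from funext fun e => hf.commute _, pairG_mul_right,
    (hf.commute _).eq]

/-- The sign that arises when an odd `h_b` passes to the right of an odd component of `w` agrees
with that of the supertranspose, so both parities of `b` give one formula. -/
theorem signOdd_halfDN_mul (k : Fin (n + 1)) (x : CplxIx n → ℝ) (b : CplxIx n ⊕ OddIx m) :
    signOdd b (fun e => halfDN x b * affineCoord k e x) =
      fun e => flipOdd (fun e => affineCoord k e x) e * halfDN x b := by
  funext e
  rcases b with i | κ
  · rcases e with e | e <;> simp [signOdd, flipOdd, halfDN, scal_mul, mul_scal]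
  · have ho : IsOddElt (halfDN x (Sum.inr κ)) := by rw [← coe_oddHalfDN]; exact (oddHalfDN m κ).2
    rcases e with e | e
    · simp only [signOdd, Sum.elim_inr, flipOdd, Sum.elim_inl]
      exact ((isEvenElt_scal _).commute _).eq.symm
    · simp only [signOdd, Sum.elim_inr, flipOdd, affineCoord_inr, neg_mul]
      exact odd_mul_odd ho (isOddElt_gen _)

theorem signOdd_hopfRow (k : Fin (n + 1)) (x : CplxIx n → ℝ) (b : CplxIx n ⊕ OddIx m) :
    signOdd b (hopfRow k x b) = signOdd b (affineRow k b) - fun e =>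
      ((powN k x (-1) : EvenGrass m) : Grass m) * (flipOdd (fun e => affineCoord k e x) e * halfDN x b) := by
  have h := congrArg (fun V : AmbIx n m → Grass m => fun e =>
    ((powN k x (-1) : EvenGrass m) : Grass m) * V e) (signOdd_halfDN_mul (m := m) k x b)
  rw [← h, ← signOdd_mul_left]
  funext e
  rcases b with i | κ <;> rcases e with e | e <;>
    simp [signOdd, flipOdd, hopfRow, mul_assoc] <;> abel

/-- Since `⟨e_a, w⟩ = h_a`, `⟨w, e_b⟩ = h_b` and `N⁻¹ ⟨w, w⟩ = 1`, the three corrections are `-`,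
`-` and `+` the term `N⁻¹ h_a h_b`. -/
theorem pairG_hopfRow_hopfRow (k : Fin (n + 1)) (x : CplxIx n → ℝ) (a b : CplxIx n ⊕ OddIx m) :
    pairG (hopfRow k x a) (signOdd b (hopfRow k x b)) = scal (flatMetric n m a b) -
      ((powN k x (-1) : EvenGrass m) : Grass m) * (halfDN x a * halfDN x b) := by
  have hν := isEvenElt_coe (powN (m := m) k x (-1))
  have h1 : ((powN (m := m) k x (-1) : EvenGrass m) : Grass m) * (scal (bodyN x : ℂ) + nilN m) = 1 := by
    rw [← affineN_eq k, ← coe_powN_one k, ← coe_mul_even, powN_neg_one_mul_one]; rfl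
  rw [signOdd_hopfRow, hopfRow, pairG_sub_left, pairG_sub_right, pairG_sub_right, pairG_mul_left,
    pairG_mul_left, pairG_mul_right' _ hν, pairG_mul_right' _ hν, pairG_mul_right, pairG_mul_right,
    pairG_affineRow_affineRow, pairG_affineRow_affine, pairG_affine_affineRow, pairG_affine_flipOdd]
  rw [← mul_assoc _ (scal _ + _) (halfDN x b), h1, one_mul, mul_assoc _ (halfDN x a)]
  abel

theorem pairG_affineJ_hopfRow (k : Fin (n + 1)) (x : CplxIx n → ℝ) (b : CplxIx n ⊕ OddIx m) :
    pairG (affineJ k x) (signOdd b (hopfRow k x b)) = connForm x b := by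
  rw [signOdd_hopfRow, pairG_sub_right, pairG_mul_right' _ (isEvenElt_coe _), pairG_mul_right,
    pairG_affineJ_affineRow, pairG_affineJ_affine, zero_mul, mul_zero, sub_zero]

theorem pairG_hopfRow_affineJ (k : Fin (n + 1)) (x : CplxIx n → ℝ) (a : CplxIx n ⊕ OddIx m) :
    pairG (hopfRow k x a) (flipOdd (affineJ k x)) = connForm x a := by
  rw [hopfRow, pairG_sub_left, pairG_mul_left, pairG_affineRow_affineJ, pairG_affine_affineJ, mul_zero,
    sub_zero]

/-- Compared with the Fubini–Study metric, `ω` has moved from the outer products to the row and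
column of the angle, whence `ν₂ = 0` and `s₂ = 1`. Elimination of the odd coordinates and of the
angle leads to the same numerical matrix. The even determinant is `b · b⁻²`, the odd one contributes
`N/b`, and the Berezinian is `(R²/N)^{2n+1-2m} N⁻¹`. -/
theorem ber_inducedMetric_hopfCoord {R : ℝ} (hR : 0 < R) (k : Fin (n + 1)) (y : HopfIx n → ℝ) :
    ber ((inducedMetric (hopfCoord (m := m) R k)).map fun f => f y) =
      (((escal m R ^ (2 * n + 1) * escal m ((R : ℂ)⁻¹) ^ (2 * m) *
        (powN k (fun i => y (some i)) (-1) ^ (n + 1) * powN k (fun i => y (some i)) 1 ^ m)) ^ 2 :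
          EvenGrass m) : Grass m) := by
  set x : CplxIx n → ℝ := fun i => y (some i) with hx
  set ν := powN (m := m) k x (-1) with hν
  set N := powN (m := m) k x 1 with hN
  set b := escal m (bodyN x) with hb
  set β := escal m ((bodyN x : ℂ)⁻¹) with hβ
  set r := escal m (R : ℂ) with hr
  set r' := escal m ((R : ℂ)⁻¹) with hr'
  set q := evenNilN m with hq
  have hrr : r * r' = 1 := escal_mul_inv hR
  have hνN : ν * N = 1 := powN_neg_one_mul_one k x
  have hbβ : b * β = 1 := escal_bodyN_mul_inv x
  have hNq : N = b + q := powN_one_eq k x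
  set c := r ^ 2 * ν with hc
  have hcoeR : ∀ f : Grass m, ((R : ℂ) ^ 2) • ((ν : Grass m) * f) = (c : Grass m) * f := by
    intro f
    rw [hc, coe_mul_even, hr, ← map_pow, coe_escal, scal_mul, smul_mul_assoc]
  have hs : N * β * (1 - ν * q) = 1 := by
    linear_combination (-β * q) * hνN + hbβ + β * hNq
  have hcf : ν + N * β * q * ν ^ 2 = β := by
    linear_combination (β * q * ν + β) * hνN - ν * β * hNq - ν * hbβ
  rw [ber_eq_of_gram (c := c) (c' := r' ^ 2 * N) (ν₁ := ν) (ν₂ := 0) (q := q) (s₁ := N * β)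
    (s₂ := 1) (w₁ := oddHalfDN m) (w₂ := oddGen)
    (B := Matrix.of fun i j => Option.elim i (Option.elim j N fun j => escal m (evenConn x j))
      fun i => Option.elim j (escal m (evenConn x i)) fun j =>
        (1 : Matrix (CplxIx n) (CplxIx n) (EvenGrass m)) i j - ν * (escal m (x i) * escal m (x j)))
    (A₁ := fun i => Option.elim i 0 fun i => -ν * escal m (x i))
    (A₂ := fun i => Option.elim i 1 fun _ => 0)
    (by rw [hc]; linear_combination (r * r' + 1) * hrr + r ^ 2 * r' ^ 2 * hνN)
    odot_oddHalfDN odot_oddGen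
    odot_oddHalfDN_sympl_oddGen odot_oddGen_sympl_oddHalfDN hs (by ring)]
  · congr 1
    -- The coefficient of `w₂` is 1 in the row of the angle, so odd elimination changes the corner
    -- entry from `N` to `N - q = b`.
    rw [det_option (b := b) (b' := β) _ hbβ (by simp [hNq])]
    simp only [Matrix.of_apply, Option.elim_some, Option.elim_none]
    have hdet : (Matrix.of fun i j => (1 : Matrix (CplxIx n) (CplxIx n) (EvenGrass m)) i j -
          ν * (escal m (x i) * escal m (x j)) -
        N * β * q * (-ν * escal m (x i) * (-ν * escal m (x j))) - 1 * q * (0 * 0) -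
        β * ((escal m (evenConn x i) - N * β * q * (-ν * escal m (x i) * 0) - 1 * q * (0 * 1)) *
          (escal m (evenConn x j) - N * β * q * (0 * (-ν * escal m (x j))) - 1 * q * (1 * 0)))) =
        Matrix.of fun i j => (1 : Matrix (CplxIx n) (CplxIx n) (EvenGrass m)) i j -
          β * (escal m (x i) * escal m (x j)) - β * (escal m (evenConn x i) * escal m (evenConn x j)) := by
      ext i j : 1
      simp only [Matrix.of_apply]
      linear_combination (-(escal m (x i) * escal m (x j))) * hcf
    rw [hdet, det_one_sub_outer_sub_outer _ _ _ (sum_escal_mul_evenConn x), sum_escal_sq,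
      sum_escal_evenConn_sq, ← hb]
    have h1 : 1 - β * (b - 1) = β := by linear_combination -hbβ
    rw [h1, Fintype.card_option, Fintype.card_prod, Fintype.card_fin, Fintype.card_fin,
      show b * (β * β) = β by linear_combination β * hbβ]
    refine mul_ring_inverse_eq (y := (r' ^ 2 * N) ^ (2 * m) * (ν * b)) ?_ ?_
    · calc _ = (r * r') ^ (4 * m) * (ν * N) ^ (2 * m) * ((ν * N) * (b * β)) := by
            rw [hc]; ring
        _ = 1 := by rw [hrr, hνN, hbβ]; simp
    · calc _ = (r * r') ^ (4 * m) * (ν * N) ^ (2 * m + 1) * (c ^ (n * 2 + 1) * β) := by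
            rw [hc]; ring
        _ = _ := by rw [hrr, hνN]; simp
  · intro i j
    simp only [Matrix.map_apply, inducedMetric_hopfCoord]
    rw [hcoeR, coe_mul_even]
    congr 1
    rcases i with _ | i <;> rcases j with _ | j
    · simp only [Matrix.of_apply, Option.elim_none, hopfRows]
      rw [hN, coe_powN_one, affineN_eq]
      exact pairG_affineJ_affineJ k x
    · exact (pairG_affineJ_hopfRow k x (Sum.inl j)).trans (connForm_inl x j)
    · exact (pairG_hopfRow_affineJ k x (Sum.inl i)).trans (connForm_inl x i)
    · refine (pairG_hopfRow_hopfRow k x (Sum.inl i) (Sum.inl j)).trans ?_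
      simp only [flatMetric, Matrix.fromBlocks_apply₁₁]
      have : (1 : Matrix (CplxIx n) (CplxIx n) (EvenGrass m)) i j =
          escal m ((1 : Matrix (CplxIx n) (CplxIx n) ℂ) i j) := by
        by_cases h : i = j <;> simp [Matrix.one_apply, h]
      simp only [Matrix.of_apply, Option.elim_some, this]
      rfl
  · intro i κ
    simp only [Matrix.map_apply, inducedMetric_hopfCoord]
    rw [hcoeR]
    rcases i with _ | i
    · have := pairG_affineJ_hopfRow k x (Sum.inr κ)
      simp only [Option.elim_none, mul_zero, mul_one]
      rw [show ((0 : EvenGrass m) : Grass m) = 0 from rfl, zero_mul, zero_add]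
      exact congrArg _ this
    · have := pairG_hopfRow_hopfRow k x (Sum.inl i) (Sum.inr κ)
      simp only [Option.elim_some, mul_zero]
      rw [show ((0 : EvenGrass m) : Grass m) = 0 from rfl, zero_mul, add_zero]
      refine (congrArg _ this).trans ?_
      simp only [flatMetric, Matrix.fromBlocks_apply₁₂, Matrix.zero_apply, scal_zero, zero_sub,
        coe_oddHalfDN x, halfDN_inl]
      rw [coe_mul_even c, mul_assoc]
      congr 1
      rw [coe_mul_even, mul_assoc]
      exact (neg_mul _ _).symm
  · intro i κ
    simp only [Matrix.map_apply, inducedMetric_hopfCoord]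
    rw [hcoeR]
    rcases i with _ | i
    · have := pairG_hopfRow_affineJ k x (Sum.inr κ)
      simp only [Option.elim_none, mul_zero, mul_one]
      rw [show ((0 : EvenGrass m) : Grass m) = 0 from rfl, zero_mul, zero_add]
      exact congrArg _ this
    · have := pairG_hopfRow_hopfRow k x (Sum.inr κ) (Sum.inl i)
      simp only [Option.elim_some, mul_zero]
      rw [show ((0 : EvenGrass m) : Grass m) = 0 from rfl, zero_mul, add_zero]
      refine (congrArg _ this).trans ?_
      simp only [flatMetric, Matrix.fromBlocks_apply₂₁, Matrix.zero_apply, scal_zero, zero_sub,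
        coe_oddHalfDN x, halfDN_inl, mul_scal, ← scal_mul]
      rw [coe_mul_even c, mul_assoc]
      congr 1
      rw [coe_mul_even, mul_assoc]
      exact (neg_mul _ _).symm
  · intro κ l
    simp only [Matrix.map_apply, inducedMetric_hopfCoord]
    rw [hcoeR, coe_mul_even]
    congr 1
    refine (pairG_hopfRow_hopfRow k x (Sum.inr κ) (Sum.inr l)).trans ?_
    simp only [flatMetric, Matrix.fromBlocks_apply₂₂, ← coe_oddHalfDN x, zero_smul, sub_zero,
      Matrix.sub_apply, Matrix.smul_apply, smul_eq_mul, outer, Matrix.of_apply, Matrix.zero_apply, ← escal_symplMat]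
    rfl

theorem sphereVolumeElement_eq {R : ℝ} (hR : 0 < R) (k : Fin (n + 1)) (y : HopfIx n → ℝ) :
    sphereVolumeElement m R k y = ((R : ℂ) ^ (2 * n + 1 - 2 * m : ℤ)) •
      superApply (fun t => t ^ (-(n - m + 1) : ℤ)) (affineN k fun i => y (some i)) := by
  rw [sphereVolumeElement, riemVolume, ber_inducedMetric_hopfCoord hR, sqrt_volume_factor hR]
  push_cast
  rfl

theorem sphereVolumeElement_eq_arcTimes {R : ℝ} (hR : 0 < R) (k : Fin (n + 1)) :
    sphereVolumeElement m R k = arcTimes R (cpVolumeElement m R k) := by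
  funext y
  rw [sphereVolumeElement_eq hR, arcTimes, cpVolumeElement_eq hR, smul_smul]
  congr 1
  rw [← zpow_one_add₀ (by exact_mod_cast hR.ne')]
  congr 1; ring

end HopfMetric

/-! ### The volume element in complex coordinates -/

section ComplexBracket

variable {n m : ℕ}

/-- The Jacobi matrix of `w, w̄` with respect to the real and imaginary parts of `w`. -/
def conjJacobi : Matrix (Fin 2) (Fin 2) ℂ := !![1, 1; Complex.I, -Complex.I]

/-- The Jacobi matrix of `N` complex coordinates and their conjugates. -/
def conjJacobis (N : ℕ) : Matrix (Fin N × Fin 2) (Fin N × Fin 2) ℂ :=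
  Matrix.kroneckerMap (· * ·) 1 conjJacobi

theorem conjJacobis_apply (N : ℕ) (p q : Fin N × Fin 2) :
    conjJacobis N p q = if p.1 = q.1 then conjJacobi p.2 q.2 else 0 := by
  simp [conjJacobis, Matrix.kroneckerMap_apply, Matrix.one_apply]

theorem det_conjJacobis (N : ℕ) : (conjJacobis N).det = (-2 * Complex.I) ^ N := by
  rw [conjJacobis, Matrix.det_kronecker, Matrix.det_one, one_pow, one_mul, Fintype.card_fin, conjJacobi,
    Matrix.det_fin_two_of]
  congr 1; ring

/-- The Jacobi matrix of `α, w, w̄`. -/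
def hopfConjJacobi (n : ℕ) : Matrix (HopfIx n) (HopfIx n) ℂ :=
  Matrix.of fun i j => Option.elim i (Option.elim j 1 fun _ => 0)
    fun i => Option.elim j 0 fun j => conjJacobis n i j

theorem det_hopfConjJacobi (n : ℕ) : (hopfConjJacobi n).det = (-2 * Complex.I) ^ n := by
  rw [det_option _ (one_mul 1) (by simp [hopfConjJacobi]), one_mul, ← det_conjJacobis]
  congr 1
  ext i j
  simp [hopfConjJacobi]

theorem pd_complexHopfCoord (a c : HopfIx n ⊕ OddIx m) (x : HopfIx n → ℝ) :
    pd a (complexHopfCoord n m c) x =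
      scal (Matrix.fromBlocks (hopfConjJacobi n) 0 0 (conjJacobis m) a c) := by
  have hsm : ∀ i : HopfIx n, SmoothOn (m := m) Set.univ fun y : HopfIx n → ℝ => scal (y i : ℂ) :=
    fun i => smoothOn_scal (contDiff_comp_ofReal (contDiff_apply ℝ ℝ i)).contDiffOn
  have hpd : ∀ i : HopfIx n, pd a (fun y : HopfIx n → ℝ => scal (m := m) (y i : ℂ)) x =
      scal ((if a = Sum.inl i then 1 else 0 : ℝ) : ℂ) := by
    intro i
    rw [pd_ofReal_scal (contDiff_apply ℝ ℝ i), bd_apply]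
  have hlin : ∀ (i j : HopfIx n) (t : ℂ), pd a (fun y : HopfIx n → ℝ =>
      scal (m := m) ((y i : ℂ) + t * (y j : ℂ))) x =
      scal ((if a = Sum.inl i then 1 else 0 : ℝ) + t * (if a = Sum.inl j then 1 else 0 : ℝ)) := by
    intro i j t
    have : (fun y : HopfIx n → ℝ => scal (m := m) ((y i : ℂ) + t * (y j : ℂ))) =
        fun y => scal (y i : ℂ) + t • scal (y j : ℂ) := by
      funext y; rw [scal_add, ← scal_mul_scal, scal_mul]
    rw [this, pd_add a (hsm i) ((hsm j).const_smul t), pd_smul (hsm j), hpd, hpd, scal_add,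
      ← scal_mul_scal, scal_mul]
  rcases c with (_ | ⟨b, t⟩) | ⟨μ, t⟩
  · refine (hpd none).trans ?_
    rcases a with (_ | i) | κ <;> simp [hopfConjJacobi]
  · have h : complexHopfCoord n m (Sum.inl (some (b, t))) = fun y : HopfIx n → ℝ =>
        scal ((y (some (b, 0)) : ℂ) + (if t = 0 then Complex.I else -Complex.I) * (y (some (b, 1)) : ℂ)) := by
      funext y
      simp only [complexHopfCoord]
      split_ifs <;> simp [sub_eq_add_neg]
    rw [h, hlin]
    rcases a with (_ | ⟨i, s⟩) | κ
    · simp [hopfConjJacobi]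
    · by_cases hi : i = b
      · fin_cases s <;> fin_cases t <;> simp [hopfConjJacobi, conjJacobis_apply, conjJacobi, hi]
      · simp [hopfConjJacobi, conjJacobis_apply, hi]
    · simp
  · have h : complexHopfCoord n m (Sum.inr (μ, t)) = fun _ : HopfIx n → ℝ =>
        gen (μ, 0) + (if t = 0 then Complex.I else -Complex.I) • gen (μ, 1) := by
      funext y
      simp only [complexHopfCoord]
      split_ifs <;> simp [sub_eq_add_neg]
    rw [h, pd_const]
    rcases a with i | ⟨ν, s⟩
    · simp
    · simp only [Sum.elim_inr, map_add, map_smul, oddD_gen, Matrix.fromBlocks_apply₂₂,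
        conjJacobis_apply]
      by_cases hi : ν = μ
      · fin_cases s <;> fin_cases t <;> simp [conjJacobi, hi, scal_eq_smul_one]
      · simp [hi]

/-- The Jacobi matrix is constant and block diagonal, with determinant `-2i` for each complex
coordinate together with its conjugate. Even coordinates count in the numerator and odd ones in the
denominator. -/
theorem bracket_complexHopfCoord (x : HopfIx n → ℝ) :
    bracket (complexHopfCoord n m) x = scal ((-2 * Complex.I) ^ (n - m : ℤ)) := by
  have hI : (-2 * Complex.I : ℂ) ≠ 0 := by simp
  have hu : IsUnit (conjJacobis m).det := by rw [det_conjJacobis]; exact (pow_ne_zero _ hI).isUnit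
  have h11 : ((jacobi (complexHopfCoord n m)).map fun f => f x).toBlocks₁₁ =
      ((hopfConjJacobi n).map (escal m)).map (fun e => (e : Grass m)) := by
    ext i j : 1; exact pd_complexHopfCoord (Sum.inl i) (Sum.inl j) x
  have h12 : ((jacobi (complexHopfCoord n m)).map fun f => f x).toBlocks₁₂ = 0 := by
    ext i j : 1; exact (pd_complexHopfCoord (Sum.inl i) (Sum.inr j) x).trans scal_zero
  rw [bracket, ber_of_coe (D := (conjJacobis m).map (escal m)) (D' := (conjJacobis m)⁻¹.map (escal m))
    (S := (hopfConjJacobi n).map (escal m))]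
  · have h1 := (RingHom.map_det (escal m) (conjJacobis m)).symm
    have h2 := (RingHom.map_det (escal m) (hopfConjJacobi n)).symm
    rw [RingHom.mapMatrix_apply] at h1 h2
    rw [h1, h2, det_conjJacobis, det_hopfConjJacobi,
      ring_inverse_eq (y := escal m (((-2 * Complex.I) ^ m)⁻¹)) (by
        rw [← map_mul, mul_inv_cancel₀ (pow_ne_zero _ hI), map_one]), ← map_mul, coe_escal,
      zpow_sub₀ hI, zpow_natCast, zpow_natCast, div_eq_mul_inv]
  · ext i j : 1; exact pd_complexHopfCoord (Sum.inr i) (Sum.inr j) x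
  · rw [← Matrix.map_mul, Matrix.mul_nonsing_inv _ hu]
    exact Matrix.map_one _ (map_zero _) (map_one _)
  · rw [h12, Matrix.zero_mul, Matrix.zero_mul, sub_zero, h11]

/-- Since `(i/2)(-2i) = 1`, the power of `i/2` exactly undoes the passage from real to complex
coordinates. -/
theorem sphereVolumeElement_eq_bracket {R : ℝ} (hR : 0 < R) (k : Fin (n + 1)) (x : HopfIx n → ℝ) :
    sphereVolumeElement m R k x =
        ((R : ℂ) ^ (2 * n + 1 - 2 * m : ℤ) * (Complex.I / 2) ^ (n - m : ℤ)) •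
          (bracket (complexHopfCoord n m) x * superApply (fun t => t ^ (-(n - m + 1) : ℤ))
              (affineN k fun i => x (some i))) := by
  rw [sphereVolumeElement_eq hR, bracket_complexHopfCoord, scal_mul, smul_smul, mul_assoc, ← mul_zpow,
    show Complex.I / 2 * (-2 * Complex.I) = 1 by linear_combination -Complex.I_mul_I, one_zpow, mul_one]

end ComplexBracket

/-! ### Affine and Hopf coordinates of the underlying points -/

section ComplexPoints

variable {N n m : ℕ}

/-- The complex coordinates of a point. -/
def toCplx (z : CplxIx N → ℝ) (a : Fin N) : ℂ := ⟨z (a, 0), z (a, 1)⟩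

theorem toCplx_injective : Function.Injective (toCplx (N := N)) := by
  intro z z' h
  funext ⟨a, s⟩
  have ha := congrFun h a
  have h0 : z (a, 0) = z' (a, 0) := congrArg Complex.re ha
  have h1 : z (a, 1) = z' (a, 1) := congrArg Complex.im ha
  fin_cases s
  exacts [h0, h1]

theorem cmul_real_apply {ι : Type*} (c : ℂ) (z : ι × Fin 2 → ℝ) (p : ι × Fin 2) :
    cmul c z p = if p.2 = 0 then c.re * z (p.1, 0) - c.im * z (p.1, 1)
      else c.im * z (p.1, 0) + c.re * z (p.1, 1) := rfl

theorem toCplx_cmul (c : ℂ) (z : CplxIx N → ℝ) (a : Fin N) : toCplx (cmul c z) a = c * toCplx z a := by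
  apply Complex.ext <;> simp [toCplx, cmul_real_apply]
  ring

theorem cmul_cmul_real (c d : ℂ) (z : CplxIx N → ℝ) : cmul c (cmul d z) = cmul (c * d) z :=
  toCplx_injective (by funext a; simp only [toCplx_cmul, mul_assoc])

theorem one_cmul_real (z : CplxIx N → ℝ) : cmul 1 z = z :=
  toCplx_injective (by funext a; simp only [toCplx_cmul, one_mul])

theorem cmul_real_injective {c : ℂ} (hc : c ≠ 0) :
    Function.Injective (cmul c : (CplxIx N → ℝ) → CplxIx N → ℝ) := by
  intro z z' h
  rw [← one_cmul_real z, ← one_cmul_real z', ← inv_mul_cancel₀ hc, ← cmul_cmul_real, h, cmul_cmul_real]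

theorem cmul_ofReal (r : ℝ) (z : CplxIx N → ℝ) : cmul (r : ℂ) z = r • z := by
  funext ⟨a, s⟩
  fin_cases s <;> simp [cmul_real_apply]

theorem cmul_real_zero (c : ℂ) : cmul c (0 : CplxIx N → ℝ) = 0 := by
  funext ⟨a, s⟩
  fin_cases s <;> simp [cmul_real_apply]

theorem sum_sq_eq_sum_normSq (z : CplxIx N → ℝ) : ∑ e, z e ^ 2 = ∑ a, Complex.normSq (toCplx z a) := by
  rw [Fintype.sum_prod_type]
  refine Finset.sum_congr rfl fun a _ => ?_
  simp [toCplx, Complex.normSq_apply, pow_two]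

theorem sum_sq_cmul (c : ℂ) (z : CplxIx N → ℝ) :
    ∑ e, cmul c z e ^ 2 = Complex.normSq c * ∑ e, z e ^ 2 := by
  simp only [sum_sq_eq_sum_normSq, toCplx_cmul, map_mul, Finset.mul_sum]

/-- The point of `ℂ^{n+1}` with given affine coordinates. -/
def affinePt (k : Fin (n + 1)) (x : CplxIx n → ℝ) : CplxIx (n + 1) → ℝ := fun p =>
  k.insertNth (α := fun _ => ℝ) (if p.2 = 0 then 1 else 0) (fun b => x (b, p.2)) p.1

theorem affinePt_same (k : Fin (n + 1)) (x : CplxIx n → ℝ) (s : Fin 2) :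
    affinePt k x (k, s) = if s = 0 then 1 else 0 := by simp [affinePt]

theorem affinePt_succAbove (k : Fin (n + 1)) (x : CplxIx n → ℝ) (j : Fin n) (s : Fin 2) :
    affinePt k x (k.succAbove j, s) = x (j, s) := by simp [affinePt]

theorem toCplx_affinePt_same (k : Fin (n + 1)) (x : CplxIx n → ℝ) : toCplx (affinePt k x) k = 1 := by
  apply Complex.ext <;> simp [toCplx, affinePt_same]

theorem affinePt_injective (k : Fin (n + 1)) : Function.Injective (affinePt k) := by
  intro x y h
  funext ⟨j, s⟩
  rw [← affinePt_succAbove k x, ← affinePt_succAbove k y, h]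

theorem sum_sq_affinePt (k : Fin (n + 1)) (x : CplxIx n → ℝ) : ∑ e, affinePt k x e ^ 2 = bodyN x := by
  rw [sum_cplxIx_succAbove k]
  simp [affinePt_same, affinePt_succAbove, bodyN]

theorem affineCoord_inl (k : Fin (n + 1)) (e : CplxIx (n + 1)) (x : CplxIx n → ℝ) :
    affineCoord (m := m) k (Sum.inl e) x = scal (affinePt k x e : ℂ) := by
  obtain ⟨p, s⟩ := e
  refine Fin.succAboveCases (α := fun p => affineCoord (m := m) k (Sum.inl (p, s)) x =
    scal (affinePt k x (p, s) : ℂ)) k ?_ ?_ p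
  · rw [affineCoord_inl_same, affinePt_same]
    split_ifs <;> simp
  · intro j
    rw [affineCoord_inl_succAbove, affinePt_succAbove]

/-- The affine coordinates of a point with nonvanishing `k`th component. -/
def affineOf (k : Fin (n + 1)) (z : CplxIx (n + 1) → ℝ) : CplxIx n → ℝ :=
  fun i => cmul (toCplx z k)⁻¹ z (k.succAbove i.1, i.2)

theorem eq_affinePt_of_toCplx_eq_one {k : Fin (n + 1)} {z : CplxIx (n + 1) → ℝ} (h : toCplx z k = 1) :
    affinePt k (fun i => z (k.succAbove i.1, i.2)) = z := by
  have h0 : z (k, 0) = 1 := (congrArg Complex.re h).trans Complex.one_re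
  have h1 : z (k, 1) = 0 := (congrArg Complex.im h).trans Complex.one_im
  funext ⟨p, s⟩
  refine Fin.succAboveCases (α := fun p => affinePt k (fun i => z (k.succAbove i.1, i.2)) (p, s) = z (p, s))
    k ?_ ?_ p
  · rw [affinePt_same]
    fin_cases s
    · simpa using h0.symm
    · simpa using h1.symm
  · intro j; rw [affinePt_succAbove]

theorem affinePt_affineOf {k : Fin (n + 1)} {z : CplxIx (n + 1) → ℝ} (h : toCplx z k ≠ 0) :
    affinePt k (affineOf k z) = cmul (toCplx z k)⁻¹ z :=
  eq_affinePt_of_toCplx_eq_one (by rw [toCplx_cmul, inv_mul_cancel₀ h])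

theorem cmul_affinePt_affineOf {k : Fin (n + 1)} {z : CplxIx (n + 1) → ℝ} (h : toCplx z k ≠ 0) :
    cmul (toCplx z k) (affinePt k (affineOf k z)) = z := by
  rw [affinePt_affineOf h, cmul_cmul_real, mul_inv_cancel₀ h, one_cmul_real]

theorem bodyN_affineOf {k : Fin (n + 1)} {z : CplxIx (n + 1) → ℝ} (h : toCplx z k ≠ 0) :
    bodyN (affineOf k z) = (∑ e, z e ^ 2) / ‖toCplx z k‖ ^ 2 := by
  rw [← sum_sq_affinePt k, affinePt_affineOf h, sum_sq_cmul, map_inv₀, Complex.normSq_eq_norm_sq]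
  ring

theorem exists_toCplx_ne_zero {z : CplxIx N → ℝ} (hz : z ≠ 0) : ∃ k, toCplx z k ≠ 0 := by
  by_contra! h
  refine hz (toCplx_injective ?_)
  funext a
  rw [h a]
  rfl

theorem rbody_scal (r : ℝ) : rbody (scal (m := m) (r : ℂ)) = r := by simp [rbody]

theorem rbody_rsqrtN_mul_superCmul (k : Fin (n + 1)) (x : CplxIx n → ℝ) (c : ℂ)
    (V : AmbIx n m → Grass m) (p : CplxIx (n + 1)) :
    rbody (rsqrtN k x * superCmul c V (Sum.inl p)) =
      bodyN x ^ (-(1 / 2) : ℝ) * cmul c (fun p => rbody (V (Sum.inl p))) p := by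
  rw [rbody, body_mul, body_rsqrtN, Complex.re_ofReal_mul, superCmul_inl, cmul_real_apply]
  congr 1
  split_ifs <;> simp [rbody, -Complex.coe_smul]

theorem rbody_hopfCoord (R : ℝ) (k : Fin (n + 1)) (x : HopfIx n → ℝ) (p : CplxIx (n + 1)) :
    rbody (hopfCoord (m := m) R k (Sum.inl p) x) = bodyN (fun i => x (some i)) ^ (-(1 / 2) : ℝ) *
      cmul (phase R (x none)) (affinePt k fun i => x (some i)) p := by
  rw [hopfCoord_apply, rbody_rsqrtN_mul_superCmul]
  simp only [affineCoord_inl, rbody_scal]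

theorem bodyPt_hopfChart (R : ℝ) (c : Fin (n + 1) × ℝ) (x : HopfIx n → ℝ) :
    (hopfChart m R c).bodyPt x = cmul (((bodyN (fun i => x (some i)) ^ (-(1 / 2) : ℝ) : ℝ) : ℂ) *
      phase R (x none)) (affinePt c.1 fun i => x (some i)) := by
  rw [← cmul_cmul_real, cmul_ofReal]
  funext p
  exact rbody_hopfCoord R c.1 x p

theorem phase_ne_zero {R : ℝ} (hR : 0 < R) (α : ℝ) : phase R α ≠ 0 :=
  mul_ne_zero (by exact_mod_cast hR.ne') (Complex.exp_ne_zero _)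

theorem norm_phase {R : ℝ} (hR : 0 < R) (α : ℝ) : ‖phase R α‖ = R := by
  rw [phase, norm_mul, mul_comm Complex.I, Complex.norm_exp_ofReal_mul_I, mul_one, Complex.norm_real,
    Real.norm_of_nonneg hR.le]

theorem phase_injOn {R : ℝ} (hR : 0 < R) (c : ℝ) :
    Set.InjOn (phase R) (Set.Ioo c (c + 2 * Real.pi)) := by
  intro α hα β hβ h
  have h' := mul_left_cancel₀ (by exact_mod_cast hR.ne') h
  obtain ⟨j, hj⟩ := Complex.exp_eq_exp_iff_exists_int.1 h'
  have hj' : α = β + j * (2 * Real.pi) := by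
    have := mul_left_cancel₀ Complex.I_ne_zero
      (hj.trans (show _ = Complex.I * ((β + j * (2 * Real.pi) : ℝ) : ℂ) by push_cast; ring))
    exact_mod_cast this
  have hpi := Real.pi_pos
  have h1 : (j : ℝ) < 1 := by nlinarith [hα.1, hα.2, hβ.1, hβ.2]
  have h2 : (-1 : ℝ) < j := by nlinarith [hα.1, hα.2, hβ.1, hβ.2]
  have : j = 0 := by
    have h1' : j < 1 := by exact_mod_cast h1
    have h2' : -1 < j := by exact_mod_cast h2
    omega
  simpa [this] using hj'

end ComplexPoints

/-! ### The Hopf charts form an atlas -/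

section SphereAtlas

variable {n m : ℕ}

theorem isRealElt_affineCoord (k : Fin (n + 1)) (e : AmbIx n m) (x : CplxIx n → ℝ) :
    IsRealElt (affineCoord k e x) := by
  rcases e with e | κ
  · rw [affineCoord_inl]; exact isRealElt_scal _
  · exact isRealElt_gen κ

theorem isRealElt_superCmul {V : AmbIx n m → Grass m} (hV : ∀ e, IsRealElt (V e)) (c : ℂ) (e : AmbIx n m) :
    IsRealElt (superCmul c V e) := by
  rw [superCmul_apply]
  exact ((hV _).smul _).add ((hV _).smul _)

theorem isRealElt_affineN (k : Fin (n + 1)) (x : CplxIx n → ℝ) : IsRealElt (affineN (m := m) k x) := by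
  rw [affineN_eq]
  refine (isRealElt_scal _).add ?_
  have := (IsRealElt.sum (s := Finset.univ) fun (μ : Fin m) _ =>
    (isRealElt_gen (m := m) (μ, 0)).mul (isRealElt_gen (μ, 1))).smul 2
  simpa [nilN, -Complex.coe_smul] using this

theorem isEvenElt_superCmul_affine (k : Fin (n + 1)) (x : CplxIx n → ℝ) (c : ℂ) (p : CplxIx (n + 1)) :
    IsEvenElt (superCmul c (fun e => affineCoord (m := m) k e x) (Sum.inl p)) := by
  rw [superCmul_apply]
  exact IsEvenElt.add (IsEvenElt.smul (isEvenElt_scal _) _) (IsEvenElt.smul (isEvenElt_scal _) _)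

theorem isOddElt_superCmul_affine (k : Fin (n + 1)) (x : CplxIx n → ℝ) (c : ℂ) (κ : OddIx m) :
    IsOddElt (superCmul c (fun e => affineCoord (n := n) k e x) (Sum.inr κ)) := by
  rw [superCmul_apply]
  exact IsOddElt.add (IsOddElt.smul (isOddElt_gen _) _) (IsOddElt.smul (isOddElt_gen _) _)

theorem isEvenElt_hopfCoord (R : ℝ) (k : Fin (n + 1)) (x : HopfIx n → ℝ) (p : CplxIx (n + 1)) :
    IsEvenElt (hopfCoord (m := m) R k (Sum.inl p) x) :=
  (isEvenElt_rsqrtN k _).mul (isEvenElt_superCmul_affine k _ _ p)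

theorem isOddElt_hopfCoord (R : ℝ) (k : Fin (n + 1)) (x : HopfIx n → ℝ) (κ : OddIx m) :
    IsOddElt (hopfCoord (n := n) R k (Sum.inr κ) x) :=
  (isEvenElt_rsqrtN k _).mul_odd (isOddElt_superCmul_affine k _ _ κ)

theorem odd_mul_self {a : Grass m} (ha : IsOddElt a) : a * a = 0 := by
  exact congrArg Subtype.val (oddMul_self ⟨a, ha⟩)

theorem normSq_hopfCoord {R : ℝ} (k : Fin (n + 1)) (x : HopfIx n → ℝ) :
    normSq (hopfCoord (m := m) R k) x = scal ((R : ℂ) ^ 2) := by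
  rw [normSq_apply]
  · simp only [hopfCoord_apply]
    have hcomm : ∀ (V : AmbIx n m → Grass m), (fun e => rsqrtN k (fun i => x (some i)) * V e) =
        fun e => V e * rsqrtN k (fun i => x (some i)) := by
      intro V; funext e; exact (isEvenElt_rsqrtN k _).commute _
    have h1 := signOdd_mul_left (Sum.inl () : Unit ⊕ OddIx m) (rsqrtN k fun i => x (some i))
      (superCmul (phase R (x none)) fun e' => affineCoord k e' fun i => x (some i))
    have h2 := signOdd_superCmul (Sum.inl () : Unit ⊕ OddIx m) (phase R (x none))
      fun e' => affineCoord k e' fun i => x (some i)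
    simp only [signOdd, Sum.elim_inl] at h1 h2
    rw [h1, h2, hcomm (superCmul _ (flipOdd _)), pairG_mul_right, pairG_mul_left,
      pairG_superCmul, phase_normSq, ((isEvenElt_rsqrtN k _).commute _).eq.symm, ← mul_assoc,
      rsqrtN_mul_self, mul_smul_comm, pairG_affine_flipOdd, ← affineN_eq k, ← coe_powN_one k,
      ← coe_mul_even, powN_neg_one_mul_one, scal_eq_smul_one]
    push_cast
    rfl
  · exact fun c => (isEvenElt_hopfCoord R k x _).commute _
  · exact fun μ => odd_mul_odd (isOddElt_hopfCoord R k x _) (isOddElt_hopfCoord R k x _)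
  · exact fun κ => odd_mul_self (isOddElt_hopfCoord R k x κ)

/-- Everything is recovered from the `k`th component, where `w^k = 1`: its modulus determines the
scale factor and its argument the angle; division by it then gives `w`. -/
theorem injOn_bodyPt_hopfChart {R : ℝ} (hR : 0 < R) (c : Fin (n + 1) × ℝ) :
    Set.InjOn (hopfChart (n := n) m R c).bodyPt (hopfChart m R c).dom := by
  intro x hx y hy h
  rw [bodyPt_hopfChart, bodyPt_hopfChart] at h
  set s := bodyN (fun i => x (some i)) ^ (-(1 / 2) : ℝ) with hs
  set t := bodyN (fun i => y (some i)) ^ (-(1 / 2) : ℝ) with ht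
  have hs0 : 0 < s := Real.rpow_pos_of_pos (bodyN_pos _) _
  have ht0 : 0 < t := Real.rpow_pos_of_pos (bodyN_pos _) _
  have hk := congrArg (fun z => toCplx z c.1) h
  simp only [toCplx_cmul, toCplx_affinePt_same, mul_one] at hk
  have hst : s = t := by
    have := congrArg norm hk
    rw [norm_mul, norm_mul, norm_phase hR, norm_phase hR, Complex.norm_real, Complex.norm_real,
      Real.norm_of_nonneg hs0.le, Real.norm_of_nonneg ht0.le] at this
    exact mul_right_cancel₀ hR.ne' this
  have hsC : (s : ℂ) ≠ 0 := by exact_mod_cast hs0.ne'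
  rw [hst] at hk
  have hα := phase_injOn hR c.2 hx hy (mul_left_cancel₀ (by exact_mod_cast ht0.ne') hk)
  rw [hst, hα] at h
  have hw := affinePt_injective c.1
    (cmul_real_injective (mul_ne_zero (by exact_mod_cast ht0.ne') (phase_ne_zero hR _)) h)
  funext i
  rcases i with _ | i
  exacts [hα, congrFun hw i]

theorem rbody_hopfRow (k : Fin (n + 1)) (x : CplxIx n → ℝ) (i : CplxIx n) (p : CplxIx (n + 1)) :
    rbody (hopfRow (m := m) k x (Sum.inl i) (Sum.inl p)) =
      (if (k.succAbove i.1, i.2) = p then 1 else 0) - (bodyN x)⁻¹ * x i * affinePt k x p := by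
  have : hopfRow (m := m) k x (Sum.inl i) (Sum.inl p) = affineRow k (Sum.inl i) (Sum.inl p) -
    ((powN k x (-1) : EvenGrass m) : Grass m) * halfDN x (Sum.inl i) * affineCoord k (Sum.inl p) x := rfl
  rw [this, affineCoord_inl, halfDN_inl, rbody, body_sub, body_mul, body_mul, body_coe_powN, body_scal,
    body_scal]
  simp only [affineRow, Sum.map_inl, Sum.inl.injEq]
  split_ifs <;> simp [← Complex.ofReal_mul]

theorem linearIndependent_hopfRows (k : Fin (n + 1)) (x : CplxIx n → ℝ) :
    LinearIndependent ℝ fun (i : HopfIx n) (p : CplxIx (n + 1)) =>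
      rbody (hopfRows (m := m) k x (Sum.inl i) (Sum.inl p)) := by
  rw [Fintype.linearIndependent_iff]
  intro g hg
  have hp : ∀ p : CplxIx (n + 1), g none * rbody (affineJ (m := m) k x (Sum.inl p)) +
      ∑ i, g (some i) * ((if (k.succAbove i.1, i.2) = p then 1 else 0) -
        (bodyN x)⁻¹ * x i * affinePt k x p) = 0 := by
    intro p
    have := congrFun hg p
    simpa [Finset.sum_apply, Fintype.sum_option, hopfRows, rbody_hopfRow] using this
  -- The imaginary part of the `k`th component is nonzero only in the row `Jw` of the angle.
  have h0 : g none = 0 := by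
    have := hp (k, 1)
    simpa [affineJ_inl_same, affinePt_same, rbody, Fin.succAbove_ne] using this
  -- The real part of the `k`th component sees only the radial corrections, which therefore cancel.
  -- The other components then read off the coefficients.
  have h1 : ∑ i, g (some i) * ((bodyN x)⁻¹ * x i) = 0 := by
    have := hp (k, 0)
    simpa [h0, affinePt_same, Fin.succAbove_ne] using this
  intro i
  rcases i with _ | j
  · exact h0
  · have := hp (k.succAbove j.1, j.2)
    rw [h0, zero_mul, zero_add, affinePt_succAbove] at this
    simp only [mul_sub, Finset.sum_sub_distrib, ← mul_assoc] at this
    simp only [← mul_assoc] at h1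
    rw [← Finset.sum_mul, h1, zero_mul, sub_zero] at this
    rw [← this, Finset.sum_eq_single j]
    · simp
    · intro i _ hi
      have : ¬ ((k.succAbove i.1, i.2) = (k.succAbove j.1, j.2)) := fun h => hi (by
        simpa [Prod.ext_iff] using h)
      simp [this]
    · simp

/-- The common factor of the rows is an invertible linear map, so independence reduces to that of
`hopfRows`. -/
theorem immersion_hopfCoord {R : ℝ} (hR : 0 < R) (k : Fin (n + 1)) (x : HopfIx n → ℝ) :
    LinearIndependent ℝ fun (i : HopfIx n) (p : CplxIx (n + 1)) =>
      rbody (jacobi (hopfCoord (m := m) R k) (Sum.inl i) (Sum.inl p) x) := by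
  have hs : bodyN (fun i => x (some i)) ^ (-(1 / 2) : ℝ) ≠ 0 := (Real.rpow_pos_of_pos (bodyN_pos _) _).ne'
  set s := bodyN (fun i => x (some i)) ^ (-(1 / 2) : ℝ) with hsdef
  let T : (CplxIx (n + 1) → ℝ) →ₗ[ℝ] CplxIx (n + 1) → ℝ :=
    { toFun := fun v => s • cmul (phase R (x none)) v
      map_add' := fun v w => by
        funext p
        simp only [Pi.smul_apply, Pi.add_apply, cmul_real_apply, smul_eq_mul]
        split_ifs <;> ring
      map_smul' := fun r v => by
        funext p
        simp only [Pi.smul_apply, cmul_real_apply, smul_eq_mul, RingHom.id_apply]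
        split_ifs <;> ring }
  have hT : LinearMap.ker T = ⊥ := LinearMap.ker_eq_bot.2 fun v w h =>
    cmul_real_injective (phase_ne_zero hR _) (smul_right_injective _ hs h)
  have h := (linearIndependent_hopfRows (m := m) k fun i => x (some i)).map' T hT
  have heq : (fun (i : HopfIx n) (p : CplxIx (n + 1)) =>
      rbody (jacobi (hopfCoord (m := m) R k) (Sum.inl i) (Sum.inl p) x)) = T ∘ fun i p =>
      rbody (hopfRows (m := m) k (fun i => x (some i)) (Sum.inl i) (Sum.inl p)) := by
    funext i p
    change rbody (pd (Sum.inl i) (hopfCoord R k (Sum.inl p)) x) = _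
    rw [pd_hopfCoord, rbody_rsqrtN_mul_superCmul]
    rfl
  rw [heq]
  exact h

/-- The radial correction is a product of two odd factors and has no body. What remains is a
rotation and dilation for each odd pair, with positive determinant. -/
theorem odd_pos_hopfCoord {R : ℝ} (hR : 0 < R) (k : Fin (n + 1)) (x : HopfIx n → ℝ) :
    0 < (Matrix.of fun κ κ' : OddIx m =>
      rbody (jacobi (hopfCoord (n := n) R k) (Sum.inr κ) (Sum.inr κ') x)).det := by
  set s := bodyN (fun i => x (some i)) ^ (-(1 / 2) : ℝ) with hs
  have hs0 : 0 < s := Real.rpow_pos_of_pos (bodyN_pos _) _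
  set c := phase R (x none) with hc
  have hb : ∀ κ κ' : OddIx m, body (hopfRow k (fun i => x (some i)) (Sum.inr κ) (Sum.inr κ')) =
      if κ = κ' then 1 else 0 := by
    intro κ κ'
    simp only [hopfRow, Pi.sub_apply, body_sub, affineRow, Sum.map_inr, id, Sum.inr.injEq,
      affineCoord_inr, body_mul, body_gen, mul_zero, sub_zero]
    split_ifs <;> simp
  have : (Matrix.of fun κ κ' : OddIx m =>
      rbody (jacobi (hopfCoord (n := n) R k) (Sum.inr κ) (Sum.inr κ') x)) =
      Matrix.kroneckerMap (· * ·) (1 : Matrix (Fin m) (Fin m) ℝ)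
        !![s * c.re, s * c.im; -(s * c.im), s * c.re] := by
    ext ⟨μ, t⟩ ⟨ν, t'⟩
    change rbody (pd (Sum.inr (μ, t)) (hopfCoord R k (Sum.inr (ν, t'))) x) = _
    rw [pd_hopfCoord, rbody, body_mul, body_rsqrtN, Complex.re_ofReal_mul, superCmul_inr,
      Matrix.kroneckerMap_apply, ← hs, ← hc]
    simp only [hopfRows]
    by_cases h : μ = ν
    · subst h
      fin_cases t <;> fin_cases t' <;> simp [hb, -Complex.coe_smul]
    · fin_cases t <;> fin_cases t' <;> simp [h, hb, -Complex.coe_smul]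
  rw [this, Matrix.det_kronecker, Matrix.det_one, one_pow, one_mul, Matrix.det_fin_two_of]
  refine pow_pos ?_ _
  have := phase_normSq R (x none)
  rw [show s * c.re * (s * c.re) - s * c.im * -(s * c.im) = s ^ 2 * R ^ 2 by
    rw [← this]; ring]
  positivity

theorem isSphereChart_hopfChart {R : ℝ} (hR : 0 < R) (c : Fin (n + 1) × ℝ) :
    IsSphereChart R (hopfChart (n := n) m R c) where
  dim := by simp [mul_comm]
  isOpen := isOpen_Ioo.preimage (continuous_apply none)
  smooth e A := (smoothOn_hopfCoord R c.1 e A).mono (Set.subset_univ _)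
  real e x _ := ((isRealElt_affineN c.1 _).superApply _).mul
    (isRealElt_superCmul (fun e => isRealElt_affineCoord c.1 e _) _ e)
  even p x _ := isEvenElt_hopfCoord R c.1 x p
  odd κ x _ := isOddElt_hopfCoord R c.1 x κ
  equation x _ := normSq_hopfCoord c.1 x
  injOn := injOn_bodyPt_hopfChart hR c
  immersion x _ := immersion_hopfCoord hR c.1 x
  odd_pos x _ := odd_pos_hopfCoord hR c.1 x

/-- The Hopf coordinates of a point, for a given choice of the argument. -/
def hopfOf (k : Fin (n + 1)) (α : ℝ) (z : CplxIx (n + 1) → ℝ) : HopfIx n → ℝ :=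
  fun i => Option.elim i α (affineOf k z)

theorem bodyPt_hopfOf {R : ℝ} (hR : 0 < R) (k : Fin (n + 1)) (c α : ℝ) {z : CplxIx (n + 1) → ℝ}
    (hz : ∑ e, z e ^ 2 = R ^ 2) (hk : toCplx z k ≠ 0)
    (hα : toCplx z k = ‖toCplx z k‖ * Complex.exp (Complex.I * (α : ℂ))) :
    (hopfChart m R (k, c)).bodyPt (hopfOf k α z) = z := by
  rw [bodyPt_hopfChart]
  change cmul (((bodyN (affineOf k z) ^ (-(1 / 2) : ℝ) : ℝ) : ℂ) * phase R α) (affinePt k (affineOf k z)) = z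
  have hn : 0 < ‖toCplx z k‖ := norm_pos_iff.2 hk
  have hb : bodyN (affineOf k z) ^ (-(1 / 2) : ℝ) = ‖toCplx z k‖ / R := by
    rw [bodyN_affineOf hk, hz, ← div_pow, Real.rpow_neg (by positivity), ← Real.sqrt_eq_rpow,
      Real.sqrt_sq (by positivity), inv_div]
  have : ((bodyN (affineOf k z) ^ (-(1 / 2) : ℝ) : ℝ) : ℂ) * phase R α = toCplx z k := by
    rw [hb]
    nth_rewrite 2 [hα]
    rw [phase]
    push_cast
    have : (R : ℂ) ≠ 0 := by exact_mod_cast hR.ne'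
    field_simp
  rw [this, cmul_affinePt_affineOf hk]

theorem isSphereAtlas_hopfChart {R : ℝ} (hR : 0 < R) :
    IsSphereAtlas R (hopfChart (n := n) m R) := by
  refine ⟨isSphereChart_hopfChart hR, fun z hz => ?_⟩
  have hz0 : z ≠ 0 := by
    rintro rfl
    have : (0 : ℝ) = R ^ 2 := by simpa using hz
    exact (pow_pos hR 2).ne this
  obtain ⟨k, hk⟩ := exists_toCplx_ne_zero hz0
  -- The interval of the angle is centred at the argument of the `k`th component.
  refine ⟨(k, Complex.arg (toCplx z k) - Real.pi), hopfOf k (Complex.arg (toCplx z k)) z, ?_,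
    bodyPt_hopfOf hR k _ _ hz hk ?_⟩
  · change Complex.arg _ ∈ Set.Ioo _ _
    constructor <;> linarith [Real.pi_pos]
  · rw [mul_comm Complex.I, Complex.norm_mul_exp_arg_mul_I]

end SphereAtlas

/-! ### Integration over an annulus in Hopf coordinates -/

section PolarFubini

open MeasureTheory

variable {n : ℕ}

/-- The point of `ℂ^{n+1}` with a given `k`th component and given other components. -/
def joinPt (k : Fin (n + 1)) (c : ℂ) (v : CplxIx n → ℝ) : CplxIx (n + 1) → ℝ := fun p =>
  k.insertNth (α := fun _ => ℝ) (if p.2 = 0 then c.re else c.im) (fun b => v (b, p.2)) p.1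

theorem joinPt_cmul (k : Fin (n + 1)) (c : ℂ) (w : CplxIx n → ℝ) :
    joinPt k c (cmul c w) = cmul c (affinePt k w) := by
  funext ⟨p, s⟩
  refine Fin.succAboveCases (α := fun p => joinPt k c (cmul c w) (p, s) = cmul c (affinePt k w) (p, s))
    k ?_ ?_ p
  · fin_cases s <;> simp [joinPt, cmul_real_apply, affinePt_same]
  · intro j
    fin_cases s <;> simp [joinPt, cmul_real_apply, affinePt_succAbove]

/-- Splitting off the `k`th complex coordinate. -/
def splitIx (k : Fin (n + 1)) : Fin 2 ⊕ CplxIx n ≃ CplxIx (n + 1) :=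
  (((finSuccEquiv' k).prodCongr (Equiv.refl (Fin 2))).trans optionProdEquiv).symm

theorem measurePreserving_joinPt (k : Fin (n + 1)) :
    MeasurePreserving (fun q : ℂ × (CplxIx n → ℝ) => joinPt k q.1 q.2) := by
  have h1 : MeasurePreserving (Prod.map Complex.measurableEquivPi (id : (CplxIx n → ℝ) → _)) :=
    Complex.volume_preserving_equiv_pi.prod (MeasurePreserving.id _)
  have h2 := volume_measurePreserving_sumPiEquivProdPi_symm (fun _ : Fin 2 ⊕ CplxIx n => ℝ)
  have h3 := volume_preserving_arrowCongr' (splitIx k) (MeasurableEquiv.refl ℝ) (MeasurePreserving.id _)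
  convert h3.comp (h2.comp h1) using 1
  funext ⟨c, v⟩ ⟨p, s⟩
  simp only [Function.comp]
  change _ = (MeasurableEquiv.sumPiEquivProdPi fun _ : Fin 2 ⊕ CplxIx n => ℝ).symm
    (Complex.measurableEquivPi c, v) ((splitIx k).symm (p, s))
  refine Fin.succAboveCases (α := fun p => joinPt k c v (p, s) =
    (MeasurableEquiv.sumPiEquivProdPi fun _ : Fin 2 ⊕ CplxIx n => ℝ).symm
    (Complex.measurableEquivPi c, v) ((splitIx k).symm (p, s))) k ?_ ?_ p
  · have : (splitIx k).symm (k, s) = Sum.inl s := by simp [splitIx, optionProdEquiv]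
    rw [this]
    change _ = Complex.measurableEquivPi c s
    fin_cases s <;> simp [joinPt]
  · intro j
    have : (splitIx k).symm (k.succAbove j, s) = Sum.inr (j, s) := by simp [splitIx, optionProdEquiv]
    rw [this]
    change _ = v (j, s)
    simp [joinPt]

/-- The matrix of the multiplication by a complex number. -/
def cmulMatrix (n : ℕ) (c : ℂ) : Matrix (CplxIx n) (CplxIx n) ℝ :=
  Matrix.kroneckerMap (· * ·) 1 !![c.re, -c.im; c.im, c.re]

theorem toLin_cmulMatrix (c : ℂ) (w : CplxIx n → ℝ) : Matrix.toLin' (cmulMatrix n c) w = cmul c w := by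
  funext ⟨p, s⟩
  rw [Matrix.toLin'_apply, Matrix.mulVec, dotProduct, Fintype.sum_prod_type]
  fin_cases s <;>
    simp [cmulMatrix, Matrix.one_apply, cmul_real_apply, sub_eq_add_neg]

theorem det_cmulMatrix (c : ℂ) : (cmulMatrix n c).det = ‖c‖ ^ (2 * n) := by
  rw [cmulMatrix, Matrix.det_kronecker, Matrix.det_one, one_pow, one_mul, Fintype.card_fin,
    Matrix.det_fin_two_of, pow_mul, ← Complex.normSq_eq_norm_sq, Complex.normSq_apply]
  congr 1; ring

/-- Multiplication by `c` on `ℂ^n` has real determinant `|c|^{2n}`. -/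
theorem lintegral_eq_mul_lintegral_cmul {c : ℂ} (hc : c ≠ 0) {F : (CplxIx n → ℝ) → ENNReal}
    (hF : Measurable F) :
    ∫⁻ v, F v = ENNReal.ofReal (‖c‖ ^ (2 * n)) * ∫⁻ w, F (cmul c w) := by
  have hpos : 0 < ‖c‖ ^ (2 * n) := pow_pos (norm_pos_iff.2 hc) _
  have hdet : (cmulMatrix n c).det ≠ 0 := by rw [det_cmulMatrix]; exact hpos.ne'
  have hm : Measurable (Matrix.toLin' (cmulMatrix n c)) :=
    (LinearMap.continuous_of_finiteDimensional _).measurable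
  have h := lintegral_map (μ := volume) hF hm
  rw [Real.map_matrix_volume_pi_eq_smul_volume_pi hdet, lintegral_smul_measure] at h
  simp only [toLin_cmulMatrix] at h
  rw [← h, det_cmulMatrix, smul_eq_mul, ← mul_assoc, ← ENNReal.ofReal_mul hpos.le, abs_of_pos (by positivity),
    mul_inv_cancel₀ hpos.ne', ENNReal.ofReal_one, one_mul]

theorem continuous_affinePt (k : Fin (n + 1)) : Continuous (affinePt (n := n) k) := by
  refine continuous_pi fun ⟨p, s⟩ => ?_
  refine Fin.succAboveCases (α := fun p => Continuous fun x => affinePt k x (p, s)) k ?_ ?_ p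
  · simp only [affinePt_same]; exact continuous_const
  · intro j; simp only [affinePt_succAbove]; exact continuous_apply _

theorem continuous_cmul_uncurry {N : ℕ} :
    Continuous fun q : ℂ × (CplxIx N → ℝ) => cmul q.1 q.2 := by
  refine continuous_pi fun ⟨p, s⟩ => ?_
  simp only [cmul_real_apply]
  fin_cases s
  · simp only [Fin.zero_eta, if_true]
    fun_prop
  · simp only [Fin.mk_one, one_ne_zero, if_false]
    fun_prop

theorem continuous_phase (R : ℝ) : Continuous (phase R) := by unfold phase; fun_prop

theorem continuous_hopfPoint (k : Fin (n + 1)) :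
    Continuous fun q : ℝ × (CplxIx n → ℝ) => cmul (phase 1 q.1) (affinePt k q.2) :=
  continuous_cmul_uncurry.comp
    (((continuous_phase 1).comp continuous_fst).prodMk ((continuous_affinePt k).comp continuous_snd))

theorem affinePt_ne_zero (k : Fin (n + 1)) (w : CplxIx n → ℝ) : affinePt k w ≠ 0 := by
  intro h
  have := toCplx_affinePt_same k w
  rw [h] at this
  exact zero_ne_one this

theorem cmul_ne_zero {N : ℕ} {c : ℂ} (hc : c ≠ 0) {z : CplxIx N → ℝ} (hz : z ≠ 0) : cmul c z ≠ 0 := by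
  intro h
  exact hz (cmul_real_injective hc (h.trans (cmul_real_zero c).symm))

theorem hopfPoint_ne_zero (k : Fin (n + 1)) (α : ℝ) (w : CplxIx n → ℝ) :
    cmul (phase 1 α) (affinePt k w) ≠ 0 := cmul_ne_zero (phase_ne_zero one_pos α) (affinePt_ne_zero k w)

/-- The annulus `1 ≤ |z| ≤ e`. -/
def annulus (N : ℕ) : Set (CplxIx N → ℝ) := {z | 1 ≤ ∑ e, z e ^ 2 ∧ ∑ e, z e ^ 2 ≤ Real.exp 2}

theorem isClosed_annulus (N : ℕ) : IsClosed (annulus N) := by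
  have hc : Continuous fun z : CplxIx N → ℝ => ∑ e, z e ^ 2 := by fun_prop
  exact (isClosed_le continuous_const hc).inter (isClosed_le hc continuous_const)

theorem isCompact_annulus (N : ℕ) : IsCompact (annulus N) := by
  refine Metric.isCompact_of_isClosed_isBounded (isClosed_annulus N)
    -- The ball refers to the supremum norm, which the Euclidean norm, at most `e` on the annulus,
    -- dominates.
    ((Metric.isBounded_closedBall (x := 0) (r := Real.exp 1)).subset fun z hz => ?_)
  rw [mem_closedBall_zero_iff, pi_norm_le_iff_of_nonneg (Real.exp_pos _).le]
  intro e
  rw [Real.norm_eq_abs]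
  refine abs_le_of_sq_le_sq ?_ (Real.exp_pos _).le
  calc z e ^ 2 ≤ ∑ e, z e ^ 2 := Finset.single_le_sum (fun _ _ => sq_nonneg _) (Finset.mem_univ e)
    _ ≤ Real.exp 2 := hz.2
    _ = Real.exp 1 ^ 2 := by rw [← Real.exp_nat_mul]; norm_num

theorem ne_zero_of_mem_annulus {N : ℕ} {z : CplxIx N → ℝ} (hz : z ∈ annulus N) : z ≠ 0 := by
  rintro rfl
  have := hz.1
  norm_num at this

/-- The condition on `t` describes the interval from `b^{-1/2}` to `e b^{-1/2}`, on which `dt/t` has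
integral `log e = 1` whatever `b` is. The outer radius `e` is chosen for this reason. -/
theorem lintegral_inv_annulus {b : ℝ} (hb : 0 < b) :
    ∫⁻ t in Set.Ioi (0 : ℝ), ENNReal.ofReal t⁻¹ *
      (if 1 ≤ t ^ 2 * b ∧ t ^ 2 * b ≤ Real.exp 2 then 1 else 0) = 1 := by
  set r := (Real.sqrt b)⁻¹ with hr
  have hr0 : 0 < r := by positivity
  have hrb : r ^ 2 * b = 1 := by
    rw [hr, inv_pow, Real.sq_sqrt hb.le, inv_mul_cancel₀ hb.ne']
  have hle : r ≤ Real.exp 1 * r := by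
    have := Real.one_le_exp (zero_le_one (α := ℝ))
    nlinarith
  have hset : ∀ t ∈ Set.Ioi (0 : ℝ), ENNReal.ofReal t⁻¹ *
      (if 1 ≤ t ^ 2 * b ∧ t ^ 2 * b ≤ Real.exp 2 then 1 else 0) =
      (Set.Icc r (Real.exp 1 * r)).indicator (fun t => ENNReal.ofReal t⁻¹) t := by
    intro t ht
    have ht0 : 0 < t := ht
    have h1 : 1 ≤ t ^ 2 * b ↔ r ≤ t := by
      rw [← hrb, mul_le_mul_iff_left₀ hb, sq_le_sq₀ hr0.le ht0.le]
    have h2 : t ^ 2 * b ≤ Real.exp 2 ↔ t ≤ Real.exp 1 * r := by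
      have : Real.exp 2 = (Real.exp 1 * r) ^ 2 * b := by
        rw [mul_pow, mul_assoc, hrb, ← Real.exp_nat_mul]; norm_num
      rw [this, mul_le_mul_iff_left₀ hb, sq_le_sq₀ ht0.le (by positivity)]
    rw [if_congr (and_congr h1 h2) rfl rfl, Set.indicator_apply]
    simp [Set.mem_Icc]
  have hsub : Set.Icc r (Real.exp 1 * r) ⊆ Set.Ioi 0 := fun t ht => Set.mem_Ioi.2 (hr0.trans_le ht.1)
  rw [setLIntegral_congr_fun measurableSet_Ioi hset, setLIntegral_indicator measurableSet_Icc,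
    Set.inter_eq_left.2 hsub]
  have hint : IntegrableOn (fun t : ℝ => t⁻¹) (Set.Icc r (Real.exp 1 * r)) :=
    ContinuousOn.integrableOn_Icc (continuousOn_inv₀.mono fun t ht => (hr0.trans_le ht.1).ne')
  rw [← ofReal_integral_eq_lintegral_ofReal hint]
  · rw [integral_Icc_eq_integral_Ioc, ← intervalIntegral.integral_of_le hle,
      integral_inv_of_pos hr0 (by positivity), mul_div_assoc, div_self hr0.ne', mul_one, Real.log_exp,
      ENNReal.ofReal_one]
  · filter_upwards [ae_restrict_mem measurableSet_Icc] with t ht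
    exact inv_nonneg.2 (hr0.le.trans ht.1)

theorem polarCoord_symm_eq_phase (p : ℝ × ℝ) : Complex.polarCoord.symm p = (p.1 : ℂ) * phase 1 p.2 := by
  rw [Complex.polarCoord_symm_apply, phase, mul_comm Complex.I, Complex.exp_mul_I]
  push_cast
  ring

/-- Put `z^k = t e^{iα}` and write the other components as `z^k w`. Polar coordinates contribute `t`
to the Jacobian and the dilation of `n` complex coordinates contributes `t^{2n}`. -/
theorem lintegral_eq_polar (k : Fin (n + 1)) {F : (CplxIx (n + 1) → ℝ) → ENNReal} (hF : Measurable F) :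
    ∫⁻ z, F z = ∫⁻ p in Set.Ioi (0 : ℝ) ×ˢ Set.Ioo (-Real.pi) Real.pi,
      ENNReal.ofReal (p.1 ^ (2 * n + 1)) * ∫⁻ w, F (cmul (p.1 : ℂ) (cmul (phase 1 p.2) (affinePt k w))) := by
  have hJ : Measurable fun q : ℂ × (CplxIx n → ℝ) => F (joinPt k q.1 q.2) :=
    hF.comp (measurePreserving_joinPt k).measurable
  rw [← (measurePreserving_joinPt k).lintegral_comp hF, Measure.volume_eq_prod, lintegral_prod _ hJ.aemeasurable,
    ← Complex.lintegral_comp_polarCoord_symm, polarCoord_target]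
  refine setLIntegral_congr_fun (measurableSet_Ioi.prod measurableSet_Ioo) fun p hp => ?_
  have hp0 : 0 < p.1 := hp.1
  have hc : Complex.polarCoord.symm p ≠ 0 := by
    rw [polarCoord_symm_eq_phase]
    exact mul_ne_zero (by exact_mod_cast hp0.ne') (phase_ne_zero one_pos _)
  have hn : ‖Complex.polarCoord.symm p‖ = p.1 := by
    rw [polarCoord_symm_eq_phase, norm_mul, norm_phase one_pos, mul_one, Complex.norm_real,
      Real.norm_of_nonneg hp0.le]
  dsimp only
  have hm : Measurable fun v => F (joinPt k (Complex.polarCoord.symm p) v) :=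
    hJ.comp measurable_prodMk_left
  rw [lintegral_eq_mul_lintegral_cmul hc hm, hn, smul_eq_mul, ← mul_assoc,
    ← ENNReal.ofReal_mul hp0.le, ← pow_succ']
  simp only [joinPt_cmul, cmul_cmul_real, polarCoord_symm_eq_phase]

/-- By Tonelli the radius is integrated first, for fixed angle and fixed `w`. -/
theorem setLIntegral_prod_of_lintegral_eq_one {W : Type*} [MeasureSpace W] [SFinite (volume : Measure W)]
    {S U : Set ℝ} {T Φ : ℝ × W → ENNReal} (hT : Measurable T) (hΦ : Measurable Φ)
    (h1 : ∀ w, ∫⁻ t in S, T (t, w) = 1) :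
    ∫⁻ p in S ×ˢ U, ∫⁻ w, T (p.1, w) * Φ (p.2, w) = ∫⁻ α in U, ∫⁻ w, Φ (α, w) := by
  have hm : Measurable fun q : (ℝ × ℝ) × W => T (q.1.1, q.2) * Φ (q.1.2, q.2) :=
    (hT.comp ((measurable_fst.comp measurable_fst).prodMk measurable_snd)).mul
      (hΦ.comp ((measurable_snd.comp measurable_fst).prodMk measurable_snd))
  rw [Measure.volume_eq_prod, ← Measure.prod_restrict,
    lintegral_prod_symm _ hm.lintegral_prod_right'.aemeasurable]
  refine lintegral_congr fun α => ?_
  have hm' : Measurable fun q : ℝ × W => T (q.1, q.2) * Φ (α, q.2) :=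
    hT.mul (hΦ.comp (measurable_const.prodMk measurable_snd))
  rw [lintegral_lintegral_swap (f := fun t w => T (t, w) * Φ (α, w)) hm'.aemeasurable]
  refine lintegral_congr fun w => ?_
  have hTw : Measurable fun t => T (t, w) := hT.comp measurable_prodMk_right
  rw [lintegral_mul_const _ hTw, h1, one_mul]

/-- Homogeneity turns the Jacobian `t^{2n+1}` into `t⁻¹`, and `|z|² = t² b` with `b` depending on
`w` only, so the radial integral is the one in `lintegral_inv_annulus`. -/
theorem setLIntegral_annulus_eq (k : Fin (n + 1)) {F : (CplxIx (n + 1) → ℝ) → ENNReal} (hF : Measurable F)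
    (hom : ∀ t : ℝ, 0 < t → ∀ z, z ≠ 0 →
      F (cmul (t : ℂ) z) = ENNReal.ofReal ((t ^ (2 * n + 2))⁻¹) * F z) :
    ∫⁻ z in annulus (n + 1), F z = ∫⁻ α in Set.Ioo (-Real.pi) Real.pi, ∫⁻ w, F (cmul (phase 1 α) (affinePt k w)) := by
  have hA := (isClosed_annulus (n + 1)).measurableSet
  rw [← lintegral_indicator hA, lintegral_eq_polar k (hF.indicator hA)]
  set T : ℝ → (CplxIx n → ℝ) → ENNReal := fun t w =>
    ENNReal.ofReal t⁻¹ * (if 1 ≤ t ^ 2 * bodyN w ∧ t ^ 2 * bodyN w ≤ Real.exp 2 then 1 else 0) with hT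
  have hTm : Measurable fun q : ℝ × (CplxIx n → ℝ) => T q.1 q.2 := by
    have hb : Measurable fun q : ℝ × (CplxIx n → ℝ) => q.1 ^ 2 * bodyN q.2 :=
      (measurable_fst.pow_const 2).mul (contDiff_bodyN.continuous.measurable.comp measurable_snd)
    refine (measurable_fst.inv.ennreal_ofReal).mul (Measurable.ite ?_ measurable_const measurable_const)
    exact (measurableSet_le measurable_const hb).inter (measurableSet_le hb measurable_const)
  have hFm : Measurable fun q : ℝ × (CplxIx n → ℝ) => F (cmul (phase 1 q.1) (affinePt k q.2)) :=
    hF.comp (continuous_hopfPoint k).measurable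
  have key : ∀ p ∈ Set.Ioi (0 : ℝ) ×ˢ Set.Ioo (-Real.pi) Real.pi,
      ENNReal.ofReal (p.1 ^ (2 * n + 1)) * ∫⁻ w, (annulus (n + 1)).indicator F
        (cmul (p.1 : ℂ) (cmul (phase 1 p.2) (affinePt k w))) =
      ∫⁻ w, T p.1 w * F (cmul (phase 1 p.2) (affinePt k w)) := by
    intro p hp
    have hp0 : 0 < p.1 := hp.1
    rw [← lintegral_const_mul' _ _ ENNReal.ofReal_ne_top]
    refine lintegral_congr fun w => ?_
    have hmem : cmul (p.1 : ℂ) (cmul (phase 1 p.2) (affinePt k w)) ∈ annulus (n + 1) ↔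
        1 ≤ p.1 ^ 2 * bodyN w ∧ p.1 ^ 2 * bodyN w ≤ Real.exp 2 := by
      change 1 ≤ ∑ e, _ ∧ ∑ e, _ ≤ _ ↔ _
      rw [sum_sq_cmul, sum_sq_cmul, sum_sq_affinePt, Complex.normSq_eq_norm_sq,
        Complex.normSq_eq_norm_sq, norm_phase one_pos, Complex.norm_real, Real.norm_of_nonneg hp0.le,
        one_pow, one_mul]
    by_cases h : 1 ≤ p.1 ^ 2 * bodyN w ∧ p.1 ^ 2 * bodyN w ≤ Real.exp 2
    · rw [Set.indicator_of_mem (hmem.2 h), hom _ hp0 _ (hopfPoint_ne_zero k _ _), hT]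
      simp only [if_pos h, mul_one]
      rw [← mul_assoc, ← ENNReal.ofReal_mul (by positivity)]
      congr 2
      field_simp
      ring
    · rw [Set.indicator_of_notMem (fun h' => h (hmem.1 h')), hT]
      simp only [if_neg h, mul_zero, zero_mul]
  rw [setLIntegral_congr_fun (measurableSet_Ioi.prod measurableSet_Ioo) key]
  exact setLIntegral_prod_of_lintegral_eq_one hTm hFm fun w => lintegral_inv_annulus (bodyN_pos w)

theorem phase_add_two_pi (R α : ℝ) : phase R (α + 2 * Real.pi) = phase R α := by
  unfold phase
  rw [Complex.ofReal_add, mul_add, Complex.exp_add]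
  have : Complex.exp (Complex.I * ((2 * Real.pi : ℝ) : ℂ)) = 1 := by
    rw [mul_comm]; push_cast; exact Complex.exp_two_pi_mul_I
  rw [this, mul_one]

theorem setLIntegral_Ioo_eq_of_periodic {g : ℝ → ENNReal} (hg : Function.Periodic g (2 * Real.pi)) (c : ℝ) :
    ∫⁻ α in Set.Ioo (-Real.pi) Real.pi, g α = ∫⁻ α in Set.Ioo c (c + 2 * Real.pi), g α := by
  have h := (isAddFundamentalDomain_Ioc Real.two_pi_pos (-Real.pi)).setLIntegral_eq
    (isAddFundamentalDomain_Ioc Real.two_pi_pos c) g hg.map_vadd_zmultiples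
  rw [show -Real.pi + 2 * Real.pi = Real.pi by ring] at h
  rw [Measure.restrict_congr_set Ioo_ae_eq_Ioc, Measure.restrict_congr_set Ioo_ae_eq_Ioc, h]

theorem measurePreserving_option :
    MeasurePreserving (fun q : ℝ × (CplxIx n → ℝ) => (fun i => Option.elim i q.1 q.2 : HopfIx n → ℝ)) := by
  have h1 : MeasurePreserving (Prod.map (MeasurableEquiv.funUnique Unit ℝ).symm (id : (CplxIx n → ℝ) → _)) :=
    ((volume_preserving_funUnique Unit ℝ).symm _).prod (MeasurePreserving.id _)
  have h2 := volume_measurePreserving_sumPiEquivProdPi_symm (fun _ : Unit ⊕ CplxIx n => ℝ)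
  have h3 := volume_preserving_arrowCongr' ((Equiv.optionEquivSumPUnit.{0} (CplxIx n)).trans
    (Equiv.sumComm _ _)).symm (MeasurableEquiv.refl ℝ) (MeasurePreserving.id _)
  convert h3.comp (h2.comp h1) using 1
  funext ⟨t, w⟩ i
  rcases i with _ | i <;> rfl

theorem setLIntegral_option {g : ℝ × (CplxIx n → ℝ) → ENNReal} (hg : Measurable g) {s : Set ℝ}
    (hs : MeasurableSet s) :
    ∫⁻ x in {x : HopfIx n → ℝ | x none ∈ s}, g (x none, fun i => x (some i)) =
      ∫⁻ α in s, ∫⁻ w, g (α, w) := by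
  have hp : Measurable fun x : HopfIx n → ℝ => (x none, fun i : CplxIx n => x (some i)) :=
    (measurable_pi_apply none).prodMk (measurable_pi_lambda _ fun i => measurable_pi_apply (some i))
  have hs' : MeasurableSet {x : HopfIx n → ℝ | x none ∈ s} := hs.preimage (measurable_pi_apply none)
  have hpre : (fun q : ℝ × (CplxIx n → ℝ) => (fun i => Option.elim i q.1 q.2 : HopfIx n → ℝ)) ⁻¹'
      {x | x none ∈ s} = s ×ˢ Set.univ := by
    ext q; simp
  have h := measurePreserving_option.setLIntegral_comp_preimage hs' (hg.comp hp)
  rw [hpre] at h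
  refine h.symm.trans ?_
  simp only [Function.comp, Option.elim_none, Option.elim_some]
  rw [Measure.volume_eq_prod, ← Measure.prod_restrict, Measure.restrict_univ, lintegral_prod _ hg.aemeasurable]

/-- The right-hand side involves neither `k` nor `c`. This independence of the chart replaces the
change of variables between Hopf charts. -/
theorem setLIntegral_hopf (k : Fin (n + 1)) (c : ℝ) {F : (CplxIx (n + 1) → ℝ) → ENNReal} (hF : Measurable F)
    (hom : ∀ t : ℝ, 0 < t → ∀ z, z ≠ 0 →
      F (cmul (t : ℂ) z) = ENNReal.ofReal ((t ^ (2 * n + 2))⁻¹) * F z) :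
    ∫⁻ x in {x : HopfIx n → ℝ | x none ∈ Set.Ioo c (c + 2 * Real.pi)},
      F (cmul (phase 1 (x none)) (affinePt k fun i => x (some i))) = ∫⁻ z in annulus (n + 1), F z := by
  have hFm : Measurable fun q : ℝ × (CplxIx n → ℝ) => F (cmul (phase 1 q.1) (affinePt k q.2)) :=
    hF.comp (continuous_hopfPoint k).measurable
  have hper : Function.Periodic (fun α => ∫⁻ w, F (cmul (phase 1 α) (affinePt k w))) (2 * Real.pi) := by
    intro α
    simp only [phase_add_two_pi]
  rw [setLIntegral_annulus_eq k hF hom, setLIntegral_Ioo_eq_of_periodic hper c]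
  exact setLIntegral_option hFm measurableSet_Ioo

end PolarFubini

/-! ### Integrals of homogeneous complex functions -/

section HomogeneousIntegral

open MeasureTheory

variable {n : ℕ}

/-- The hypothesis is restricted to positively homogeneous `φ` so that composition with `φ` keeps a
homogeneous function homogeneous of the same degree. The norm transfers integrability from `g` to
`f`, which is essential because Hopf charts are unbounded; the positive and negative parts of real
and imaginary parts then transfer the value. -/
theorem integral_eq_of_lintegral_comp_eq {X Y : Type*} [MeasurableSpace X] [MeasurableSpace Y]
    {μ : Measure X} {ν : Measure Y} {f : X → ℂ} {g : Y → ℂ} (hf : AEStronglyMeasurable f μ)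
    (hg : Integrable g ν)
    (h : ∀ φ : ℂ → ENNReal, Measurable φ → (∀ (s : ℝ) (w : ℂ), 0 < s → φ ((s : ℂ) * w) = ENNReal.ofReal s * φ w) →
      ∫⁻ x, φ (f x) ∂μ = ∫⁻ y, φ (g y) ∂ν) :
    ∫ x, f x ∂μ = ∫ y, g y ∂ν := by
  have hfi : Integrable f μ := by
    refine ⟨hf, ?_⟩
    have := h (fun w => ‖w‖ₑ) measurable_enorm fun s w hs => by
      rw [enorm_mul]
      congr 1
      rw [← ofReal_norm, Complex.norm_real, Real.norm_of_nonneg hs.le]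
    rw [HasFiniteIntegral, this]
    exact hg.2
  have hpart : ∀ ρ : ℂ → ℝ, Measurable ρ → (∀ (s : ℝ) (w : ℂ), 0 < s → ρ ((s : ℂ) * w) = s * ρ w) →
      ∫⁻ x, ENNReal.ofReal (ρ (f x)) ∂μ = ∫⁻ y, ENNReal.ofReal (ρ (g y)) ∂ν := by
    intro ρ hρ hs
    refine h (fun w => ENNReal.ofReal (ρ w)) hρ.ennreal_ofReal fun s w hs0 => ?_
    rw [hs s w hs0, ENNReal.ofReal_mul hs0.le]
  rw [← integral_re_add_im hfi, ← integral_re_add_im hg,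
    integral_eq_lintegral_pos_part_sub_lintegral_neg_part hfi.re,
    integral_eq_lintegral_pos_part_sub_lintegral_neg_part hg.re,
    integral_eq_lintegral_pos_part_sub_lintegral_neg_part hfi.im,
    integral_eq_lintegral_pos_part_sub_lintegral_neg_part hg.im]
  have e1 := hpart (fun w => w.re) Complex.measurable_re fun s w _ => Complex.re_ofReal_mul s w
  have e2 := hpart (fun w => -w.re) Complex.measurable_re.neg fun s w _ => by
    rw [Complex.re_ofReal_mul, mul_neg]
  have e3 := hpart (fun w => w.im) Complex.measurable_im fun s w _ => Complex.im_ofReal_mul s w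
  have e4 := hpart (fun w => -w.im) Complex.measurable_im.neg fun s w _ => by
    rw [Complex.im_ofReal_mul, mul_neg]
  simp only [RCLike.re_eq_complex_re, RCLike.im_eq_complex_im] at *
  rw [e1, e2, e3, e4]

theorem integrableOn_annulus {N : ℕ} {G : (CplxIx N → ℝ) → ℂ} (hG : ContinuousOn G {z | z ≠ 0}) :
    IntegrableOn G (annulus N) :=
  (hG.mono fun _ hz => ne_zero_of_mem_annulus hz).integrableOn_compact (isCompact_annulus N)

theorem setIntegral_hopf (k : Fin (n + 1)) (c : ℝ) {G : (CplxIx (n + 1) → ℝ) → ℂ}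
    (hG : ContinuousOn G {z | z ≠ 0})
    (hom : ∀ t : ℝ, 0 < t → ∀ z, z ≠ 0 → G (cmul (t : ℂ) z) = (((t ^ (2 * n + 2))⁻¹ : ℝ) : ℂ) * G z) :
    ∫ x in {x : HopfIx n → ℝ | x none ∈ Set.Ioo c (c + 2 * Real.pi)},
      G (cmul (phase 1 (x none)) (affinePt k fun i => x (some i))) = ∫ z in annulus (n + 1), G z := by
  classical
  -- Nothing is known about `G` at the origin; it is replaced by zero there to obtain a measurable
  -- function.
  set G' : (CplxIx (n + 1) → ℝ) → ℂ := Set.piecewise {z | z ≠ 0} G 0 with hG'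
  have hset : MeasurableSet {z : CplxIx (n + 1) → ℝ | z ≠ 0} := (measurableSet_singleton 0).compl
  have hG'm : Measurable G' := hG.measurable_piecewise continuousOn_const hset
  have hG'eq : ∀ z, z ≠ 0 → G' z = G z := fun z hz => Set.piecewise_eq_of_mem _ _ _ hz
  have hp : Continuous fun x : HopfIx n → ℝ => (x none, fun i : CplxIx n => x (some i)) :=
    (continuous_apply none).prodMk (continuous_pi fun i => continuous_apply (some i))
  refine integral_eq_of_lintegral_comp_eq ?_ (integrableOn_annulus hG) fun φ hφ hs => ?_
  · refine Continuous.aestronglyMeasurable ?_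
    rw [← continuousOn_univ]
    exact hG.comp ((continuous_hopfPoint k).comp hp).continuousOn fun x _ => hopfPoint_ne_zero k _ _
  · have h := setLIntegral_hopf k c (F := fun z => φ (G' z)) (hφ.comp hG'm) fun t ht z hz => by
      rw [hG'eq _ (cmul_ne_zero (by exact_mod_cast ht.ne') hz), hG'eq _ hz, hom t ht z hz,
        hs _ _ (by positivity)]
    have h1 : ∀ x : HopfIx n → ℝ, G' (cmul (phase 1 (x none)) (affinePt k fun i => x (some i))) =
        G (cmul (phase 1 (x none)) (affinePt k fun i => x (some i))) :=
      fun x => hG'eq _ (hopfPoint_ne_zero k _ _)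
    simp only [h1] at h
    rw [h]
    exact setLIntegral_congr_fun (isClosed_annulus _).measurableSet fun z hz => by
      rw [hG'eq _ (ne_zero_of_mem_annulus hz)]

theorem setIntegral_option_const (g : (CplxIx n → ℝ) → ℂ) {s : Set ℝ} (hs : MeasurableSet s) :
    ∫ x in {x : HopfIx n → ℝ | x none ∈ s}, g (fun i => x (some i)) =
      (volume s).toReal * ∫ w, g w := by
  have hs' : MeasurableSet {x : HopfIx n → ℝ | x none ∈ s} := hs.preimage (measurable_pi_apply none)
  have hpre : (fun q : ℝ × (CplxIx n → ℝ) => (fun i => Option.elim i q.1 q.2 : HopfIx n → ℝ)) ⁻¹'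
      {x | x none ∈ s} = s ×ˢ Set.univ := by
    ext q; simp
  have hemb : MeasurableEmbedding
      (fun q : ℝ × (CplxIx n → ℝ) => (fun i => Option.elim i q.1 q.2 : HopfIx n → ℝ)) := by
    have hp : Measurable fun x : HopfIx n → ℝ => (x none, fun i : CplxIx n => x (some i)) :=
      (measurable_pi_apply none).prodMk (measurable_pi_lambda _ fun i => measurable_pi_apply (some i))
    exact (MeasurableEquiv.mk ⟨_, fun x => (x none, fun i => x (some i)), fun _ => rfl, fun x => by
      funext i; rcases i with _ | i <;> rfl⟩ measurePreserving_option.measurable hp).measurableEmbedding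
  rw [← measurePreserving_option.setIntegral_preimage_emb hemb, hpre, Measure.volume_eq_prod]
  have h := setIntegral_prod_mul (μ := (volume : Measure ℝ)) (ν := (volume : Measure (CplxIx n → ℝ)))
    (fun _ : ℝ => (1 : ℂ)) g s Set.univ
  simpa [Measure.real] using h

theorem volume_Ioo_two_pi (c : ℝ) : (volume (Set.Ioo c (c + 2 * Real.pi))).toReal = 2 * Real.pi := by
  rw [Real.volume_Ioo, add_sub_cancel_left, ENNReal.toReal_ofReal Real.two_pi_pos.le]

/-- For homogeneous functions which are invariant under the circle, the integral over the annulus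
reduces to an integral over an affine chart. -/
theorem integral_affine (k : Fin (n + 1)) {G : (CplxIx (n + 1) → ℝ) → ℂ}
    (hG : ContinuousOn G {z | z ≠ 0})
    (hom : ∀ l : ℂ, l ≠ 0 → ∀ z, z ≠ 0 → G (cmul l z) = (((‖l‖ ^ (2 * n + 2))⁻¹ : ℝ) : ℂ) * G z) :
    (2 * Real.pi : ℝ) * ∫ w, G (affinePt k w) = ∫ z in annulus (n + 1), G z := by
  rw [← setIntegral_hopf k 0 hG fun t ht z hz => by
    rw [hom t (by exact_mod_cast ht.ne') z hz, Complex.norm_real, Real.norm_of_nonneg ht.le]]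
  have h1 : ∀ x : HopfIx n → ℝ, G (cmul (phase 1 (x none)) (affinePt k fun i => x (some i))) =
      G (affinePt k fun i => x (some i)) := by
    intro x
    rw [hom _ (phase_ne_zero one_pos _) _ (affinePt_ne_zero k _), norm_phase one_pos]
    simp
  simp only [h1]
  rw [setIntegral_option_const (fun w => G (affinePt k w)) measurableSet_Ioo, volume_Ioo_two_pi]

end HomogeneousIntegral

/-! ### Berezin integration and scaling of the odd variables -/

section ScaleBerezin

variable {m : ℕ}

theorem scaleHom_gen_zero (l : ℂ) (μ : Fin m) :
    scaleHom l (gen (μ, 0)) = (l.re : ℂ) • gen (μ, 0) - (l.im : ℂ) • gen (μ, 1) := by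
  rw [scaleHom_gen, cmul_eq]; simp [-Complex.coe_smul]

theorem scaleHom_gen_one (l : ℂ) (μ : Fin m) :
    scaleHom l (gen (μ, 1)) = (l.im : ℂ) • gen (μ, 0) + (l.re : ℂ) • gen (μ, 1) := by
  rw [scaleHom_gen, cmul_eq]; simp [-Complex.coe_smul]

/-- This is the chain rule for a linear substitution. The elements satisfying both identities form a
subspace that contains 1 and is stable under left multiplication by generators, hence everything. -/
theorem oddD_scaleHom (l : ℂ) (μ : Fin m) (f : Grass m) :
    oddD (μ, 0) (scaleHom l f) =
        scaleHom l ((l.re : ℂ) • oddD (μ, 0) f + (l.im : ℂ) • oddD (μ, 1) f) ∧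
      oddD (μ, 1) (scaleHom l f) =
        scaleHom l (-((l.im : ℂ) • oddD (μ, 0) f) + (l.re : ℂ) • oddD (μ, 1) f) := by
  let V : Submodule ℂ (Grass m) :=
    LinearMap.ker ((oddD (μ, 0)) ∘ₗ (scaleHom l).toLinearMap -
        (scaleHom l).toLinearMap ∘ₗ ((l.re : ℂ) • oddD (μ, 0) + (l.im : ℂ) • oddD (μ, 1))) ⊓
      LinearMap.ker ((oddD (μ, 1)) ∘ₗ (scaleHom l).toLinearMap -
        (scaleHom l).toLinearMap ∘ₗ (-((l.im : ℂ) • oddD (μ, 0)) + (l.re : ℂ) • oddD (μ, 1)))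
  have hV : ∀ f : Grass m, f ∈ V ↔ (oddD (μ, 0) (scaleHom l f) =
        scaleHom l ((l.re : ℂ) • oddD (μ, 0) f + (l.im : ℂ) • oddD (μ, 1) f) ∧
      oddD (μ, 1) (scaleHom l f) =
        scaleHom l (-((l.im : ℂ) • oddD (μ, 0) f) + (l.re : ℂ) • oddD (μ, 1) f)) := by
    intro f
    simp only [V, Submodule.mem_inf, LinearMap.mem_ker, LinearMap.sub_apply, sub_eq_zero]
    rfl
  rw [← hV]
  refine submodule_eq_top_of_gen_mul V ?_ ?_ f
  · rw [hV]; simp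
  · rintro ⟨ν, s⟩ f hf
    rw [hV] at hf ⊢
    obtain ⟨h0, h1⟩ := hf
    have hs : s = 0 ∨ s = 1 := by omega
    rcases hs with rfl | rfl
    · simp only [map_mul, scaleHom_gen_zero, sub_mul, smul_mul_assoc, map_sub, map_smul, oddD_gen_mul, h0, h1]
      by_cases h : μ = ν <;>
        simp only [h, map_add, map_sub, map_smul, map_neg, map_mul, scaleHom_gen_zero, Prod.mk.injEq,
          true_and, false_and, if_true, if_false, one_ne_zero, zero_ne_one, sub_mul, mul_add, mul_neg, mul_smul_comm,
          smul_mul_assoc, map_zero] <;> constructor <;> module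
    · simp only [map_mul, scaleHom_gen_one, add_mul, smul_mul_assoc, map_add, map_smul, oddD_gen_mul, h0, h1]
      by_cases h : μ = ν <;>
        simp only [h, map_sub, map_smul, map_neg, map_mul, scaleHom_gen_one, Prod.mk.injEq,
          true_and, false_and, if_true, if_false, one_ne_zero, zero_ne_one, add_mul, mul_add, mul_neg, mul_smul_comm,
          smul_mul_assoc, map_zero] <;> constructor <;> module

/-- Since odd derivatives anticommute, the two of them see only the determinant of the rotation and
dilation, which is `|l|²`. -/
theorem oddD_oddD_scaleHom (l : ℂ) (μ : Fin m) (f : Grass m) :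
    oddD (μ, 0) (oddD (μ, 1) (scaleHom l f)) =
      ((‖l‖ ^ 2 : ℝ) : ℂ) • scaleHom l (oddD (μ, 0) (oddD (μ, 1) f)) := by
  rw [(oddD_scaleHom l μ f).2, (oddD_scaleHom l μ _).1, ← map_smul, ← Complex.normSq_eq_norm_sq,
    Complex.normSq_apply]
  simp only [map_add, map_neg, map_smul, oddD_oddD_self, oddD_comm (μ, 1) (μ, 0)]
  push_cast
  module

/-- Odd integration is differentiation, so each odd pair contributes the determinant `|l|²` of the
substitution and not its inverse. -/
theorem berezin_scaleHom (l : ℂ) (f : Grass m) :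
    berezin (scaleHom l f) = ((‖l‖ ^ (2 * m) : ℝ) : ℂ) * berezin f := by
  have key : ∀ L : List (Fin m), (L.product (List.finRange 2)).foldr (fun κ g => oddD κ g) (scaleHom l f) =
      ((‖l‖ ^ (2 * L.length) : ℝ) : ℂ) •
        scaleHom l ((L.product (List.finRange 2)).foldr (fun κ g => oddD κ g) f) := by
    intro L
    induction L with
    | nil => simp [List.product]
    | cons μ L ih =>
      have h2 : List.finRange 2 = [0, 1] := rfl
      have h3 : (μ :: L).product (List.finRange 2) =
        (List.finRange 2).map (Prod.mk μ) ++ L.product (List.finRange 2) := rfl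
      rw [h3, List.foldr_append, List.foldr_append, ih, h2]
      simp only [List.map_cons, List.map_nil, List.foldr_cons, List.foldr_nil, map_smul,
        oddD_oddD_scaleHom, smul_smul, List.length_cons]
      congr 1
      push_cast
      ring
  unfold berezin oddList
  rw [key, body_smul, body_scaleHom, List.length_finRange]

/-- The Berezin integral as a linear functional. -/
def berezinₗ (m : ℕ) : Grass m →ₗ[ℂ] ℂ where
  toFun := berezin
  map_add' f g := by
    unfold berezin
    rw [← body_add]
    congr 1
    induction oddList m with
    | nil => rfl
    | cons a l ih => simp [ih]
  map_smul' c f := by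
    unfold berezin
    rw [RingHom.id_apply, smul_eq_mul, ← body_smul]
    congr 1
    induction oddList m with
    | nil => rfl
    | cons a l ih => simp [ih]

end ScaleBerezin

/-! ### Substitution into superfunctions -/

section Substitution

variable {E : Type*} [Fintype E] [DecidableEq E] {m m' : ℕ}

theorem taylor_map {φ : Grass m →ₐ[ℂ] Grass m} (hφ : ∀ f, body (φ f) = body f) (f : (E → ℝ) → ℂ)
    (b : E → Grass m) : φ (taylor f b) = taylor f fun e => φ (b e) := by
  have hs : ∀ f : Grass m, φ (scal (body f)) = scal (body f) := fun f => φ.commutes _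
  unfold taylor
  simp only [map_sum, map_smul, map_list_prod, List.map_ofFn, rbody, hφ, Function.comp_def, map_sub, hs]

theorem superEval_map {φ : Grass m →ₐ[ℂ] Grass m} (hφ : ∀ f, body (φ f) = body f) (F : SFun E m')
    (a : E ⊕ OddIx m' → Grass m) : φ (superEval F a) = superEval F fun e => φ (a e) := by
  unfold superEval
  simp only [map_sum, map_mul, taylor_map hφ, map_list_prod, List.map_map, Function.comp_def]

theorem taylor_scal (f : (E → ℝ) → ℂ) (x : E → ℝ) :
    taylor (m := m) f (fun e => scal (x e : ℂ)) = scal (f x) := by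
  unfold taylor
  rw [Finset.sum_eq_single 0]
  · simp only [rbody_scal]
    simp [scal_eq_smul_one]
  · intro k _ hk
    obtain ⟨k, rfl⟩ := Nat.exists_eq_succ_of_ne_zero hk
    simp [List.ofFn_succ]
  · simp

theorem taylor_congr {f g : (E → ℝ) → ℂ} {b : E → Grass m}
    (h : f =ᶠ[nhds fun e => rbody (b e)] g) : taylor f b = taylor g b := by
  unfold taylor
  refine Finset.sum_congr rfl fun k _ => ?_
  rw [(h.iteratedFDeriv ℝ k).eq_of_nhds]

theorem taylor_const (c : ℂ) (b : E → Grass m) : taylor (fun _ => c) b = scal c := by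
  unfold taylor
  rw [Finset.sum_eq_single 0]
  · simp [scal_eq_smul_one]
  · intro k _ hk
    rw [iteratedFDeriv_const_of_ne hk]
    simp
  · simp

theorem taylor_add {f g : (E → ℝ) → ℂ} {b : E → Grass m} (hf : ContDiffAt ℝ ∞ f fun e => rbody (b e))
    (hg : ContDiffAt ℝ ∞ g fun e => rbody (b e)) : taylor (f + g) b = taylor f b + taylor g b := by
  unfold taylor
  rw [← Finset.sum_add_distrib]
  refine Finset.sum_congr rfl fun k _ => ?_
  rw [iteratedFDeriv_add_apply (hf.of_le (by exact_mod_cast le_top)) (hg.of_le (by exact_mod_cast le_top)),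
    ← smul_add, ← Finset.sum_add_distrib]
  congr 1
  refine Finset.sum_congr rfl fun s _ => ?_
  rw [add_apply, add_smul]

theorem taylor_sum {ι : Type*} (s : Finset ι) {f : ι → (E → ℝ) → ℂ} {b : E → Grass m}
    (hf : ∀ j ∈ s, ContDiffAt ℝ ∞ (f j) fun e => rbody (b e)) :
    taylor (fun x => ∑ j ∈ s, f j x) b = ∑ j ∈ s, taylor (f j) b := by
  classical
  induction s using Finset.induction_on with
  | empty => simpa using taylor_const 0 b
  | insert a s ha ih =>
    have h1 := fun j hj => hf j (Finset.mem_insert_of_mem hj)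
    rw [Finset.sum_insert ha, ← ih h1, ← taylor_add (hf a (Finset.mem_insert_self a s)) (ContDiffAt.sum h1)]
    congr 1
    funext x
    simp [Finset.sum_insert ha]

theorem superEval_scal (h : (E → ℝ) → ℂ) (a : E ⊕ OddIx m' → Grass m) :
    superEval (fun x => scal (m := m') (h x)) a = taylor h fun e => a (Sum.inl e) := by
  unfold superEval
  rw [Finset.sum_eq_single ∅]
  · simp [coeff_scal, sortedList]
  · intro A _ hA
    have : (fun x : E → ℝ => coeff A (scal (m := m') (h x))) = fun _ => 0 := by
      funext x; rw [coeff_scal, if_neg hA]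
    rw [this, taylor_const, scal_zero, zero_mul]
  · simp

theorem SmoothOn.list_prod {I : Type*} [Fintype I] {U : Set (I → ℝ)} {ι : Type*} (l : List ι) {f : ι → SFun I m}
    (hf : ∀ i ∈ l, SmoothOn U (f i)) : SmoothOn U fun x => (l.map fun i => f i x).prod := by
  induction l with
  | nil => simpa using smoothOn_const 1
  | cons a l ih =>
    simp only [List.map_cons, List.prod_cons]
    exact (hf a (by simp)).mul (ih fun i hi => hf i (by simp [hi]))

theorem SmoothOn.taylor {I : Type*} [Fintype I] {U : Set (I → ℝ)} {V : Set (E → ℝ)}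
    (hV : IsOpen V) {f : (E → ℝ) → ℂ} (hf : ContDiffOn ℝ ∞ f V) {b : E → SFun I m} (hb : ∀ e, SmoothOn U (b e))
    (hUV : ∀ x ∈ U, (fun e => SuperHopf.rbody (b e x)) ∈ V) : SmoothOn U fun x => SuperHopf.taylor f fun e => b e x := by
  unfold SuperHopf.taylor
  refine SmoothOn.sum fun k _ => SmoothOn.const_smul (SmoothOn.sum fun s _ => SmoothOn.smul ?_ ?_) _
  · have hr : ContDiffOn ℝ ∞ (fun x => fun e => SuperHopf.rbody (b e x)) U := contDiffOn_pi.2 fun e => (hb e).rbody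
    have hD : ContDiffOn ℝ ∞ (iteratedFDeriv ℝ k f) V := fun y hy =>
      ((hf.contDiffAt (hV.mem_nhds hy)).iteratedFDeriv_right (m := ∞) (i := k) (by
        exact_mod_cast le_top)).contDiffWithinAt
    have h := hD.comp hr hUV
    exact (ContinuousMultilinearMap.apply ℝ (fun _ : Fin k => E → ℝ) ℂ
      (fun j => Pi.single (s j) 1)).contDiff.comp_contDiffOn h
  · have h : (fun x => (List.ofFn fun j => b (s j) x - scal (SuperHopf.body (b (s j) x))).prod) =
        fun x => ((List.finRange k).map fun j => b (s j) x - scal (SuperHopf.body (b (s j) x))).prod := by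
      funext x; rw [List.ofFn_eq_map]
    rw [h]
    exact SmoothOn.list_prod _ fun j _ => (hb _).fun_sub (smoothOn_scal (hb _).body)

theorem SmoothOn.superEval {I : Type*} [Fintype I] {U : Set (I → ℝ)} {V : Set (E → ℝ)}
    (hV : IsOpen V) {F : SFun E m'} (hF : SmoothOn V F) {a : E ⊕ OddIx m' → SFun I m} (ha : ∀ e, SmoothOn U (a e))
    (hUV : ∀ x ∈ U, (fun e => SuperHopf.rbody (a (Sum.inl e) x)) ∈ V) : SmoothOn U fun x => SuperHopf.superEval F fun e => a e x := by
  unfold SuperHopf.superEval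
  exact SmoothOn.sum fun A _ => (SmoothOn.taylor hV (hF A) (fun e => ha _) hUV).mul
    (SmoothOn.list_prod _ fun κ _ => ha _)

end Substitution

/-! ### Scaling and retraction to the sphere on `ℂ^{n+1|m} ∖ 0` -/

section AmbientFunctions

variable {n m : ℕ}

theorem superEval_stdCoord (F : SFun (CplxIx (n + 1)) m) (z : CplxIx (n + 1) → ℝ) :
    superEval F (stdCoord z) = F z := by
  unfold superEval
  simp only [stdCoord, Sum.elim_inl, Sum.elim_inr, taylor_scal, scal_mul]
  exact sum_coeff_mono (F z)

theorem scaleHom_stdCoord (l : ℂ) (z : CplxIx (n + 1) → ℝ) (e : AmbIx n m) :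
    scaleHom l (stdCoord (cmul l z) e) = superCmul l (stdCoord z) e := by
  rcases e with ⟨p, s⟩ | κ
  · simp only [stdCoord, Sum.elim_inl, scaleHom_scal, superCmul_inl, cmul_real_apply]
    split_ifs
    · simp only [scal_eq_smul_one]; push_cast; module
    · simp only [scal_eq_smul_one]; push_cast; module
  · simp only [stdCoord, Sum.elim_inr, scaleHom_gen]
    rfl

/-- The action of a scalar is split into a motion of the base point and a substitution of
generators. Invariance of `F` thereby becomes `scaleHom l (F (l z)) = F z`. -/
theorem scaleHom_superEval_stdCoord (F : SFun (CplxIx (n + 1)) m) (l : ℂ) (z : CplxIx (n + 1) → ℝ) :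
    superEval F (superCmul l (stdCoord z)) = scaleHom l (F (cmul l z)) := by
  rw [← superEval_stdCoord F (cmul l z), superEval_map (body_scaleHom l)]
  congr 1
  funext e
  exact (scaleHom_stdCoord l z e).symm

/-- The function `z·z̄ + i ζ·ζ̄` on `ℂ^{n+1|m}`. -/
def ambN (m : ℕ) (z : CplxIx (n + 1) → ℝ) : Grass m := scal ((∑ e, z e ^ 2 : ℝ) : ℂ) + nilN m

theorem affineN_eq_ambN (k : Fin (n + 1)) (x : CplxIx n → ℝ) : affineN k x = ambN m (affinePt k x) := by
  rw [affineN_eq, ambN, sum_sq_affinePt]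

theorem rbody_ambN (z : CplxIx (n + 1) → ℝ) : rbody (ambN m z) = ∑ e, z e ^ 2 := by
  rw [rbody, ambN, body_add, body_scal, body_nilN, add_zero, Complex.ofReal_re]

theorem sum_sq_pos {N : ℕ} {z : CplxIx N → ℝ} (hz : z ≠ 0) : 0 < ∑ e, z e ^ 2 := by
  obtain ⟨e, he⟩ := Function.ne_iff.1 hz
  exact Finset.sum_pos' (fun _ _ => sq_nonneg _) ⟨e, Finset.mem_univ e, sq_pos_of_ne_zero he⟩

theorem rbody_ambN_pos {z : CplxIx (n + 1) → ℝ} (hz : z ≠ 0) : 0 < rbody (ambN m z) := by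
  rw [rbody_ambN]; exact sum_sq_pos hz

theorem smoothOn_ambN {U : Set (CplxIx (n + 1) → ℝ)} : SmoothOn U (ambN (n := n) m) := by
  have h : ContDiff ℝ ∞ fun z : CplxIx (n + 1) → ℝ => ∑ e, z e ^ 2 :=
    ContDiff.sum fun i _ => (contDiff_apply ℝ ℝ i).pow 2
  exact (smoothOn_scal (contDiff_comp_ofReal h).contDiffOn).fun_add (smoothOn_const _)

theorem scaleHom_nilN (l : ℂ) : scaleHom l (nilN m) = ((‖l‖ ^ 2 : ℝ) : ℂ) • nilN m := by
  have h (μ : Fin m) : scaleHom l (gen (μ, 0) * gen (μ, 1)) =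
      ((‖l‖ ^ 2 : ℝ) : ℂ) • (gen (μ, 0) * gen (μ, 1) : Grass m) := by
    rw [map_mul, scaleHom_gen_zero, scaleHom_gen_one, ← Complex.normSq_eq_norm_sq, Complex.normSq_apply]
    simp only [sub_mul, mul_add, smul_mul_assoc, mul_smul_comm, gen_mul_self, gen_mul_gen_zero_one μ]
    push_cast
    module
  rw [nilN, map_smul, map_sum]
  simp only [h, ← Finset.smul_sum]
  rw [smul_comm]

theorem scaleHom_ambN (l : ℂ) (z : CplxIx (n + 1) → ℝ) :
    scaleHom l (ambN m (cmul l z)) = ((‖l‖ ^ 2 : ℝ) : ℂ) • ambN m z := by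
  rw [ambN, ambN, map_add, scaleHom_scal, scaleHom_nilN, sum_sq_cmul, Complex.normSq_eq_norm_sq, smul_add]
  congr 1
  rw [← scal_mul, scal_mul_scal]
  push_cast
  rfl

theorem scaleHom_superApply_ambN {F : ℝ → ℝ} {l : ℂ} {d : ℝ} (hF : ∀ t, 0 < t → F (‖l‖ ^ 2 * t) = d * F t)
    {z : CplxIx (n + 1) → ℝ} (hz : z ≠ 0) :
    scaleHom l (superApply F (ambN m (cmul l z))) = (d : ℂ) • superApply F (ambN m z) := by
  rw [map_superApply (body_scaleHom l), scaleHom_ambN, superApply_smul hF (rbody_ambN_pos hz)]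

theorem scaleHom_zpow_ambN (l : ℂ) (j : ℤ) {z : CplxIx (n + 1) → ℝ} (hz : z ≠ 0) :
    scaleHom l (superApply (fun t => t ^ j) (ambN m (cmul l z))) =
      (((‖l‖ ^ 2) ^ j : ℝ) : ℂ) • superApply (fun t => t ^ j) (ambN m z) :=
  scaleHom_superApply_ambN (fun _ _ => mul_zpow _ _ _) hz

theorem scaleHom_rsqrt_ambN (l : ℂ) {z : CplxIx (n + 1) → ℝ} (hz : z ≠ 0) :
    scaleHom l (superApply (fun t => t ^ (-(1 / 2) : ℝ)) (ambN m (cmul l z))) =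
      ((‖l‖⁻¹ : ℝ) : ℂ) • superApply (fun t => t ^ (-(1 / 2) : ℝ)) (ambN m z) := by
  refine scaleHom_superApply_ambN (fun t ht => ?_) hz
  rw [Real.mul_rpow (by positivity) ht.le, Real.rpow_neg (by positivity), ← Real.sqrt_eq_rpow,
    Real.sqrt_sq (norm_nonneg _)]

/-- The projection of `ℂ^{n+1|m} ∖ 0` to the supersphere. -/
def spherePt (R : ℝ) (z : CplxIx (n + 1) → ℝ) (e : AmbIx n m) : Grass m :=
  (R : ℂ) • (superApply (fun t => t ^ (-(1 / 2) : ℝ)) (ambN m z) * stdCoord z e)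

theorem superCmul_ofReal_mul (r : ℝ) (c : ℂ) (V : AmbIx n m → Grass m) (e : AmbIx n m) :
    superCmul ((r : ℂ) * c) V e = (r : ℂ) • superCmul c V e := by
  simp only [superCmul_apply, Complex.re_ofReal_mul, Complex.im_ofReal_mul]
  push_cast
  module

theorem scaleHom_spherePt (R : ℝ) (l : ℂ) {z : CplxIx (n + 1) → ℝ} (hz : z ≠ 0) (e : AmbIx n m) :
    scaleHom l (spherePt R (cmul l z) e) = ((R * ‖l‖⁻¹ : ℝ) : ℂ) •
      (superApply (fun t => t ^ (-(1 / 2) : ℝ)) (ambN m z) * superCmul l (stdCoord z) e) := by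
  rw [spherePt, map_smul, map_mul, scaleHom_rsqrt_ambN l hz, scaleHom_stdCoord, smul_mul_assoc, smul_smul,
    Complex.ofReal_mul]

theorem affineCoord_eq_stdCoord (k : Fin (n + 1)) (x : CplxIx n → ℝ) :
    (fun e => affineCoord (m := m) k e x) = stdCoord (affinePt k x) := by
  funext e
  rcases e with e | κ
  · exact affineCoord_inl k e x
  · rfl

/-- The Hopf parametrization is the radial retraction evaluated at `e^{iα} w`, with the phase acting
on the generators. Functions on the sphere can thus be studied as functions on `ℂ^{n+1} ∖ 0`. -/
theorem hopfCoord_eq_scaleHom (R : ℝ) (k : Fin (n + 1)) (x : HopfIx n → ℝ) (e : AmbIx n m) :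
    hopfCoord R k e x = scaleHom (phase 1 (x none))
      (spherePt R (cmul (phase 1 (x none)) (affinePt k fun i => x (some i))) e) := by
  rw [scaleHom_spherePt R _ (affinePt_ne_zero k _), norm_phase one_pos, inv_one, mul_one, hopfCoord_apply,
    affineCoord_eq_stdCoord, rsqrtN, affineN_eq_ambN,
    show phase R (x none) = (R : ℂ) * phase 1 (x none) by simp [phase], superCmul_ofReal_mul, mul_smul_comm]

/-- The dilation of the coordinates cancels against that of `N^{-1/2}`. Hence functions pulled back
along the retraction are invariant under positive dilations. -/
theorem scaleHom_ofReal_spherePt (R : ℝ) {t : ℝ} (ht : 0 < t) {z : CplxIx (n + 1) → ℝ} (hz : z ≠ 0)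
    (e : AmbIx n m) : scaleHom (t : ℂ) (spherePt R (cmul (t : ℂ) z) e) = spherePt R z e := by
  have h := superCmul_ofReal_mul t 1 (stdCoord z) e
  have h1 : superCmul 1 (stdCoord z) e = (stdCoord z e : Grass m) := by
    rw [superCmul_apply]; simp
  rw [mul_one, h1] at h
  rw [scaleHom_spherePt R _ hz, h, Complex.norm_real, Real.norm_of_nonneg ht.le, spherePt, mul_smul_comm,
    smul_smul, ← Complex.ofReal_mul, mul_assoc, inv_mul_cancel₀ ht.ne', mul_one]

theorem rbody_spherePt (R : ℝ) (z : CplxIx (n + 1) → ℝ) (e : CplxIx (n + 1)) :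
    rbody (spherePt (m := m) R z (Sum.inl e)) = R * ((∑ e, z e ^ 2) ^ (-(1 / 2) : ℝ) * z e) := by
  rw [spherePt, rbody, body_smul, body_mul, body_superApply, rbody_ambN, stdCoord, Sum.elim_inl, body_scal]
  rw [Complex.re_ofReal_mul, Complex.re_ofReal_mul, Complex.ofReal_re]

theorem isOpen_ne_zero {N : ℕ} : IsOpen {z : CplxIx N → ℝ | z ≠ 0} := isOpen_ne

theorem smoothOn_spherePt (R : ℝ) (e : AmbIx n m) :
    SmoothOn {z : CplxIx (n + 1) → ℝ | z ≠ 0} fun z => spherePt R z e := by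
  refine SmoothOn.const_smul (SmoothOn.mul ?_ ?_) _
  · exact smoothOn_ambN.superApply contDiffOn_rpow_neg_half fun z hz => rbody_ambN_pos hz
  · rcases e with e | κ
    · exact smoothOn_scal (contDiff_comp_ofReal (contDiff_apply ℝ ℝ e)).contDiffOn
    · exact smoothOn_const _

theorem rbody_spherePt_ne_zero {R : ℝ} (hR : 0 < R) {z : CplxIx (n + 1) → ℝ} (hz : z ≠ 0) :
    (fun e => rbody (spherePt (m := m) R z (Sum.inl e))) ≠ 0 := by
  obtain ⟨e, he⟩ := Function.ne_iff.1 hz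
  intro h
  have := congrFun h e
  simp only [rbody_spherePt, Pi.zero_apply] at this
  have h1 : 0 < (∑ e, z e ^ 2) ^ (-(1 / 2) : ℝ) := Real.rpow_pos_of_pos (sum_sq_pos hz) _
  exact mul_ne_zero hR.ne' (mul_ne_zero h1.ne' he) this

theorem contDiffOn_zpow (j : ℤ) : ContDiffOn ℝ ∞ (fun t : ℝ => t ^ j) (Set.Ioi 0) := by
  have h : ∀ t ∈ Set.Ioi (0 : ℝ), t ^ j = t ^ (j : ℝ) := fun t _ => (Real.rpow_intCast t j).symm
  refine ContDiffOn.congr (fun t ht => ?_) h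
  exact (Real.contDiffAt_rpow_const_of_ne (ne_of_gt ht)).contDiffWithinAt

theorem SmoothOn.continuousOn_berezin {f : SFun (CplxIx (n + 1)) m} {U : Set (CplxIx (n + 1) → ℝ)}
    (hf : SmoothOn U f) : ContinuousOn (fun z => berezin (f z)) U :=
  (hf.functional (berezinₗ m)).continuousOn

end AmbientFunctions

/-! ### Total volumes as integrals over the annulus -/

section TotalIntegrals

open MeasureTheory

variable {n m : ℕ}

/-- The density `N^{-(n-m+1)}` on `ℂ^{n+1|m} ∖ 0`. -/
def volDensity (z : CplxIx (n + 1) → ℝ) : Grass m := superApply (fun t => t ^ (-(n - m + 1) : ℤ)) (ambN m z)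

theorem smoothOn_volDensity : SmoothOn {z | z ≠ 0} (volDensity (n := n) (m := m)) :=
  smoothOn_ambN.superApply (contDiffOn_zpow _) fun _ hz => rbody_ambN_pos hz

theorem isRealElt_volDensity (z : CplxIx (n + 1) → ℝ) : IsRealElt (volDensity (m := m) z) := by
  refine IsRealElt.superApply ((isRealElt_scal _).add ?_) _
  have := (IsRealElt.sum (s := Finset.univ) fun (μ : Fin m) _ =>
    (isRealElt_gen (μ, 0)).mul (isRealElt_gen (μ, 1))).smul 2
  simpa [nilN] using this

theorem scaleHom_volDensity (l : ℂ) {z : CplxIx (n + 1) → ℝ} (hz : z ≠ 0) :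
    scaleHom l (volDensity (m := m) (cmul l z)) = (((‖l‖ ^ 2) ^ (-(n - m + 1) : ℤ) : ℝ) : ℂ) • volDensity z :=
  scaleHom_zpow_ambN l _ hz

theorem berezin_smul (c : ℂ) (f : Grass m) : berezin (c • f) = c * berezin f := (berezinₗ m).map_smul c f

theorem berezin_sum {ι : Type*} (s : Finset ι) (f : ι → Grass m) :
    berezin (∑ j ∈ s, f j) = ∑ j ∈ s, berezin (f j) := map_sum (berezinₗ m) f s

/-- The density contributes the exponent `-2(n-m+1)` and the odd integration `-2m`. The total
`-2(n+1)` does not depend on `m` and is the degree at which the radial integral over the annulus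
becomes that of `dt/t`. -/
theorem berezin_mul_volDensity_cmul {Q : SFun (CplxIx (n + 1)) m} {l : ℂ} (hl : l ≠ 0)
    {z : CplxIx (n + 1) → ℝ} (hz : z ≠ 0) (hQ : scaleHom l (Q (cmul l z)) = Q z) :
    berezin (Q (cmul l z) * volDensity (cmul l z)) =
      (((‖l‖ ^ (2 * n + 2))⁻¹ : ℝ) : ℂ) * berezin (Q z * volDensity z) := by
  have h := berezin_scaleHom l (Q (cmul l z) * volDensity (cmul l z))
  rw [map_mul, hQ, scaleHom_volDensity l hz, mul_smul_comm, berezin_smul] at h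
  have hl0 : 0 < ‖l‖ := norm_pos_iff.2 hl
  -- The factor `‖l‖ ^ (2 * m)` is split off because `berezin_scaleHom` puts the same factor on the
  -- other side.
  have hp : (‖l‖ ^ 2) ^ (-(n - m + 1) : ℤ) = ‖l‖ ^ (2 * m) * (‖l‖ ^ (2 * n + 2))⁻¹ := by
    rw [← zpow_natCast, ← zpow_natCast, ← zpow_natCast, ← zpow_neg, ← zpow_mul, ← zpow_add₀ hl0.ne']
    congr 1
    push_cast
    ring
  rw [hp, Complex.ofReal_mul, mul_assoc] at h
  exact (mul_left_cancel₀ (Complex.ofReal_ne_zero.2 (pow_pos hl0 _).ne') h).symm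

theorem continuousOn_berezin_mul_volDensity {Q : SFun (CplxIx (n + 1)) m} (hQ : SmoothOn {z | z ≠ 0} Q) :
    ContinuousOn (fun z => berezin (Q z * volDensity z)) {z | z ≠ 0} :=
  (hQ.mul smoothOn_volDensity).continuousOn_berezin

theorem sum_setIntegral_annulus {r : ℕ} {Q : Fin r → SFun (CplxIx (n + 1)) m}
    (hQ : ∀ j, SmoothOn {z | z ≠ 0} (Q j))
    (hsum : ∀ z, z ≠ 0 → ∑ j, berezin (Q j z * volDensity z) = berezin (volDensity (m := m) z)) :
    ∑ j, ∫ z in annulus (n + 1), berezin (Q j z * volDensity z) =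
      ∫ z in annulus (n + 1), berezin (volDensity (m := m) z) := by
  rw [← integral_finsetSum _ fun j _ => integrableOn_annulus (continuousOn_berezin_mul_volDensity (hQ j))]
  exact setIntegral_congr_fun (isClosed_annulus _).measurableSet fun z hz => hsum z (ne_zero_of_mem_annulus hz)

theorem pull_affineChart (k : Fin (n + 1)) (F : SFun (CplxIx (n + 1)) m) (x : CplxIx n → ℝ) :
    (affineChart n m k).pull F x = F (affinePt k x) := by
  rw [← superEval_stdCoord F, ← affineCoord_eq_stdCoord]
  rfl

theorem pull_hopfChart (R : ℝ) (c : Fin (n + 1) × ℝ) (F : SFun (CplxIx (n + 1)) m) (x : HopfIx n → ℝ) :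
    (hopfChart m R c).pull F x = scaleHom (phase 1 (x none))
      (superEval F (spherePt R (cmul (phase 1 (x none)) (affinePt c.1 fun i => x (some i))))) := by
  rw [superEval_map (body_scaleHom _), SuperChart.pull]
  congr 1
  funext e
  exact hopfCoord_eq_scaleHom R c.1 x e

theorem scaleHom_of_invariant {F : SFun (CplxIx (n + 1)) m}
    (h : ∀ l ∈ (⊤ : Subgroup ℂˣ), ∀ z, z ≠ 0 → superEval F (superCmul (l : ℂ) (stdCoord z)) = F z)
    {l : ℂ} (hl : l ≠ 0) {z : CplxIx (n + 1) → ℝ} (hz : z ≠ 0) : scaleHom l (F (cmul l z)) = F z := by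
  rw [← scaleHom_superEval_stdCoord]
  exact h (Units.mk0 l hl) trivial z hz

/-- The volume of `CP^{n|m}_R`. -/
def volCP (n m : ℕ) (R : ℝ) : ℝ :=
  R ^ (2 * n - 2 * m : ℤ) * (2 * Real.pi)⁻¹ * ∫ z in annulus (n + 1), (berezin (volDensity (n := n) (m := m) z)).re

/-- The density has real coefficients, so the real part in the definition of `volCP` loses nothing.
-/
theorem two_pi_mul_volCP (n m : ℕ) (R : ℝ) :
    ((2 * Real.pi : ℝ) : ℂ) * (volCP n m R : ℂ) = (R : ℂ) ^ (2 * n - 2 * m : ℤ) *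
      ∫ z in annulus (n + 1), berezin (volDensity (n := n) (m := m) z) := by
  have h : ∀ z : CplxIx (n + 1) → ℝ, berezin (volDensity (m := m) z) = ((berezin (volDensity (m := m) z)).re : ℂ) :=
    fun z => by
      apply Complex.ext
      · simp
      · simp [im_berezin_of_isRealElt (isRealElt_volDensity z)]
  rw [setIntegral_congr_fun (isClosed_annulus _).measurableSet fun z _ => h z, integral_complex_ofReal, volCP, ← Complex.ofReal_zpow, ← Complex.ofReal_mul, ← Complex.ofReal_mul]
  congr 1
  have := Real.pi_pos.ne'
  field_simp

/-- By `integral_affine` each chart integral, multiplied by `2π`, is an integral over the same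
annulus. There the partition is summed under the integral sign, so the result does not depend on it.
-/
theorem sum_chartIntegral_cp {R : ℝ} (hR : 0 < R) {r : ℕ} {c : Fin r → Fin (n + 1)}
    {ρ : Fin r → SFun (CplxIx (n + 1)) m} (hρ : IsPartition ⊤ (affineChart n m) c ρ) :
    ∑ j, chartIntegral (affineChart n m (c j)).dom
      ((affineChart n m (c j)).pull (ρ j) * cpVolumeElement m R (c j)) = volCP n m R := by
  have hinv : ∀ j, ∀ l : ℂ, l ≠ 0 → ∀ z, z ≠ 0 → berezin (ρ j (cmul l z) * volDensity (cmul l z)) =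
      (((‖l‖ ^ (2 * n + 2))⁻¹ : ℝ) : ℂ) * berezin (ρ j z * volDensity z) := fun j l hl z hz =>
    berezin_mul_volDensity_cmul hl hz (scaleHom_of_invariant (hρ.invariant j) hl hz)
  -- By homogeneity with the scalar `z^k` it suffices to consider a point of the `k`th affine chart,
  -- where the partition sums to one. The constant function 1 obeys the same homogeneity.
  have hsum : ∀ z, z ≠ 0 → ∑ j, berezin (ρ j z * volDensity z) = berezin (volDensity (m := m) z) := by
    intro z hz
    obtain ⟨k, hk⟩ := exists_toCplx_ne_zero hz
    have hz' := cmul_affinePt_affineOf hk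
    have h0 := affinePt_ne_zero k (affineOf k z)
    rw [← hz']
    simp only [hinv _ _ hk _ h0, ← Finset.mul_sum]
    have h1 := berezin_mul_volDensity_cmul (Q := fun _ => (1 : Grass m)) hk h0 (map_one _)
    simp only [one_mul] at h1
    rw [h1, ← berezin_sum, ← Finset.sum_mul]
    congr 2
    have := hρ.sum_one k (affineOf k z) trivial
    simp only [pull_affineChart] at this
    rw [this, one_mul]
  have hchart : ∀ j, chartIntegral (affineChart n m (c j)).dom
      ((affineChart n m (c j)).pull (ρ j) * cpVolumeElement m R (c j)) =
      (R : ℂ) ^ (2 * n - 2 * m : ℤ) * ∫ w, berezin (ρ j (affinePt (c j) w) * volDensity (affinePt (c j) w)) := by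
    intro j
    rw [← integral_const_mul, chartIntegral, show (affineChart n m (c j)).dom = Set.univ from rfl,
      Measure.restrict_univ]
    refine integral_congr_ae (Filter.Eventually.of_forall fun x => ?_)
    simp only [Pi.mul_apply]
    rw [cpVolumeElement_eq hR, pull_affineChart, mul_smul_comm, berezin_smul, affineN_eq_ambN]
    rfl
  have hpi : ((2 * Real.pi : ℝ) : ℂ) ≠ 0 := Complex.ofReal_ne_zero.2 (by positivity)
  apply mul_left_cancel₀ hpi
  rw [two_pi_mul_volCP, ← sum_setIntegral_annulus hρ.smooth hsum, Finset.mul_sum, Finset.mul_sum]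
  refine Finset.sum_congr rfl fun j _ => ?_
  rw [hchart, ← integral_affine (c j) (continuousOn_berezin_mul_volDensity (hρ.smooth j)) (hinv j)]
  push_cast
  ring

theorem smoothOn_superEval_spherePt {R : ℝ} (hR : 0 < R) {F : SFun (CplxIx (n + 1)) m}
    (hF : SmoothOn {z | z ≠ 0} F) : SmoothOn {z : CplxIx (n + 1) → ℝ | z ≠ 0} fun z => superEval F (spherePt R z) :=
  SmoothOn.superEval isOpen_ne_zero hF (fun e => smoothOn_spherePt R e) fun _ hz => rbody_spherePt_ne_zero hR hz

theorem berezin_scaleHom_phase (α : ℝ) (f : Grass m) : berezin (scaleHom (phase 1 α) f) = berezin f := by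
  rw [berezin_scaleHom, norm_phase one_pos, one_pow, Complex.ofReal_one, one_mul]

theorem volDensity_affinePt (k : Fin (n + 1)) (α : ℝ) (w : CplxIx n → ℝ) :
    superApply (fun t => t ^ (-(n - m + 1) : ℤ)) (affineN k w) =
      scaleHom (phase 1 α) (volDensity (m := m) (cmul (phase 1 α) (affinePt k w))) := by
  rw [scaleHom_volDensity _ (affinePt_ne_zero k w), norm_phase one_pos, one_pow, one_zpow, Complex.ofReal_one,
    one_smul, affineN_eq_ambN]
  rfl

/-- The partition is extended from the sphere to `ℂ^{n+1} ∖ 0` along the retraction. The extension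
is invariant only under positive dilations, but `setIntegral_hopf` asks for no more, and a phase
does not change Berezin integrals. -/
theorem sum_chartIntegral_sphere {R : ℝ} (hR : 0 < R) {r : ℕ} {c : Fin r → Fin (n + 1) × ℝ}
    {ρ : Fin r → SFun (CplxIx (n + 1)) m} (hρ : IsPartition ⊥ (hopfChart m R) c ρ) :
    ∑ j, chartIntegral (hopfChart m R (c j)).dom
      ((hopfChart m R (c j)).pull (ρ j) * sphereVolumeElement m R (c j).1) =
      ((2 * Real.pi * R * volCP n m R : ℝ) : ℂ) := by
  set P : Fin r → SFun (CplxIx (n + 1)) m := fun j z => superEval (ρ j) (spherePt R z) with hP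
  have hPs : ∀ j, SmoothOn {z | z ≠ 0} (P j) := fun j => smoothOn_superEval_spherePt hR (hρ.smooth j)
  have hinv : ∀ j, ∀ t : ℝ, 0 < t → ∀ z, z ≠ 0 → berezin (P j (cmul (t : ℂ) z) * volDensity (cmul (t : ℂ) z)) =
      (((t ^ (2 * n + 2))⁻¹ : ℝ) : ℂ) * berezin (P j z * volDensity z) := by
    intro j t ht z hz
    have h := berezin_mul_volDensity_cmul (Q := P j) (l := (t : ℂ)) (Complex.ofReal_ne_zero.2 ht.ne') hz ?_
    · rwa [Complex.norm_real, Real.norm_of_nonneg ht.le] at h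
    · rw [hP, superEval_map (body_scaleHom _)]
      congr 1
      funext e
      exact scaleHom_ofReal_spherePt R ht hz e
  -- Only the modulus of `z^k` is removed by homogeneity; its argument becomes the angle of the Hopf
  -- chart in which the partition sums to one.
  have hsum : ∀ z, z ≠ 0 → ∑ j, berezin (P j z * volDensity z) = berezin (volDensity (m := m) z) := by
    intro z hz
    obtain ⟨k, hk⟩ := exists_toCplx_ne_zero hz
    set α := (toCplx z k).arg with hα
    have hk' : ((‖toCplx z k‖ : ℝ) : ℂ) * phase 1 α = toCplx z k := by
      rw [phase, Complex.ofReal_one, one_mul, mul_comm Complex.I, Complex.norm_mul_exp_arg_mul_I]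
    have hz' := cmul_affinePt_affineOf hk
    rw [← hk', ← cmul_cmul_real] at hz'
    have h0 := cmul_ne_zero (phase_ne_zero one_pos α) (affinePt_ne_zero k (affineOf k z))
    have ht : 0 < ‖toCplx z k‖ := norm_pos_iff.2 hk
    rw [← hz']
    simp only [hinv _ _ ht _ h0, ← Finset.mul_sum]
    have h1 := berezin_mul_volDensity_cmul (Q := fun _ => (1 : Grass m)) (l := (‖toCplx z k‖ : ℂ))
      (Complex.ofReal_ne_zero.2 ht.ne') h0 (map_one _)
    simp only [one_mul, Complex.norm_real, Real.norm_of_nonneg ht.le] at h1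
    rw [h1, ← berezin_sum, ← Finset.sum_mul, ← berezin_scaleHom_phase α, map_mul,
      ← berezin_scaleHom_phase α (volDensity _)]
    congr 2
    -- The chart whose interval is centred at `α` contains this angle.
    have := hρ.sum_one (k, α - Real.pi) (fun o => o.elim α (affineOf k z))
      ⟨by simp [Real.pi_pos], by simp only [Option.elim]; linarith [Real.pi_pos]⟩
    simp only [pull_hopfChart, Option.elim] at this
    rw [map_sum, this, one_mul]
  have hchart : ∀ j, chartIntegral (hopfChart m R (c j)).dom
      ((hopfChart m R (c j)).pull (ρ j) * sphereVolumeElement m R (c j).1) =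
      (R : ℂ) ^ (2 * n + 1 - 2 * m : ℤ) * ∫ z in annulus (n + 1), berezin (P j z * volDensity z) := by
    intro j
    rw [← setIntegral_hopf (c j).1 (c j).2 (continuousOn_berezin_mul_volDensity (hPs j)) (hinv j),
      ← integral_const_mul, chartIntegral]
    refine integral_congr_ae (Filter.Eventually.of_forall fun x => ?_)
    simp only [Pi.mul_apply]
    rw [sphereVolumeElement_eq hR, pull_hopfChart, mul_smul_comm, berezin_smul,
      volDensity_affinePt (c j).1 (x none), ← map_mul, berezin_scaleHom_phase]
  simp only [hchart]
  rw [← Finset.mul_sum, sum_setIntegral_annulus hPs hsum]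
  have h := two_pi_mul_volCP n m R
  rw [show (2 * Real.pi * R * volCP n m R : ℝ) = R * (2 * Real.pi * volCP n m R) by ring, Complex.ofReal_mul,
    Complex.ofReal_mul (2 * Real.pi), h, ← mul_assoc]
  congr 1
  rw [← zpow_one_add₀ (Complex.ofReal_ne_zero.2 hR.ne')]
  congr 1
  ring

end TotalIntegrals

/-! ### Existence of partitions of unity -/

section Partitions

variable {n m : ℕ}

/-- Normalized cutoff functions, supported where the members of the family `q` are at least `ε`. -/
def cutoff {ι X : Type*} [Fintype ι] (q : ι → X → ℝ) (ε : ℝ) (i : ι) (z : X) : ℝ :=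
  expNegInvGlue (q i z - ε) / ∑ j, expNegInvGlue (q j z - ε)

section Cutoff

variable {ι : Type*} [Fintype ι] {N : ℕ} {q : ι → (CplxIx N → ℝ) → ℝ} {ε : ℝ}

theorem sum_expNegInvGlue_pos {z : CplxIx N → ℝ} (h : ∃ i, ε < q i z) :
    0 < ∑ j, expNegInvGlue (q j z - ε) := by
  obtain ⟨i, hi⟩ := h
  exact Finset.sum_pos' (fun _ _ => expNegInvGlue.nonneg _)
    ⟨i, Finset.mem_univ i, expNegInvGlue.pos_of_pos (sub_pos.2 hi)⟩

theorem sum_cutoff {z : CplxIx N → ℝ} (h : ∃ i, ε < q i z) : ∑ i, cutoff q ε i z = 1 := by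
  unfold cutoff
  rw [← Finset.sum_div, div_self (sum_expNegInvGlue_pos h).ne']

theorem contDiffOn_cutoff {U : Set (CplxIx N → ℝ)} (hq : ∀ i, ContDiffOn ℝ ∞ (q i) U)
    (h : ∀ z ∈ U, ∃ i, ε < q i z) (i : ι) : ContDiffOn ℝ ∞ (cutoff q ε i) U := by
  have hg : ∀ j, ContDiffOn ℝ ∞ (fun z => expNegInvGlue (q j z - ε)) U := fun j =>
    expNegInvGlue.contDiff.comp_contDiffOn ((hq j).sub contDiffOn_const)
  exact (hg i).div (ContDiffOn.sum fun j _ => hg j) fun z hz => (sum_expNegInvGlue_pos (h z hz)).ne'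

/-- Vanishing near the point, and not only at it, is needed because pulling back to a chart involves
higher derivatives at the body. -/
theorem cutoff_eventuallyEq_zero {i : ι} {z : CplxIx N → ℝ} (hq : ContinuousAt (q i) z) (h : q i z < ε) :
    cutoff q ε i =ᶠ[nhds z] 0 := by
  filter_upwards [hq.eventually_lt continuousAt_const h] with y hy
  rw [cutoff, expNegInvGlue.zero_of_nonpos (sub_nonpos.2 hy.le), zero_div, Pi.zero_apply]

end Cutoff

theorem pull_scal {I : Type} [Fintype I] [DecidableEq I] (φ : SuperChart n m I)
    (h : (CplxIx (n + 1) → ℝ) → ℂ) (x : I → ℝ) :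
    φ.pull (fun z => scal (h z)) x = taylor h fun e => φ.param (Sum.inl e) x := superEval_scal _ _

/-- Purely numerical cutoffs suffice. Their pull-backs are Taylor expansions, determined by germs at
the underlying point. So a cutoff that vanishes near this point has zero pull-back, and cutoffs that
sum to one near it have pull-backs summing to one, nilpotent parts included. -/
theorem exists_isPartition_of_cutoff {I C ι : Type} [Fintype I] [DecidableEq I] [Fintype ι]
    {Γ : Subgroup ℂˣ} {𝒜 : C → SuperChart n m I} (c : ι → C) {q : ι → (CplxIx (n + 1) → ℝ) → ℝ} {ε : ℝ}
    (hdom : ∀ d, ∀ x ∈ (𝒜 d).dom, (𝒜 d).bodyPt x ≠ 0)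
    (hq : ∀ i, ContDiffOn ℝ ∞ (q i) {z | z ≠ 0})
    (hinv : ∀ i, ∀ l ∈ Γ, ∀ z, z ≠ 0 → q i (cmul (l : ℂ) z) = q i z)
    (hε : ∀ z, z ≠ 0 → ∃ i, ε < q i z)
    (hsupp : ∀ i, ∃ K ⊆ (𝒜 (c i)).dom, IsCompact K ∧ ∀ d, ∀ x ∈ (𝒜 d).dom, ε ≤ q i ((𝒜 d).bodyPt x) →
      ∃ l ∈ Γ, ∃ y ∈ K, (𝒜 d).bodyPt x = cmul (l : ℂ) ((𝒜 (c i)).bodyPt y)) :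
    ∃ (r : ℕ) (c : Fin r → C) (ρ : Fin r → SFun (CplxIx (n + 1)) m), IsPartition Γ 𝒜 c ρ := by
  set h : ι → (CplxIx (n + 1) → ℝ) → ℂ := fun i z => (cutoff q ε i z : ℂ) with hh
  have hs : ∀ i, ContDiffOn ℝ ∞ (h i) {z | z ≠ 0} := fun i =>
    contDiff_ofReal.comp_contDiffOn (contDiffOn_cutoff hq hε i)
  have hat : ∀ i z, z ≠ 0 → ContDiffAt ℝ ∞ (h i) z := fun i z hz =>
    (hs i).contDiffAt (isOpen_ne_zero.mem_nhds hz)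
  set e := (Fintype.equivFin ι).symm
  refine ⟨Fintype.card ι, fun j => c (e j), fun j z => scal (h (e j) z), ?_, ?_, ?_, ?_, ?_⟩
  · exact fun j => smoothOn_scal (hs _)
  · exact fun j z _ => isEvenElt_scal _
  · intro j l hl z hz
    rw [scaleHom_superEval_stdCoord, scaleHom_scal]
    simp only [hh, cutoff, hinv _ l hl z hz]
  · intro j
    obtain ⟨K, hK, hKc, hKs⟩ := hsupp (e j)
    refine ⟨K, hK, hKc, fun d x hx hne => ?_⟩
    have hlt : q (e j) ((𝒜 d).bodyPt x) < ε := by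
      by_contra hge
      obtain ⟨l, hl, y, hy, hxy⟩ := hKs d x hx (not_lt.1 hge)
      exact hne l hl y hy hxy
    have h0 : h (e j) =ᶠ[nhds ((𝒜 d).bodyPt x)] fun _ => 0 := by
      filter_upwards [cutoff_eventuallyEq_zero
        ((hq (e j)).contDiffAt (isOpen_ne_zero.mem_nhds (hdom d x hx))).continuousAt hlt] with z hz
      rw [hh]
      simp only [hz, Pi.zero_apply, Complex.ofReal_zero]
    rw [pull_scal, taylor_congr h0, taylor_const, scal_eq_smul_one, zero_smul]
  · intro d x hx
    have h1 : (fun z => ∑ j, h (e j) z) =ᶠ[nhds ((𝒜 d).bodyPt x)] fun _ => 1 := by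
      filter_upwards [isOpen_ne_zero.mem_nhds (hdom d x hx)] with z hz
      rw [Equiv.sum_comp e fun i => h i z, hh]
      simp only
      rw [← Complex.ofReal_sum, sum_cutoff (hε z hz), Complex.ofReal_one]
    simp only [pull_scal]
    rw [← taylor_sum _ fun j _ => hat (e j) _ (hdom d x hx), taylor_congr h1, taylor_const, scal_eq_smul_one,
      one_smul]

theorem contDiff_sum_sq {N : ℕ} : ContDiff ℝ ∞ fun z : CplxIx N → ℝ => ∑ e, z e ^ 2 :=
  ContDiff.sum fun i _ => (contDiff_apply ℝ ℝ i).pow 2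

theorem abs_le_bodyN (w : CplxIx n → ℝ) (i : CplxIx n) : |w i| ≤ bodyN w := by
  have h : w i ^ 2 ≤ ∑ j, w j ^ 2 := Finset.single_le_sum (fun j _ => sq_nonneg (w j)) (Finset.mem_univ i)
  have h2 : |w i| ≤ 1 + w i ^ 2 := by nlinarith [sq_nonneg (|w i| - 1), sq_abs (w i)]
  unfold bodyN
  linarith

theorem isCompact_bodyN_le (B : ℝ) : IsCompact {w : CplxIx n → ℝ | bodyN w ≤ B} := by
  refine (isCompact_univ_pi fun _ => isCompact_Icc (a := -B) (b := B)).of_isClosed_subset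
    (isClosed_le contDiff_bodyN.continuous continuous_const) fun w hw i _ => ?_
  exact abs_le.1 ((abs_le_bodyN w i).trans hw)

theorem isCompact_hopf_box (a b B : ℝ) :
    IsCompact {x : HopfIx n → ℝ | x none ∈ Set.Icc a b ∧ bodyN (fun i => x (some i)) ≤ B} := by
  refine (isCompact_univ_pi fun o : HopfIx n => (?_ : IsCompact (o.elim (Set.Icc a b) fun _ => Set.Icc (-B) B))).of_isClosed_subset
    ((isClosed_Icc.preimage (continuous_apply none)).inter (isClosed_le (contDiff_bodyN.continuous.comp
      (continuous_pi fun i => continuous_apply (some i))) continuous_const)) fun x hx o _ => ?_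
  · cases o <;> exact isCompact_Icc
  · rcases o with _ | i
    · exact hx.1
    · exact abs_le.1 ((abs_le_bodyN _ i).trans hx.2)

theorem bodyPt_affineChart (k : Fin (n + 1)) (x : CplxIx n → ℝ) : (affineChart n m k).bodyPt x = affinePt k x := by
  funext e
  change rbody (affineCoord k (Sum.inl e) x) = _
  rw [affineCoord_inl, rbody_scal]

/-- The functions `|z^k|² / |z|²` are invariant and sum to one. With half of their mean `1/(n+1)` as
threshold, one of them always exceeds it. Above the threshold `b = |z|² / |z^k|²` is at most
`2(n+1)`, which confines the affine coordinates to a compact set. -/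
theorem exists_isPartition_affineChart (n m : ℕ) : ∃ (r : ℕ) (c : Fin r → Fin (n + 1))
    (ρ : Fin r → SFun (CplxIx (n + 1)) m), IsPartition ⊤ (affineChart n m) c ρ := by
  have hε : (0 : ℝ) < (2 * (n + 1) : ℝ)⁻¹ := by positivity
  refine exists_isPartition_of_cutoff (ι := Fin (n + 1)) id
    (q := fun k z => Complex.normSq (toCplx z k) / ∑ e, z e ^ 2) (ε := (2 * (n + 1) : ℝ)⁻¹) ?_ ?_ ?_ ?_ ?_
  · intro d x _
    rw [bodyPt_affineChart]
    exact affinePt_ne_zero d x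
  · intro k
    refine ContDiffOn.div ?_ contDiff_sum_sq.contDiffOn fun z hz => (sum_sq_pos hz).ne'
    simp only [toCplx, Complex.normSq_apply]
    exact (((contDiff_apply ℝ ℝ (k, 0)).mul (contDiff_apply ℝ ℝ (k, 0))).add
      ((contDiff_apply ℝ ℝ (k, 1)).mul (contDiff_apply ℝ ℝ (k, 1)))).contDiffOn
  · intro k l _ z _
    simp only [sum_sq_cmul, toCplx_cmul, map_mul]
    exact mul_div_mul_left _ _ (Complex.normSq_pos.2 l.ne_zero).ne'
  · intro z hz
    have hz' := sum_sq_pos hz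
    by_contra! h
    have h1 : ∑ k, Complex.normSq (toCplx z k) / ∑ e, z e ^ 2 = 1 := by
      rw [← Finset.sum_div, ← sum_sq_eq_sum_normSq, div_self hz'.ne']
    have h2 := Finset.sum_le_sum fun k (_ : k ∈ Finset.univ) => h k
    rw [h1] at h2
    simp only [Finset.sum_const, Finset.card_univ, Fintype.card_fin, nsmul_eq_mul] at h2
    push_cast at h2
    have h3 : ((n : ℝ) + 1) * (2 * (n + 1) : ℝ)⁻¹ = 1 / 2 := by field_simp
    rw [h3] at h2
    norm_num at h2
  · intro k
    refine ⟨{w | bodyN w ≤ 2 * (n + 1)}, Set.subset_univ _, isCompact_bodyN_le _, fun d x _ hx => ?_⟩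
    set z := (affineChart n m d).bodyPt x
    have hk : toCplx z k ≠ 0 := by
      intro h0
      simp only [h0, map_zero, zero_div] at hx
      linarith
    refine ⟨Units.mk0 _ hk, trivial, affineOf k z, ?_, ?_⟩
    · change bodyN _ ≤ _
      rw [bodyN_affineOf hk, ← Complex.normSq_eq_norm_sq, ← inv_div]
      exact inv_le_of_inv_le₀ (by positivity) hx
    · rw [id, bodyPt_affineChart, Units.val_mk0, cmul_affinePt_affineOf hk]

theorem sum_sq_bodyPt_hopfChart {R : ℝ} (hR : 0 < R) (c : Fin (n + 1) × ℝ) (x : HopfIx n → ℝ) :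
    ∑ e, (hopfChart m R c).bodyPt x e ^ 2 = R ^ 2 := by
  have hb := bodyN_pos fun i => x (some i)
  rw [bodyPt_hopfChart, sum_sq_cmul, sum_sq_affinePt, Complex.normSq_eq_norm_sq, norm_mul, norm_phase hR,
    Complex.norm_real, Real.norm_of_nonneg (Real.rpow_nonneg hb.le _), mul_pow, ← Real.rpow_natCast,
    ← Real.rpow_mul hb.le]
  norm_num
  rw [Real.rpow_neg_one]
  field_simp

/-- The direction `cos β x^k + sin β y^k`, divided by the norm. -/
def directionCos (k : Fin (n + 1)) (β : ℝ) (z : CplxIx (n + 1) → ℝ) : ℝ :=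
  (Real.cos β * z (k, 0) + Real.sin β * z (k, 1)) / Real.sqrt (∑ e, z e ^ 2)

theorem contDiffOn_directionCos (k : Fin (n + 1)) (β : ℝ) : ContDiffOn ℝ ∞ (directionCos k β) {z | z ≠ 0} := by
  refine ContDiffOn.div ?_ (contDiff_sum_sq.contDiffOn.sqrt fun z hz => (sum_sq_pos hz).ne') fun z hz =>
    (Real.sqrt_pos.2 (sum_sq_pos hz)).ne'
  exact ((contDiff_const.mul (contDiff_apply ℝ ℝ (k, 0))).add
    (contDiff_const.mul (contDiff_apply ℝ ℝ (k, 1)))).contDiffOn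

theorem exists_lt_directionCos {z : CplxIx (n + 1) → ℝ} (hz : z ≠ 0) :
    ∃ k, ∃ s t : Fin 2, ((2 * n + 3 : ℝ))⁻¹ <
      directionCos k ((s : ℕ) * (Real.pi / 2) + (t : ℕ) * Real.pi) z := by
  have hz' := sum_sq_pos hz
  have hs := Real.sqrt_pos.2 hz'
  set ε : ℝ := (2 * n + 3 : ℝ)⁻¹ with hε
  have hε0 : 0 < ε := by positivity
  -- If all `2n+2` squares were at most `ε² |z|²`, summation would give `1 ≤ (2n+2) ε²`, which fails
  -- for `ε = 1/(2n+3)`.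
  obtain ⟨⟨k, s⟩, hks⟩ : ∃ p, (ε * Real.sqrt (∑ e, z e ^ 2)) ^ 2 < z p ^ 2 := by
    by_contra! h
    have h2 := Finset.sum_le_sum fun p (_ : p ∈ Finset.univ) => h p
    simp only [Finset.sum_const, Finset.card_univ, Fintype.card_prod, Fintype.card_fin, nsmul_eq_mul, mul_pow,
      Real.sq_sqrt hz'.le] at h2
    push_cast at h2
    have h3 : ((n : ℝ) + 1) * 2 * ε ^ 2 < 1 := by
      rw [hε, inv_pow, ← div_eq_mul_inv, div_lt_one (by positivity)]
      nlinarith [Nat.cast_nonneg (α := ℝ) n]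
    nlinarith
  have habs : ε * Real.sqrt (∑ e, z e ^ 2) < |z (k, s)| := by
    rw [← abs_of_pos (mul_pos hε0 hs)]
    exact sq_lt_sq.1 hks
  -- The index `s` selects the real or imaginary part, and `t` makes its sign positive by a half
  -- turn.
  have key : ∃ t : Fin 2, Real.cos ((s : ℕ) * (Real.pi / 2) + (t : ℕ) * Real.pi) * z (k, 0) +
      Real.sin ((s : ℕ) * (Real.pi / 2) + (t : ℕ) * Real.pi) * z (k, 1) = |z (k, s)| := by
    rcases le_total 0 (z (k, s)) with h | h
    · refine ⟨0, ?_⟩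
      rw [abs_of_nonneg h]
      fin_cases s <;> simp
    · refine ⟨1, ?_⟩
      rw [abs_of_nonpos h]
      fin_cases s <;> simp [Real.cos_add_pi, Real.sin_add_pi]
  obtain ⟨t, ht⟩ := key
  exact ⟨k, s, t, by rwa [directionCos, ht, lt_div_iff₀ hs]⟩

/-- Rotate `z^k` by `-β`. The condition says that the real part of the result is at least `εR > 0`,
so its argument is at most `π/2` in absolute value. Moreover `|z^k| ≥ εR`, which bounds `|z|² /
|z^k|²` by `ε⁻²`. -/
theorem exists_bodyPt_eq_of_le_directionCos {R : ℝ} (hR : 0 < R) {k : Fin (n + 1)} {β ε : ℝ} (hε : 0 < ε)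
    {z : CplxIx (n + 1) → ℝ} (hz : ∑ e, z e ^ 2 = R ^ 2) (h : ε ≤ directionCos k β z) (c : ℝ) :
    ∃ y : HopfIx n → ℝ, (y none ∈ Set.Icc (β - Real.pi / 2) (β + Real.pi / 2) ∧
      bodyN (fun i => y (some i)) ≤ (ε ^ 2)⁻¹) ∧ (hopfChart m R (k, c)).bodyPt y = z := by
  rw [directionCos, hz, Real.sqrt_sq hR.le, le_div_iff₀ hR] at h
  set u : ℂ := toCplx z k * Complex.exp (-(Complex.I * (β : ℂ))) with hu
  have hre : u.re = Real.cos β * z (k, 0) + Real.sin β * z (k, 1) := by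
    rw [hu, show -(Complex.I * (β : ℂ)) = ((-β : ℝ) : ℂ) * Complex.I by push_cast; ring, Complex.mul_re,
      Complex.exp_ofReal_mul_I_re, Complex.exp_ofReal_mul_I_im, Real.cos_neg, Real.sin_neg]
    simp only [toCplx]
    ring
  have hnorm : ‖u‖ = ‖toCplx z k‖ := by
    rw [hu, norm_mul, show -(Complex.I * (β : ℂ)) = ((-β : ℝ) : ℂ) * Complex.I by push_cast; ring,
      Complex.norm_exp_ofReal_mul_I, mul_one]
  have hpos : 0 < ε * R := mul_pos hε hR
  rw [← hre] at h
  have hle : ε * R ≤ ‖toCplx z k‖ := h.trans ((Complex.re_le_norm u).trans hnorm.le)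
  have hk : toCplx z k ≠ 0 := norm_pos_iff.1 (hpos.trans_le hle)
  have harg := abs_le.1 (Complex.abs_arg_le_pi_div_two_iff.2 (hpos.le.trans h))
  refine ⟨hopfOf k (β + u.arg) z, ⟨?_, ?_⟩, bodyPt_hopfOf hR k c _ hz hk ?_⟩
  · change β + u.arg ∈ _
    exact ⟨by linarith [harg.1], by linarith [harg.2]⟩
  · change bodyN (affineOf k z) ≤ _
    rw [bodyN_affineOf hk, hz, ← div_pow, ← inv_pow]
    refine pow_le_pow_left₀ (by positivity) ?_ 2
    rw [div_le_iff₀ (hpos.trans_le hle), inv_mul_eq_div, le_div_iff₀ hε]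
    linarith
  · have h1 := Complex.norm_mul_exp_arg_mul_I u
    rw [hnorm] at h1
    rw [Complex.ofReal_add, mul_add, Complex.exp_add, mul_left_comm, mul_comm Complex.I (u.arg : ℂ), h1, hu,
      mul_left_comm, ← Complex.exp_add, add_neg_cancel, Complex.exp_zero, mul_one]

/-- A Hopf chart omits one direction of `z^k`, so four directions are used for each `k`. The cutoff
in the direction `β` lives on angles within `π/2` of `β`, well inside the interval of length `2π`
centred at `β`. -/
theorem exists_isPartition_hopfChart (n m : ℕ) {R : ℝ} (hR : 0 < R) :
    ∃ (r : ℕ) (c : Fin r → Fin (n + 1) × ℝ) (ρ : Fin r → SFun (CplxIx (n + 1)) m),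
      IsPartition ⊥ (hopfChart m R) c ρ := by
  have hε : (0 : ℝ) < (2 * n + 3 : ℝ)⁻¹ := by positivity
  let angle : Fin (n + 1) × Fin 2 × Fin 2 → ℝ := fun i => (i.2.1 : ℕ) * (Real.pi / 2) + (i.2.2 : ℕ) * Real.pi
  refine exists_isPartition_of_cutoff (ι := Fin (n + 1) × Fin 2 × Fin 2) (fun i => (i.1, angle i - Real.pi))
    (q := fun i => directionCos i.1 (angle i)) (ε := (2 * n + 3 : ℝ)⁻¹) ?_ ?_ ?_ ?_ ?_
  · intro d x _ h0
    have := sum_sq_bodyPt_hopfChart (m := m) hR d x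
    rw [h0] at this
    simp only [Pi.zero_apply, ne_eq, OfNat.ofNat_ne_zero, not_false_eq_true, zero_pow, Finset.sum_const_zero] at this
    exact (pow_pos hR 2).ne this
  · exact fun i => contDiffOn_directionCos _ _
  · intro i l hl z _
    rw [Subgroup.mem_bot.1 hl, Units.val_one, one_cmul_real]
  · intro z hz
    obtain ⟨k, s, t, h⟩ := exists_lt_directionCos hz
    exact ⟨(k, s, t), h⟩
  · intro i
    refine ⟨_, ?_, isCompact_hopf_box (angle i - Real.pi / 2) (angle i + Real.pi / 2) (((2 * n + 3 : ℝ)⁻¹ ^ 2)⁻¹),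
      fun d x _ hx => ?_⟩
    · rintro x ⟨⟨h1, h2⟩, _⟩
      change _ < _ ∧ _ < _
      constructor <;> linarith [Real.pi_pos]
    · obtain ⟨y, hy, hyz⟩ := exists_bodyPt_eq_of_le_directionCos (m := m) hR hε
        (sum_sq_bodyPt_hopfChart (m := m) hR d x) hx (angle i - Real.pi)
      exact ⟨1, Subgroup.one_mem _, y, hy, by rw [Units.val_one, one_cmul_real, hyz]⟩

theorem isVolumeCP_volCP (n m : ℕ) {R : ℝ} (hR : 0 < R) : IsVolumeCP n m R (volCP n m R) :=
  ⟨exists_isPartition_affineChart n m, fun _ _ _ hρ => sum_chartIntegral_cp hR hρ⟩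

theorem isVolumeSphere_volCP (n m : ℕ) {R : ℝ} (hR : 0 < R) :
    IsVolumeSphere n m R (2 * Real.pi * R * volCP n m R) :=
  ⟨exists_isPartition_hopfChart n m hR, fun _ _ _ hρ => sum_chartIntegral_sphere hR hρ⟩

end Partitions

end SuperHopf

end

theorem mainTheorem2 (n m : ℕ) (R : ℝ) (hR : 0 < R) :
    SuperHopf.IsSphereAtlas R (SuperHopf.hopfChart (n := n) m R) ∧
    (∀ k : Fin (n + 1), ∀ x : SuperHopf.HopfIx n → ℝ,
      SuperHopf.sphereVolumeElement m R k x =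
        ((R : ℂ) ^ (2 * n + 1 - 2 * m : ℤ) * (Complex.I / 2) ^ (n - m : ℤ)) •
          (SuperHopf.bracket (SuperHopf.complexHopfCoord n m) x *
            SuperHopf.superApply (fun t => t ^ (-(n - m + 1) : ℤ))
              (SuperHopf.affineN k fun i => x (some i)))) ∧
    (∀ k : Fin (n + 1),
      SuperHopf.sphereVolumeElement m R k =
        SuperHopf.arcTimes R (SuperHopf.cpVolumeElement m R k)) ∧
    ∃ v : ℝ, SuperHopf.IsVolumeCP n m R v ∧
      SuperHopf.IsVolumeSphere n m R (2 * Real.pi * R * v) :=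
  ⟨SuperHopf.isSphereAtlas_hopfChart hR, SuperHopf.sphereVolumeElement_eq_bracket hR,
    SuperHopf.sphereVolumeElement_eq_arcTimes hR, SuperHopf.volCP n m R, SuperHopf.isVolumeCP_volCP n m hR,
    SuperHopf.isVolumeSphere_volCP n m hR⟩
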